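/- Let $\Bbbk$ be a field of characteristic different from $2$ that contains an element $\sqrt{-1}$, and let $n\ge 0$. Parities are taken in $\mathbb{Z}_2$. Let $V$ be the superspace with basis $v_1,\dots,v_n$ (even), $v_{\bar 1},\dots,v_{\bar n}$ (odd), put $I_0=\{1,\dots,n\}$ and $I=\{1,\dots,n,\bar 1,\dots,\bar n\}$, and let $c:V\to V$ be the odd linear map $c(v_i)=(-1)^{|v_i|}\sqrt{-1}\,v_{\bar i}$ for $i\in I$, where $\bar{\bar i}=i$. Let $\mathfrak q=\mathfrak q(n)$ be the Lie superalgebra of all $x\in\mathfrak{gl}(V)$ with $[x,c]=0$ (graded commutator), with basis $$e_{i,j}^{\bar 0}=e_{i,j}+e_{\bar i,\bar j},\qquad e_{i,j}^{\bar 1}=e_{\bar i,j}+e_{i,\bar j}\qquad(1\le i,j\le n),$$ where the $e_{a,b}$ are the matrix units of $\mathfrak{gl}(V)$; put also $\tilde e_{i,j}^{\bar 0}=e_{i,j}-e_{\bar i,\bar j}$ and $\tilde e_{i,j}^{\bar 1}=e_{\bar i,j}-e_{i,\bar j}$. Let $U(\mathfrak q)$ be the universal enveloping superalgebra of $\mathfrak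 q$. Let $\mathcal{AOBC}$ be the degenerate affine oriented Brauer–Clifford supercategory, that is, the $\Bbbk$-linear strict monoidal supercategory generated by two objects $\uparrow,\downarrow$, even morphisms $\mathrm{cup}:\mathbb 1\to\uparrow\downarrow$, $\mathrm{cap}:\downarrow\uparrow\to\mathbb 1$, $\sigma:\uparrow\uparrow\to\uparrow\uparrow$, $x:\uparrow\to\uparrow$ and an odd morphism $\gamma:\uparrow\to\uparrow$, subject to: $\sigma^2=1$ and the braid relation for $\sigma$; the two zigzag relations for $\mathrm{cup}$, $\mathrm{cap}$; the invertibility of the morphism $\downarrow\uparrow\to\uparrow\downarrow$ given by $(\mathrm{cap}\otimes 1_{\uparrow\downarrow})(1_\downarrow\otimes\sigma\otimes 1_\downarrow)(1_{\downarrow\uparrow}\otimes\mathrm{cup})$, whose inverse is denoted $\tau:\uparrow\downarrow\to\downarrow\uparrow$; and $$\gamma^2=1,\quad \sigma(\gamma\otimes 1)=(1\otimes\gamma)\sigma,\quad \mathrm{cap}\,(1_\downarrow\otimes\gamma)\,\tau\,\mathrm{cup}=0,\quad x\gamma=-\gamma x,\quad (x\otimes 1)\sigma-\sigma(1\otimes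 x)=1_{\uparrow\uparrow}-\gamma\otimes\gamma .$$ For $k\ge0$ let $\Delta_k=\mathrm{cap}\,(1_\downarrow\otimes x^k)\,\tau\,\mathrm{cup}\in\operatorname{End}(\mathbb 1)$ be the counterclockwise bubble with $k$ dots. Let $\Psi$ be the monoidal superfunctor from $\mathcal{AOBC}$ to the endosuperfunctors of the supercategory of $U(\mathfrak q)$-supermodules with $\uparrow\,\mapsto V\otimes-$, $\downarrow\,\mapsto V^*\otimes-$ and, on components at a supermodule $M$ and for homogeneous $u,v\in V$, $f\in V^*$, $m\in M$, $$\mathrm{cup}: m\mapsto\sum_{i\in I}v_i\otimes v_i^*\otimes m,\qquad \mathrm{cap}: f\otimes v\otimes m\mapsto f(v)m,\qquad \sigma: u\otimes v\otimes m\mapsto(-1)^{|u||v|}v\otimes u\otimes m,$$ $$x: v\otimes m\mapsto\sum_{1\le i,j\le n}\big(\tilde e_{i,j}^{\bar 0}v\otimes e_{j,i}^{\bar 0}m+(-1)^{|v|}\tilde e_{i,j}^{\bar 1}v\otimes e_{j,i}^{\bar 1}m\big),\qquad \gamma: v\otimes m\mapsto c(v)\otimes m .$$ Regard $U(\mathfrak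 q)$ as the left regular supermodule and put $z_k=\Psi(\Delta_k)_{U(\mathfrak q)}(1)$. For $\varepsilon_1,\dots,\varepsilon_k\in\mathbb Z_2$ with $k\ge1$ define $\operatorname{sgn}(\varepsilon_k,\dots,\varepsilon_1)=\pm1$ by $\operatorname{sgn}(\varepsilon_1)=1$ and, for $k>1$, $$\operatorname{sgn}(\varepsilon_k,\dots,\varepsilon_1)=(-1)^{(\varepsilon_k+\bar 1)(\varepsilon_{k-1}+\cdots+\varepsilon_1)}\operatorname{sgn}(\varepsilon_{k-1},\dots,\varepsilon_1).$$ **Theorem.** For every $k\ge 0$ the supernatural transformation $\Psi(\Delta_k)$ of the identity superfunctor is even, it acts on every $U(\mathfrak q)$-supermodule as multiplication by $z_k$, and $z_k$ is an even element of the supercenter of $U(\mathfrak q)$. If $k$ is odd, then $$z_k=2\sum_{\substack{(i_k,\dots,i_1)\in I_0^k,\ (\varepsilon_k,\dots,\varepsilon_1)\in\mathbb Z_2^k\\ \varepsilon_k+\cdots+\varepsilon_1=\bar 0}}\operatorname{sgn}(\varepsilon_k,\dots,\varepsilon_1)\; e_{i_{k-1},i_k}^{\varepsilon_k}\,e_{i_{k-2},i_{k-1}}^{\varepsilon_{k-1}}\cdots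 e_{i_2,i_3}^{\varepsilon_3}\,e_{i_1,i_2}^{\varepsilon_2}\,e_{i_k,i_1}^{\varepsilon_1},$$ which for $k=1$ reads $z_1=2\sum_{i=1}^n e_{i,i}^{\bar 0}$. If $k$ is even, then $z_k=0$. -/

import Mathlib

open CategoryTheory

universe u v w

/-! ### Signs and supercategories -/

/-- The sign `(-1)^p` for a parity `p`. -/
def sg (p : ZMod 2) : ℤ := (-1) ^ p.val

@[simp] theorem sg_zero : sg 0 = 1 := rfl
@[simp] theorem sg_one : sg 1 = -1 := rfl
theorem sg_add : ∀ p q : ZMod 2, sg (p + q) = sg p * sg q := by decide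
@[simp] theorem sg_mul_self : ∀ p : ZMod 2, sg p * sg p = 1 := by decide

theorem zmod2_cases (p : ZMod 2) : p = 0 ∨ p = 1 := by revert p; decide

theorem zmod2_aux : ∀ r q : ZMod 2, r + q + 1 - r ≠ q := by decide

theorem sum_zmod2 {A : Type*} [AddCommMonoid A] (f : ZMod 2 → A) :
    ∑ p : ZMod 2, f p = f 0 + f 1 := Fin.sum_univ_two f

/-- A supercategory over `k`: a `k`-linear category whose morphism spaces are superspaces
`Hom = Hom₀ ⊕ Hom₁` with even identities and parity-additive composition. -/
class Supercategory (k : Type u) [Field k] (C : Type v) [Category.{w} C] [Preadditive C]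
    [Linear k C] where
  part (p : ZMod 2) (X Y : C) : Submodule k (X ⟶ Y)
  isCompl (X Y : C) : IsCompl (part 0 X Y) (part 1 X Y)
  id_mem (X : C) : 𝟙 X ∈ part 0 X X
  comp_mem {p q : ZMod 2} {X Y Z : C} {f : X ⟶ Y} {g : Y ⟶ Z} :
    f ∈ part p X Y → g ∈ part q Y Z → f ≫ g ∈ part (p + q) X Z

section Super

variable (k : Type u) [Field k] (C : Type v) [Category.{w} C] [Preadditive C] [Linear k C]
  [Supercategory k C]

/-- An endosuperfunctor: a functor that is `k`-linear and parity preserving on morphisms. -/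
structure Superfunctor extends C ⥤ C where
  map_add' {X Y : C} (f g : X ⟶ Y) : map (f + g) = map f + map g
  map_smul' {X Y : C} (r : k) (f : X ⟶ Y) : map (r • f) = r • map f
  map_mem {p : ZMod 2} {X Y : C} {f : X ⟶ Y} :
    f ∈ Supercategory.part (k := k) p X Y → map f ∈ Supercategory.part (k := k) p (obj X) (obj Y)

variable {k C}

/-- A supernatural transformation `η : F → G`, given by its even components `η.app 0 X` and its
odd components `η.app 1 X`. -/
structure SuperNat (F G : Superfunctor k C) where
  app (p : ZMod 2) (X : C) : F.obj X ⟶ G.obj X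
  app_mem (p : ZMod 2) (X : C) : app p X ∈ Supercategory.part (k := k) p (F.obj X) (G.obj X)
  naturality (p q : ZMod 2) {X Y : C} (f : X ⟶ Y) : f ∈ Supercategory.part (k := k) q X Y →
    F.map f ≫ app p Y = sg (p * q) • (app p X ≫ G.map f)

namespace Superfunctor

/-- The identity superfunctor. -/
abbrev id : Superfunctor k C where
  obj X := X
  map f := f
  map_add' _ _ := rfl
  map_smul' _ _ := rfl
  map_mem h := h

/-- The composition `F ∘ G`, that is `X ↦ F (G X)`; this is the tensor product of
endosuperfunctors. -/
abbrev comp (F G : Superfunctor k C) : Superfunctor k C where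
  obj X := F.obj (G.obj X)
  map f := F.map (G.map f)
  map_add' f g := by simp [G.map_add', F.map_add']
  map_smul' r f := by simp [G.map_smul', F.map_smul']
  map_mem h := F.map_mem (G.map_mem h)

theorem map_zsmul' (F : Superfunctor k C) {X Y : C} (r : ℤ) (f : X ⟶ Y) :
    F.map (r • f) = r • F.map f :=
  map_zsmul (AddMonoidHom.mk' (fun f : X ⟶ Y => F.map f) F.map_add') r f

theorem map_sum' (F : Superfunctor k C) {X Y : C} (f : ZMod 2 → (X ⟶ Y)) :
    F.map (∑ p, f p) = ∑ p, F.map (f p) :=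
  map_sum (AddMonoidHom.mk' (fun f : X ⟶ Y => F.map f) F.map_add') f _

theorem map_zero' (F : Superfunctor k C) {X Y : C} : F.map (0 : X ⟶ Y) = 0 :=
  map_zero (AddMonoidHom.mk' (fun f : X ⟶ Y => F.map f) F.map_add')

end Superfunctor

namespace SuperNat

variable {F G H K : Superfunctor k C}

/-- The morphism `η_X = η_{X,0} + η_{X,1}`. -/
def total (η : SuperNat F G) (X : C) : F.obj X ⟶ G.obj X := η.app 0 X + η.app 1 X

/-- `η` is homogeneous of parity `p`. -/
def IsHomog (η : SuperNat F G) (p : ZMod 2) : Prop := ∀ X, η.app (p + 1) X = 0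

theorem ext_app {η θ : SuperNat F G} (h : ∀ p X, η.app p X = θ.app p X) : η = θ := by
  cases η; cases θ; congr; funext p X; exact h p X

theorem ext_total {η θ : SuperNat F G} (h : ∀ X, η.total X = θ.total X) : η = θ := by
  have key : ∀ X, η.app 0 X = θ.app 0 X := by
    intro X
    have h1 : η.app 0 X - θ.app 0 X = θ.app 1 X - η.app 1 X := by
      have := h X
      simp only [total] at this
      rw [sub_eq_sub_iff_add_eq_add, this, add_comm]
    have h0 := Submodule.sub_mem _ (η.app_mem 0 X) (θ.app_mem 0 X)
    have h2 := Submodule.sub_mem _ (θ.app_mem 1 X) (η.app_mem 1 X)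
    rw [← h1] at h2
    have := (Supercategory.isCompl (k := k) (F.obj X) (G.obj X)).disjoint
    exact sub_eq_zero.1 (Submodule.disjoint_def.1 this _ h0 h2)
  refine ext_app fun p X => ?_
  rcases zmod2_cases p with rfl | rfl
  · exact key X
  · have := h X
    simpa only [total, key X, add_right_inj] using this

theorem total_of_isHomog {η : SuperNat F G} {p : ZMod 2} (h : η.IsHomog p) (X : C) :
    η.total X = η.app p X := by
  have := h X
  rcases zmod2_cases p with rfl | rfl
  · simpa [total] using this
  · have h2 : (1 : ZMod 2) + 1 = 0 := rfl
    rw [h2] at this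
    simp [total, this]

/-- The identity transformation. -/
def id (F : Superfunctor k C) : SuperNat F F where
  app p X := if p = 0 then 𝟙 _ else 0
  app_mem p X := by
    rcases zmod2_cases p with rfl | rfl
    · simpa using Supercategory.id_mem _
    · simp
  naturality p q X Y f _ := by
    rcases zmod2_cases p with rfl | rfl <;> simp

/-- Vertical composition `η ∘ θ` (first `θ`, then `η`). -/
def comp (η : SuperNat G H) (θ : SuperNat F G) : SuperNat F H where
  app p X := ∑ q : ZMod 2, θ.app (p - q) X ≫ η.app q X
  app_mem p X := Submodule.sum_mem _ fun q _ => by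
    simpa using Supercategory.comp_mem (θ.app_mem (p - q) X) (η.app_mem q X)
  naturality p r X Y f hf := by
    rw [Preadditive.comp_sum, Preadditive.sum_comp, Finset.smul_sum]
    refine Finset.sum_congr rfl fun q _ => ?_
    rw [← Category.assoc, θ.naturality _ r f hf, Preadditive.zsmul_comp, Category.assoc,
      η.naturality _ r f hf, Preadditive.comp_zsmul, smul_smul, Category.assoc, ← sg_add]
    congr 2; ring

/-- Horizontal composition `η ⊗ θ : F ∘ H → G ∘ K`, with
`(η ⊗ θ)_{X,p} = ∑_{p₁+p₂=p} η_{K X,p₁} ∘ F θ_{X,p₂}`. -/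
def hcomp (η : SuperNat F G) (θ : SuperNat H K) : SuperNat (F.comp H) (G.comp K) where
  app p X := ∑ q : ZMod 2, F.map (θ.app (p - q) X) ≫ η.app q (K.obj X)
  app_mem p X := Submodule.sum_mem _ fun q _ => by
    simpa using Supercategory.comp_mem (F.map_mem (θ.app_mem (p - q) X)) (η.app_mem q (K.obj X))
  naturality p r X Y f hf := by
    rw [Preadditive.comp_sum, Preadditive.sum_comp, Finset.smul_sum]
    refine Finset.sum_congr rfl fun q _ => ?_
    rw [← Category.assoc, ← F.map_comp, θ.naturality _ r f hf, F.map_zsmul',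
      Preadditive.zsmul_comp, F.map_comp, Category.assoc,
      η.naturality _ r _ (K.map_mem hf), Preadditive.comp_zsmul, smul_smul, Category.assoc,
      ← sg_add]
    congr 2; ring

theorem IsHomog.app_eq_zero {η : SuperNat F G} {p : ZMod 2} (h : η.IsHomog p) {q : ZMod 2}
    (hq : q ≠ p) (X : C) : η.app q X = 0 := by
  have : ∀ p q : ZMod 2, q ≠ p → q = p + 1 := by decide
  rw [this p q hq]; exact h X

theorem IsHomog.comp {η : SuperNat G H} {θ : SuperNat F G} {p q : ZMod 2} (hη : η.IsHomog p)
    (hθ : θ.IsHomog q) : (comp η θ).IsHomog (p + q) := by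
  intro X
  change ∑ r : ZMod 2, θ.app (p + q + 1 - r) X ≫ η.app r X = 0
  refine Finset.sum_eq_zero fun r _ => ?_
  by_cases hr : r = p
  · subst hr
    rw [hθ.app_eq_zero (zmod2_aux r q), Limits.zero_comp]
  · rw [hη.app_eq_zero hr, Limits.comp_zero]

theorem IsHomog.hcomp {η : SuperNat F G} {θ : SuperNat H K} {p q : ZMod 2} (hη : η.IsHomog p)
    (hθ : θ.IsHomog q) : (hcomp η θ).IsHomog (p + q) := by
  intro X
  change ∑ r : ZMod 2, F.map (θ.app (p + q + 1 - r) X) ≫ η.app r (K.obj X) = 0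
  refine Finset.sum_eq_zero fun r _ => ?_
  by_cases hr : r = p
  · subst hr
    rw [hθ.app_eq_zero (zmod2_aux r q), F.map_zero', Limits.zero_comp]
  · rw [hη.app_eq_zero hr, Limits.comp_zero]

/-- The zero transformation. -/
def zero (F G : Superfunctor k C) : SuperNat F G where
  app _ _ := 0
  app_mem _ _ := Submodule.zero_mem _
  naturality _ _ _ _ _ _ := by simp

/-- The sum of two transformations. -/
def add (η θ : SuperNat F G) : SuperNat F G where
  app p X := η.app p X + θ.app p X
  app_mem p X := Submodule.add_mem _ (η.app_mem p X) (θ.app_mem p X)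
  naturality p q X Y f hf := by
    simp [η.naturality p q f hf, θ.naturality p q f hf]

/-- A scalar multiple of a transformation. -/
def smul (r : k) (η : SuperNat F G) : SuperNat F G where
  app p X := r • η.app p X
  app_mem p X := Submodule.smul_mem _ _ (η.app_mem p X)
  naturality p q X Y f hf := by
    rw [Linear.comp_smul, Linear.smul_comp, η.naturality p q f hf, smul_comm]

/-- An even transformation from even natural components. -/
def ofEven (f : ∀ X, F.obj X ⟶ G.obj X)
    (hf : ∀ X, f X ∈ Supercategory.part (k := k) 0 (F.obj X) (G.obj X))
    (hn : ∀ {X Y : C} (g : X ⟶ Y), F.map g ≫ f Y = f X ≫ G.map g) : SuperNat F G where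
  app p X := if p = 0 then f X else 0
  app_mem p X := by
    rcases zmod2_cases p with rfl | rfl
    · simpa using hf X
    · simp
  naturality p q X Y g _ := by
    rcases zmod2_cases p with rfl | rfl <;> simp [hn]

theorem isHomog_ofEven (f : ∀ X, F.obj X ⟶ G.obj X) (hf hn) :
    (ofEven (k := k) f hf hn).IsHomog 0 :=
  fun X => if_neg (t := f X) (show ¬ ((0 : ZMod 2) + 1 = 0) by decide)

@[simp] theorem total_id (X : C) : (id F).total X = 𝟙 _ := by simp [total, id]
@[simp] theorem total_zero (X : C) : (zero F G).total X = 0 := by simp [total, zero]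
@[simp] theorem total_add (η θ : SuperNat F G) (X : C) :
    (add η θ).total X = η.total X + θ.total X := by
  simp only [total, add]; exact add_add_add_comm _ _ _ _
@[simp] theorem total_smul (r : k) (η : SuperNat F G) (X : C) :
    (smul r η).total X = r • η.total X := by simp [total, smul]
@[simp] theorem total_ofEven (f : ∀ X, F.obj X ⟶ G.obj X) (hf hn) (X : C) :
    (ofEven (k := k) f hf hn).total X = f X := by simp [total, ofEven]
@[simp] theorem total_comp (η : SuperNat G H) (θ : SuperNat F G) (X : C) :
    (comp η θ).total X = θ.total X ≫ η.total X := by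
  simp only [total, comp, sum_zmod2, sub_zero, sub_self, Preadditive.add_comp, Preadditive.comp_add]
  have : (0 : ZMod 2) - 1 = 1 := rfl
  rw [this]; abel
@[simp] theorem total_hcomp (η : SuperNat F G) (θ : SuperNat H K) (X : C) :
    (hcomp η θ).total X = F.map (θ.total X) ≫ η.total (K.obj X) := by
  simp only [total, hcomp, sum_zmod2, sub_zero, sub_self, Preadditive.add_comp,
    Preadditive.comp_add, F.map_add']
  have : (0 : ZMod 2) - 1 = 1 := rfl
  rw [this]; abel

theorem total_naturality (η : SuperNat F G) {X Y : C} {f : X ⟶ Y}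
    (hf : f ∈ Supercategory.part (k := k) 0 X Y) :
    F.map f ≫ η.total Y = η.total X ≫ G.map f := by
  simp [total, η.naturality _ 0 f hf]

end SuperNat

end Super

/-! ### The degenerate affine oriented Brauer-Clifford supercategory -/

/-- The two generating objects `↑` and `↓`. -/
inductive Letter
  | up
  | down

/-- Objects are words in `↑`, `↓`; the tensor product of objects is concatenation. -/
abbrev Word := List Letter

namespace AOBC

open Letter

/-- The generating morphisms: the leftward cup and cap, the upward crossing, the rightward crossing,
the black dot (degree one generator) and the white dot (Clifford generator). -/
inductive Gen : Word → Word → Type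
  | cup : Gen [] [up, down]
  | cap : Gen [down, up] []
  | cross : Gen [up, up] [up, up]
  | rcross : Gen [up, down] [down, up]
  | dot : Gen [up] [up]
  | cliff : Gen [up] [up]

/-- Only the white dot is odd. -/
def Gen.parity : {a b : Word} → Gen a b → ZMod 2
  | _, _, .cliff => 1
  | _, _, _ => 0

/-- Formal `k`-linear expressions in the generators, vertical composition (`comp g f` is `g ∘ f`) and
horizontal composition. -/
inductive Term (k : Type u) : Word → Word → Type u
  | gen {a b : Word} : Gen a b → Term k a b
  | id (a : Word) : Term k a a
  | comp {a b c : Word} : Term k b c → Term k a b → Term k a c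
  | tensor {a b c d : Word} : Term k a b → Term k c d → Term k (a ++ c) (b ++ d)
  | zero (a b : Word) : Term k a b
  | add {a b : Word} : Term k a b → Term k a b → Term k a b
  | smul {a b : Word} : k → Term k a b → Term k a b

infixr:60 " ⊚ " => Term.comp
infixr:70 " ⊠ " => Term.tensor

variable {k : Type u}

/-- Transport along equalities of words. -/
def Term.cast {a b a' b' : Word} (ha : a = a') (hb : b = b') (t : Term k a b) : Term k a' b' :=
  ha ▸ hb ▸ t

/-- `HasParity p t`: the expression `t` is homogeneous of parity `p`. -/
inductive HasParity : {a b : Word} → ZMod 2 → Term k a b → Prop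
  | gen {a b : Word} (g : Gen a b) : HasParity g.parity (.gen g)
  | id (a : Word) : HasParity 0 (.id a)
  | comp {a b c : Word} {p q : ZMod 2} {g : Term k b c} {f : Term k a b} :
      HasParity p g → HasParity q f → HasParity (p + q) (g ⊚ f)
  | tensor {a b c d : Word} {p q : ZMod 2} {f : Term k a b} {g : Term k c d} :
      HasParity p f → HasParity q g → HasParity (p + q) (f ⊠ g)
  | zero (p : ZMod 2) (a b : Word) : HasParity p (.zero a b)
  | add {a b : Word} {p : ZMod 2} {f g : Term k a b} :
      HasParity p f → HasParity p g → HasParity p (.add f g)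
  | smul {a b : Word} {p : ZMod 2} (r : k) {f : Term k a b} :
      HasParity p f → HasParity p (.smul r f)

/-- The leftward crossing `↓↑ → ↑↓`, built from cap, upward crossing and cup. -/
def lcross : Term k [down, up] [up, down] :=
  (.gen .cap ⊠ .id [up, down] :) ⊚ (.id [down] ⊠ .gen .cross ⊠ .id [down] :) ⊚
    (.id [down, up] ⊠ .gen .cup :)

/-- The rightward cup `𝟙 → ↓↑`. -/
def rcup : Term k [] [down, up] := .gen .rcross ⊚ .gen .cup

/-- `m` black dots on an upward strand. -/
def dots : ℕ → Term k [up] [up]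
  | 0 => .id [up]
  | m + 1 => .gen .dot ⊚ dots m

/-- The counterclockwise bubble with `m` black dots on its right-hand (upward) strand. -/
def bubbleTerm (m : ℕ) : Term k [] [] := .gen .cap ⊚ (.id [down] ⊠ dots m :) ⊚ rcup

variable [Field k]

/-- The defining relations of the supercategory. -/
inductive Defining : {a b : Word} → Term k a b → Term k a b → Prop
  | cross_sq : Defining (.gen .cross ⊚ .gen .cross) (.id [up, up])
  | braid : Defining (a := [up, up, up]) (b := [up, up, up])
      ((.gen .cross ⊠ .id [up] :) ⊚ (.id [up] ⊠ .gen .cross :) ⊚ (.gen .cross ⊠ .id [up] :))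
      ((.id [up] ⊠ .gen .cross :) ⊚ (.gen .cross ⊠ .id [up] :) ⊚ (.id [up] ⊠ .gen .cross :))
  | zigzag_up : Defining (a := [up]) (b := [up])
      ((.id [up] ⊠ .gen .cap :) ⊚ (.gen .cup ⊠ .id [up] :)) (.id [up])
  | zigzag_down : Defining (a := [down]) (b := [down])
      ((.gen .cap ⊠ .id [down] :) ⊚ (.id [down] ⊠ .gen .cup :)) (.id [down])
  | rcross_lcross : Defining (.gen .rcross ⊚ lcross) (.id [down, up])
  | lcross_rcross : Defining (lcross ⊚ .gen .rcross) (.id [up, down])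
  | cliff_sq : Defining (.gen .cliff ⊚ .gen .cliff) (.id [up])
  | cliff_cross : Defining (a := [up, up]) (b := [up, up])
      (.gen .cross ⊚ (.gen .cliff ⊠ .id [up] :)) ((.id [up] ⊠ .gen .cliff :) ⊚ .gen .cross)
  | cliff_bubble : Defining (a := []) (b := [])
      (.gen .cap ⊚ (.id [down] ⊠ .gen .cliff :) ⊚ rcup) (.zero [] [])
  | dot_cliff : Defining (.gen .dot ⊚ .gen .cliff) (.smul (-1) (.gen .cliff ⊚ .gen .dot))
  | dot_cross : Defining (a := [up, up]) (b := [up, up])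
      (.add ((.gen .dot ⊠ .id [up] :) ⊚ .gen .cross)
        (.smul (-1) (.gen .cross ⊚ (.id [up] ⊠ .gen .dot :))))
      (.add (.id [up, up]) (.smul (-1) (.gen .cliff ⊠ .gen .cliff :)))

/-- The congruence on expressions generated by the axioms of a `k`-linear strict monoidal
supercategory (with the super-interchange law) and the defining relations. -/
inductive Rel : {a b : Word} → Term k a b → Term k a b → Prop
  | defining {a b : Word} {s t : Term k a b} : Defining s t → Rel s t
  -- congruence
  | refl {a b : Word} (t : Term k a b) : Rel t t
  | symm {a b : Word} {s t : Term k a b} : Rel s t → Rel t s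
  | trans {a b : Word} {r s t : Term k a b} : Rel r s → Rel s t → Rel r t
  | comp_congr {a b c : Word} {g g' : Term k b c} {f f' : Term k a b} :
      Rel g g' → Rel f f' → Rel (g ⊚ f) (g' ⊚ f')
  | tensor_congr {a b c d : Word} {f f' : Term k a b} {g g' : Term k c d} :
      Rel f f' → Rel g g' → Rel (f ⊠ g) (f' ⊠ g')
  | add_congr {a b : Word} {f f' g g' : Term k a b} :
      Rel f f' → Rel g g' → Rel (.add f g) (.add f' g')
  | smul_congr {a b : Word} (r : k) {f f' : Term k a b} : Rel f f' → Rel (.smul r f) (.smul r f')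
  -- vector spaces
  | add_assoc {a b : Word} (f g h : Term k a b) : Rel (.add (.add f g) h) (.add f (.add g h))
  | add_comm {a b : Word} (f g : Term k a b) : Rel (.add f g) (.add g f)
  | zero_add {a b : Word} (f : Term k a b) : Rel (.add (.zero a b) f) f
  | neg_add {a b : Word} (f : Term k a b) : Rel (.add (.smul (-1) f) f) (.zero a b)
  | smul_add {a b : Word} (r : k) (f g : Term k a b) :
      Rel (.smul r (.add f g)) (.add (.smul r f) (.smul r g))
  | add_smul {a b : Word} (r s : k) (f : Term k a b) :
      Rel (.smul (r + s) f) (.add (.smul r f) (.smul s f))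
  | mul_smul {a b : Word} (r s : k) (f : Term k a b) :
      Rel (.smul (r * s) f) (.smul r (.smul s f))
  | one_smul {a b : Word} (f : Term k a b) : Rel (.smul 1 f) f
  -- category
  | id_comp {a b : Word} (f : Term k a b) : Rel (.id b ⊚ f) f
  | comp_id {a b : Word} (f : Term k a b) : Rel (f ⊚ .id a) f
  | comp_assoc {a b c d : Word} (h : Term k c d) (g : Term k b c) (f : Term k a b) :
      Rel ((h ⊚ g) ⊚ f) (h ⊚ g ⊚ f)
  | add_comp {a b c : Word} (g g' : Term k b c) (f : Term k a b) :
      Rel (.add g g' ⊚ f) (.add (g ⊚ f) (g' ⊚ f))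
  | comp_add {a b c : Word} (g : Term k b c) (f f' : Term k a b) :
      Rel (g ⊚ .add f f') (.add (g ⊚ f) (g ⊚ f'))
  | smul_comp {a b c : Word} (r : k) (g : Term k b c) (f : Term k a b) :
      Rel (.smul r g ⊚ f) (.smul r (g ⊚ f))
  | comp_smul {a b c : Word} (r : k) (g : Term k b c) (f : Term k a b) :
      Rel (g ⊚ .smul r f) (.smul r (g ⊚ f))
  -- monoidal structure
  | add_tensor {a b c d : Word} (f f' : Term k a b) (g : Term k c d) :
      Rel (.add f f' ⊠ g) (.add (f ⊠ g) (f' ⊠ g))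
  | tensor_add {a b c d : Word} (f : Term k a b) (g g' : Term k c d) :
      Rel (f ⊠ .add g g') (.add (f ⊠ g) (f ⊠ g'))
  | smul_tensor {a b c d : Word} (r : k) (f : Term k a b) (g : Term k c d) :
      Rel (.smul r f ⊠ g) (.smul r (f ⊠ g))
  | tensor_smul {a b c d : Word} (r : k) (f : Term k a b) (g : Term k c d) :
      Rel (f ⊠ .smul r g) (.smul r (f ⊠ g))
  | id_tensor_id (a b : Word) : Rel (.id a ⊠ .id b) (.id (a ++ b))
  | interchange {a b c a' b' c' : Word} {p q : ZMod 2} (f : Term k b c) (g : Term k b' c')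
      (h : Term k a b) (l : Term k a' b') : HasParity p g → HasParity q h →
      Rel ((f ⊠ g) ⊚ (h ⊠ l)) (.smul (sg (p * q) : k) ((f ⊚ h) ⊠ (g ⊚ l)))
  | unit_tensor {a b : Word} (f : Term k a b) : Rel (.id [] ⊠ f) f
  | tensor_unit {a b : Word} (f : Term k a b) :
      Rel ((f ⊠ .id []).cast (List.append_nil a) (List.append_nil b)) f
  | tensor_assoc {a b c d a' b' : Word} (f : Term k a b) (g : Term k c d) (h : Term k a' b') :
      Rel (((f ⊠ g) ⊠ h).cast (List.append_assoc a c a') (List.append_assoc b d b')) (f ⊠ g ⊠ h)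

variable (k) in
/-- The morphism spaces of the degenerate affine oriented Brauer-Clifford supercategory. -/
def Hom (a b : Word) : Type u := Quot (Rel (k := k) (a := a) (b := b))

variable (k) in
/-- The dotted bubble `Δ_m`, an endomorphism of the unit object. -/
def Delta (m : ℕ) : Hom k [] [] := Quot.mk _ (bubbleTerm m)

end AOBC

/-! ### Strict monoidal interpretations in endosuperfunctors -/

namespace AOBC

section Interp

variable {k : Type u} [Field k] {C : Type v} [Category.{w} C] [Preadditive C] [Linear k C]
  [Supercategory k C] (Φ : Letter → Superfunctor k C)

/-- The endosuperfunctor of a word: the composition of the endosuperfunctors of its letters. -/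
def obj : Word → Superfunctor k C
  | [] => Superfunctor.id
  | x :: a => (Φ x).comp (obj a)

/-- The coherence isomorphism `obj (a ++ c) ≅ obj a ∘ obj c`. -/
def mu : (a c : Word) → (X : C) → ((obj Φ (a ++ c)).obj X ≅ (obj Φ a).obj ((obj Φ c).obj X))
  | [], _, _ => Iso.refl _
  | x :: a, c, X => (Φ x).mapIso (mu a c X)

theorem mu_hom_mem (a c : Word) (X : C) :
    (mu Φ a c X).hom ∈ Supercategory.part (k := k) 0 _ _ := by
  induction a with
  | nil => exact Supercategory.id_mem _
  | cons x a ih => exact (Φ x).map_mem ih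

theorem mu_inv_mem (a c : Word) (X : C) :
    (mu Φ a c X).inv ∈ Supercategory.part (k := k) 0 _ _ := by
  induction a with
  | nil => exact Supercategory.id_mem _
  | cons x a ih => exact (Φ x).map_mem ih

theorem mu_natural (a c : Word) {X Y : C} (f : X ⟶ Y) :
    (obj Φ (a ++ c)).map f ≫ (mu Φ a c Y).hom =
      (mu Φ a c X).hom ≫ (obj Φ a).map ((obj Φ c).map f) := by
  induction a with
  | nil => exact (Category.comp_id _).trans (Category.id_comp _).symm
  | cons x a ih =>
    change (Φ x).map ((obj Φ (a ++ c)).map f) ≫ (Φ x).map (mu Φ a c Y).hom =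
      (Φ x).map (mu Φ a c X).hom ≫ (Φ x).map ((obj Φ a).map ((obj Φ c).map f))
    rw [← Functor.map_comp, ← Functor.map_comp, ih]

theorem mu_inv_natural (a c : Word) {X Y : C} (f : X ⟶ Y) :
    (obj Φ a).map ((obj Φ c).map f) ≫ (mu Φ a c Y).inv =
      (mu Φ a c X).inv ≫ (obj Φ (a ++ c)).map f := by
  rw [Iso.comp_inv_eq, Category.assoc, mu_natural, Iso.inv_hom_id_assoc]

theorem mu_nil (a : Word) (X : C) :
    (mu Φ a [] X).hom = eqToHom (congrArg (fun w => (obj Φ w).obj X) (List.append_nil a)) := by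
  induction a with
  | nil => rfl
  | cons x a ih =>
    change (Φ x).map (mu Φ a [] X).hom = _
    rw [ih]
    exact eqToHom_map _ _

theorem mu_nil_inv (a : Word) (X : C) :
    (mu Φ a [] X).inv = eqToHom (congrArg (fun w => (obj Φ w).obj X) (List.append_nil a).symm) := by
  induction a with
  | nil => rfl
  | cons x a ih =>
    change (Φ x).map (mu Φ a [] X).inv = _
    rw [ih]
    exact eqToHom_map _ _

theorem mu_assoc (a c e : Word) (X : C) :
    (mu Φ (a ++ c) e X).hom ≫ (mu Φ a c _).hom =
      eqToHom (by rw [List.append_assoc]) ≫ (mu Φ a (c ++ e) X).hom ≫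
        (obj Φ a).map (mu Φ c e X).hom := by
  induction a with
  | nil =>
    change (mu Φ c e X).hom ≫ 𝟙 _ = 𝟙 _ ≫ 𝟙 _ ≫ (mu Φ c e X).hom
    simp
  | cons x a ih =>
    change (Φ x).map (mu Φ (a ++ c) e X).hom ≫ (Φ x).map (mu Φ a c _).hom = _
    rw [← Functor.map_comp, ih, Functor.map_comp, Functor.map_comp, eqToHom_map]
    rfl

variable (γ : ∀ {a b : Word}, Gen a b → SuperNat (obj Φ a) (obj Φ b))

/-- The coherence isomorphism as an even supernatural transformation. -/
def muHom (a c : Word) : SuperNat (obj Φ (a ++ c)) ((obj Φ a).comp (obj Φ c)) :=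
  SuperNat.ofEven (fun X => (mu Φ a c X).hom) (mu_hom_mem Φ a c) (mu_natural Φ a c)

/-- The inverse coherence isomorphism as an even supernatural transformation. -/
def muInv (a c : Word) : SuperNat ((obj Φ a).comp (obj Φ c)) (obj Φ (a ++ c)) :=
  SuperNat.ofEven (fun X => (mu Φ a c X).inv) (mu_inv_mem Φ a c) (mu_inv_natural Φ a c)

theorem isHomog_muHom (a c : Word) : (muHom Φ a c).IsHomog 0 := SuperNat.isHomog_ofEven _ _ _

theorem isHomog_muInv (a c : Word) : (muInv Φ a c).IsHomog 0 := SuperNat.isHomog_ofEven _ _ _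

/-- The interpretation of expressions, given supernatural transformations for the generators. -/
def interp : {a b : Word} → Term k a b → SuperNat (obj Φ a) (obj Φ b)
  | _, _, .gen g => γ g
  | _, _, .id a => SuperNat.id (obj Φ a)
  | _, _, .comp g f => (interp g).comp (interp f)
  | _, _, .tensor (a := a) (b := b) (c := c) (d := d) f g =>
      (muInv Φ b d).comp (((interp f).hcomp (interp g)).comp (muHom Φ a c))
  | _, _, .zero a b => SuperNat.zero (obj Φ a) (obj Φ b)
  | _, _, .add f g => (interp f).add (interp g)
  | _, _, .smul r f => (interp f).smul r

theorem interp_tensor_total {a b c d : Word} (f : Term k a b) (g : Term k c d) (X : C) :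
    (interp Φ γ (f ⊠ g)).total X =
      (mu Φ a c X).hom ≫ ((obj Φ a).map ((interp Φ γ g).total X) ≫
        (interp Φ γ f).total ((obj Φ d).obj X)) ≫ (mu Φ b d X).inv := by
  simp [interp, muHom, muInv]

theorem interp_cast_total {a b a' b' : Word} (ha : a = a') (hb : b = b') (t : Term k a b) (X : C) :
    (interp Φ γ (t.cast ha hb)).total X =
      eqToHom (by rw [ha]) ≫ (interp Φ γ t).total X ≫ eqToHom (by rw [hb]) := by
  subst ha hb; simp [Term.cast]

theorem interp_isHomog
    (hγ : ∀ {a b : Word} (g : Gen a b), (γ g).IsHomog g.parity) {a b : Word} {t : Term k a b} {p : ZMod 2} (h : HasParity p t) :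
    (interp Φ γ t).IsHomog p := by
  induction h with
  | gen g => exact hγ g
  | id a => intro X; exact if_neg (t := 𝟙 ((obj Φ a).obj X)) (show ¬ ((0 : ZMod 2) + 1 = 0) by decide)
  | comp _ _ ih₁ ih₂ => exact ih₁.comp ih₂
  | tensor _ _ ih₁ ih₂ =>
    have h := (isHomog_muInv Φ _ _).comp ((ih₁.hcomp ih₂).comp (isHomog_muHom Φ _ _))
    rwa [zero_add, add_zero] at h
  | zero p a b => intro X; rfl
  | add _ _ ih₁ ih₂ =>
    intro X
    have h₁ := ih₁ X
    have h₂ := ih₂ X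
    simp only [interp, SuperNat.add, h₁, h₂, add_zero]
  | smul r _ ih =>
    intro X
    have h₁ := ih X
    simp only [interp, SuperNat.smul, h₁, smul_zero]

theorem interp_tensor_assoc {a b c d a' b' : Word} (f : Term k a b) (g : Term k c d)
    (h : Term k a' b') (X : C) :
    (interp Φ γ ((f ⊠ g) ⊠ h)).total X ≫ eqToHom (by rw [List.append_assoc]) =
      eqToHom (by rw [List.append_assoc]) ≫ (interp Φ γ (f ⊠ g ⊠ h)).total X := by
  have key : (mu Φ (b ++ d) b' X).inv ≫ eqToHom (by rw [List.append_assoc]) =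
      (mu Φ b d _).hom ≫ (obj Φ b).map (mu Φ d b' X).inv ≫ (mu Φ b (d ++ b') X).inv := by
    rw [Iso.inv_comp_eq, ← Category.assoc, ← Category.assoc, Iso.eq_comp_inv,
      ← Functor.mapIso_inv, Iso.eq_comp_inv, Functor.mapIso_hom, mu_assoc, Category.assoc]
  rw [interp_tensor_total, Category.assoc, Category.assoc, key, interp_tensor_total,
    interp_tensor_total, interp_tensor_total]
  simp only [Category.assoc, Functor.map_comp, Iso.inv_hom_id_assoc]
  have hn := SuperNat.total_naturality (interp Φ γ f) (mu_inv_mem Φ d b' X)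
  rw [reassoc_of% hn]
  have hm := mu_assoc Φ a c a' X
  have hn2 := mu_natural Φ a c ((interp Φ γ h).total X)
  rw [reassoc_of% hn2, reassoc_of% hm]

theorem interp_interchange
    (hγ : ∀ {a b : Word} (g : Gen a b), (γ g).IsHomog g.parity) {a b c a' b' c' : Word} {p q : ZMod 2} (f : Term k b c)
    (g : Term k b' c') (h : Term k a b) (l : Term k a' b') (hg : HasParity p g)
    (hh : HasParity q h) (X : C) :
    (interp Φ γ ((f ⊠ g) ⊚ (h ⊠ l))).total X =
      sg (p * q) • (interp Φ γ ((f ⊚ h) ⊠ (g ⊚ l))).total X := by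
  have hg' := interp_isHomog Φ γ hγ hg
  have hh' := interp_isHomog Φ γ hγ hh
  have hn := (interp Φ γ h).naturality q p _ ((interp Φ γ g).app_mem p X)
  rw [← SuperNat.total_of_isHomog hg', ← SuperNat.total_of_isHomog hh',
    ← SuperNat.total_of_isHomog hh'] at hn
  have hn' : (interp Φ γ h).total ((obj Φ b').obj X) ≫ (obj Φ b).map ((interp Φ γ g).total X) =
      sg (p * q) • ((obj Φ a).map ((interp Φ γ g).total X) ≫
        (interp Φ γ h).total ((obj Φ c').obj X)) := by
    rw [hn, smul_smul, mul_comm q p, sg_mul_self, one_smul]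
  change (SuperNat.comp (interp Φ γ (f ⊠ g)) (interp Φ γ (h ⊠ l))).total X = _
  rw [SuperNat.total_comp, interp_tensor_total, interp_tensor_total, interp_tensor_total]
  simp only [interp, SuperNat.total_comp, Category.assoc, Functor.map_comp,
    Iso.inv_hom_id_assoc]
  rw [reassoc_of% hn']
  simp only [Preadditive.zsmul_comp, Preadditive.comp_zsmul, Category.assoc]

theorem interp_sound
    (hγ : ∀ {a b : Word} (g : Gen a b), (γ g).IsHomog g.parity)
    (hd : ∀ {a b : Word} {s t : Term k a b}, Defining s t → interp Φ γ s = interp Φ γ t)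
    {a b : Word} {s t : Term k a b} (h : Rel s t) : interp Φ γ s = interp Φ γ t := by
  induction h with
  | defining h => exact hd h
  | refl t => rfl
  | symm _ ih => exact ih.symm
  | trans _ _ ih₁ ih₂ => exact ih₁.trans ih₂
  | comp_congr _ _ ih₁ ih₂ => simp only [interp, ih₁, ih₂]
  | tensor_congr _ _ ih₁ ih₂ => simp only [interp, ih₁, ih₂]
  | add_congr _ _ ih₁ ih₂ => simp only [interp, ih₁, ih₂]
  | smul_congr r _ ih => simp only [interp, ih]
  | interchange f g h l hg hh =>
    refine SuperNat.ext_total fun X => ?_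
    rw [interp_interchange Φ γ hγ f g h l hg hh]
    simp only [interp, SuperNat.total_smul, Int.cast_smul_eq_zsmul]
  | unit_tensor f =>
    refine SuperNat.ext_total fun X => ?_
    rw [interp_tensor_total]
    simp [mu, interp, obj]
  | tensor_unit f =>
    refine SuperNat.ext_total fun X => ?_
    rw [interp_cast_total, interp_tensor_total, mu_nil, mu_nil_inv]
    have h₀ : (interp Φ γ (Term.id [])).total X = 𝟙 _ := SuperNat.total_id X
    rw [h₀, CategoryTheory.Functor.map_id]
    change eqToHom _ ≫ (eqToHom _ ≫ (𝟙 _ ≫ (interp Φ γ f).total X) ≫ eqToHom _) ≫ eqToHom _ =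
      (interp Φ γ f).total X
    simp
  | tensor_assoc f g h =>
    refine SuperNat.ext_total fun X => ?_
    rw [interp_cast_total, interp_tensor_assoc]
    simp
  | add_assoc f g h =>
    refine SuperNat.ext_total fun X => ?_
    simp [interp, add_assoc]
  | add_comm f g =>
    refine SuperNat.ext_total fun X => ?_
    simp [interp, add_comm]
  | _ =>
    refine SuperNat.ext_total fun X => ?_
    simp [interp, muHom, muInv, Superfunctor.map_add', Superfunctor.map_smul', add_smul, mul_smul]

end Interp

end AOBC

/-! ### The Lie superalgebra `q(n)` and its enveloping superalgebra -/

namespace TypeQ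

/-- The index set `I`: `(i, 0)` stands for `i` and `(i, 1)` for `ī`; the second entry is the parity
of the basis vector. -/
abbrev Idx (n : ℕ) := Fin n × ZMod 2

/-- The matrices of the elements of `gl(V)`, where `V` has basis indexed by `I`. -/
abbrev Mat (k : Type u) (n : ℕ) := Matrix (Idx n) (Idx n) k

/-- A square root of `-1` in `k`. -/
structure SqrtNegOne (k : Type u) [Field k] where
  val : k
  sq : val * val = -1

section

variable {k : Type u} [Field k] {n : ℕ}

/-- The component of parity `p` of a matrix. -/
def matPart (p : ZMod 2) : Mat k n →ₗ[k] Mat k n where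
  toFun X := Matrix.of fun a b => if a.2 + b.2 = p then X a b else 0
  map_add' X Y := by ext a b; by_cases h : a.2 + b.2 = p <;> simp [h]
  map_smul' r X := by ext a b; by_cases h : a.2 + b.2 = p <;> simp [h]

/-- A matrix is homogeneous of parity `p`. -/
def MatHomog (p : ZMod 2) (X : Mat k n) : Prop := ∀ a b, a.2 + b.2 ≠ p → X a b = 0

/-- The graded commutator, `[X, Y] = XY - (-1)^{|X||Y|} YX` on homogeneous elements. -/
def superBracket (X Y : Mat k n) : Mat k n :=
  ∑ p : ZMod 2, ∑ r : ZMod 2,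
    (matPart p X * matPart r Y - sg (p * r) • (matPart r Y * matPart p X))

theorem matPart_apply (p : ZMod 2) (X : Mat k n) (a b : Idx n) :
    matPart p X a b = if a.2 + b.2 = p then X a b else 0 := rfl

theorem matPart_self {p : ZMod 2} {X : Mat k n} (h : MatHomog p X) : matPart p X = X := by
  ext a b
  rw [matPart_apply]
  split_ifs with hab
  · rfl
  · exact (h a b hab).symm

theorem matPart_ne {p r : ZMod 2} {X : Mat k n} (h : MatHomog p X) (hr : r ≠ p) :
    matPart r X = 0 := by
  ext a b
  rw [matPart_apply]
  split_ifs with hab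
  · exact h a b (by rw [hab]; exact hr)
  · rfl

theorem matHomog_matPart (p : ZMod 2) (X : Mat k n) : MatHomog p (matPart p X) := by
  intro a b h; rw [matPart_apply, if_neg h]

theorem matPart_add (X : Mat k n) : matPart 0 X + matPart 1 X = X := by
  ext a b
  simp only [Matrix.add_apply, matPart_apply]
  rcases zmod2_cases (a.2 + b.2) with h | h <;> simp [h]

theorem superBracket_of_homog {p r : ZMod 2} {X Y : Mat k n} (hX : MatHomog p X)
    (hY : MatHomog r Y) : superBracket X Y = X * Y - sg (p * r) • (Y * X) := by
  unfold superBracket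
  rw [Finset.sum_eq_single p, Finset.sum_eq_single r, matPart_self hX, matPart_self hY]
  · intro b _ hb; simp [matPart_ne hY hb]
  · simp
  · intro b _ hb; simp [matPart_ne hX hb]
  · simp

theorem matHomog_mul {p r : ZMod 2} {X Y : Mat k n} (hX : MatHomog p X) (hY : MatHomog r Y) :
    MatHomog (p + r) (X * Y) := by
  intro a b hab
  rw [Matrix.mul_apply]
  refine Finset.sum_eq_zero fun c _ => ?_
  by_cases h : a.2 + c.2 = p
  · rw [hY c b, mul_zero]
    rintro rfl
    apply hab
    rw [← h]
    generalize a.2 = x; generalize b.2 = y; generalize c.2 = z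
    revert x y z; decide
  · rw [hX a c h, zero_mul]

theorem matHomog_superBracket {p r : ZMod 2} {X Y : Mat k n} (hX : MatHomog p X)
    (hY : MatHomog r Y) : MatHomog (p + r) (superBracket X Y) := by
  intro a b hab
  rw [superBracket_of_homog hX hY, Matrix.sub_apply, Matrix.smul_apply, matHomog_mul hX hY a b hab,
    matHomog_mul hY hX a b (by rwa [add_comm r p]), smul_zero, sub_zero]

variable (n) in
/-- The odd map `c`, with `c v_i = (-1)^{|v_i|} √-1 v_ī` for all `i ∈ I`. -/
def cMat (s : SqrtNegOne k) : Mat k n :=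
  Matrix.of fun a b => if a.1 = b.1 ∧ a.2 = b.2 + 1 then sg b.2 • s.val else 0

variable (n) in
/-- The Lie superalgebra `q(n)`: the matrices whose graded commutator with `c` vanishes. -/
def q (s : SqrtNegOne k) : Submodule k (Mat k n) where
  carrier := {X | superBracket X (cMat n s) = 0}
  zero_mem' := by simp [superBracket]
  add_mem' {X Y} hX hY := by
    have : superBracket (X + Y) (cMat n s) =
        superBracket X (cMat n s) + superBracket Y (cMat n s) := by
      simp only [superBracket, sum_zmod2, map_add, add_mul, mul_add, smul_add]; abel
    simp only [Set.mem_ofPred_eq] at hX hY ⊢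
    rw [this, hX, hY, add_zero]
  smul_mem' r X hX := by
    have : superBracket (r • X) (cMat n s) = r • superBracket X (cMat n s) := by
      simp only [superBracket, map_smul, Matrix.smul_mul, Matrix.mul_smul, Finset.smul_sum,
        smul_sub, smul_comm r]
    simp only [Set.mem_ofPred_eq] at hX ⊢
    rw [this, hX, smul_zero]

variable {s : SqrtNegOne k}

theorem s_ne_zero (s : SqrtNegOne k) : s.val ≠ 0 := by
  intro h; have := s.sq; rw [h] at this; simp at this

theorem cMat_homog : MatHomog 1 (cMat n s) := by
  intro a b h
  simp only [cMat, Matrix.of_apply]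
  rw [if_neg]
  rintro ⟨-, h2⟩
  apply h; rw [h2]; generalize b.2 = x; revert x; decide

theorem mul_cMat (X : Mat k n) (a : Idx n) (j : Fin n) (r : ZMod 2) :
    (X * cMat n s) a (j, r) = X a (j, r + 1) * (sg r • s.val) := by
  rw [Matrix.mul_apply, Finset.sum_eq_single (j, r + 1)]
  · simp [cMat]
  · rintro ⟨l, d⟩ _ h
    simp only [cMat, Matrix.of_apply]
    rw [if_neg, mul_zero]
    rintro ⟨rfl, rfl⟩; exact h rfl
  · simp

theorem cMat_mul (X : Mat k n) (b : Idx n) (i : Fin n) (p : ZMod 2) :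
    (cMat n s * X) (i, p) b = (sg (p + 1) • s.val) * X (i, p + 1) b := by
  have h2 : ∀ p : ZMod 2, p + 1 + 1 = p := by decide
  rw [Matrix.mul_apply, Finset.sum_eq_single (i, p + 1)]
  · simp [cMat, h2]
  · rintro ⟨l, d⟩ _ h
    simp only [cMat, Matrix.of_apply]
    rw [if_neg, zero_mul]
    rintro ⟨rfl, h3⟩; apply h; rw [h3, h2]
  · simp

/-- `q(n)` consists of the matrices that are invariant under `i ↔ ī`. -/
theorem mem_q {X : Mat k n} :
    X ∈ q n s ↔ ∀ i j p r, X (i, p + 1) (j, r + 1) = X (i, p) (j, r) := by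
  have h2 : ∀ p : ZMod 2, p + 1 + 1 = p := by decide
  have key : ∀ i j p r, superBracket X (cMat n s) (i, p) (j, r) =
      (sg r • s.val) * (X (i, p) (j, r + 1) - X (i, p + 1) (j, r)) := by
    intro i j p r
    have : superBracket X (cMat n s) = superBracket (matPart 0 X) (cMat n s) +
        superBracket (matPart 1 X) (cMat n s) := by
      rw [superBracket_of_homog (matHomog_matPart 0 X) cMat_homog,
        superBracket_of_homog (matHomog_matPart 1 X) cMat_homog]
      simp [superBracket, sum_zmod2, matPart_self (cMat_homog (s := s)),
        matPart_ne (cMat_homog (s := s)) (show (0 : ZMod 2) ≠ 1 by decide)]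
      abel
    rw [this, superBracket_of_homog (matHomog_matPart 0 X) cMat_homog,
        superBracket_of_homog (matHomog_matPart 1 X) cMat_homog]
    simp only [Matrix.add_apply, Matrix.sub_apply, Matrix.smul_apply, mul_cMat, cMat_mul,
      matPart_apply]
    have e1 : (1 : ZMod 2) + 1 = 0 := rfl
    rcases zmod2_cases p with rfl | rfl <;> rcases zmod2_cases r with rfl | rfl <;>
      simp [e1] <;> ring
  constructor
  · intro h i j p r
    have h0 := key i j p (r + 1)
    have h1 : superBracket X (cMat n s) = 0 := h
    rw [h1, Matrix.zero_apply, h2] at h0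
    have : (sg (r + 1) • s.val) ≠ 0 := by
      rcases zmod2_cases (r + 1) with h | h <;> simp [h, s_ne_zero]
    have := (mul_eq_zero.1 h0.symm).resolve_left this
    exact (sub_eq_zero.1 this).symm
  · intro h
    change superBracket X (cMat n s) = 0
    ext ⟨i, p⟩ ⟨j, r⟩
    rw [key, ← h i j p (r + 1), h2, sub_self, mul_zero, Matrix.zero_apply]

theorem matPart_mem_q (p : ZMod 2) {X : Mat k n} (h : X ∈ q n s) : matPart p X ∈ q n s := by
  rw [mem_q] at h ⊢
  intro i j a b
  rw [matPart_apply, matPart_apply, h]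
  have : ∀ a b : ZMod 2, a + 1 + (b + 1) = a + b := by decide
  simp [this]

theorem mul_mem_q {X Y : Mat k n} (hX : X ∈ q n s) (hY : Y ∈ q n s) : X * Y ∈ q n s := by
  rw [mem_q] at hX hY ⊢
  intro i j a b
  rw [Matrix.mul_apply, Matrix.mul_apply, Fintype.sum_prod_type, Fintype.sum_prod_type]
  refine Finset.sum_congr rfl fun l _ => ?_
  rw [← Equiv.sum_comp (Equiv.addRight (1 : ZMod 2))]
  exact Finset.sum_congr rfl fun d _ => by simp [hX, hY]

theorem superBracket_mem_q {X Y : Mat k n} (hX : X ∈ q n s) (hY : Y ∈ q n s) :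
    superBracket X Y ∈ q n s :=
  Submodule.sum_mem _ fun _ _ => Submodule.sum_mem _ fun _ _ => Submodule.sub_mem _
    (mul_mem_q (matPart_mem_q _ hX) (matPart_mem_q _ hY))
    (zsmul_mem (mul_mem_q (matPart_mem_q _ hY) (matPart_mem_q _ hX)) _)

/-- The bracket of `q(n)`. -/
def qBracket (x y : q n s) : q n s := ⟨superBracket x.1 y.1, superBracket_mem_q x.2 y.2⟩

/-- The component of parity `p` of an element of `q(n)`. -/
def qPart (p : ZMod 2) : q n s →ₗ[k] q n s :=
  (matPart p).restrict fun _ h => matPart_mem_q p h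

theorem qPart_homog (p : ZMod 2) (x : q n s) : MatHomog p (qPart p x).1 := matHomog_matPart p x.1
theorem qPart_add (x : q n s) : qPart 0 x + qPart 1 x = x := Subtype.ext (matPart_add x.1)
theorem qPart_self {p : ZMod 2} {x : q n s} (h : MatHomog p x.1) : qPart p x = x :=
  Subtype.ext (matPart_self h)
theorem qPart_ne {p r : ZMod 2} {x : q n s} (h : MatHomog p x.1) (hr : r ≠ p) : qPart r x = 0 :=
  Subtype.ext (matPart_ne h hr)

variable (n s) in
/-- The relations `xy - (-1)^{|x||y|} yx = [x, y]` of the enveloping superalgebra. -/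
inductive UqRel : TensorAlgebra k (q n s) → TensorAlgebra k (q n s) → Prop
  | bracket (p r : ZMod 2) (x y : q n s) : MatHomog p x.1 → MatHomog r y.1 →
      UqRel (TensorAlgebra.ι k x * TensorAlgebra.ι k y -
          sg (p * r) • (TensorAlgebra.ι k y * TensorAlgebra.ι k x))
        (TensorAlgebra.ι k (qBracket x y))

variable (n s) in
/-- The universal enveloping superalgebra `U(q(n))`. -/
def Uq : Type u := RingQuot (UqRel n s)

namespace Uq

instance : Ring (Uq n s) := inferInstanceAs (Ring (RingQuot (UqRel n s)))
instance : Algebra k (Uq n s) := inferInstanceAs (Algebra k (RingQuot (UqRel n s)))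

/-- The canonical map `q(n) → U(q(n))`. -/
def ι : q n s →ₗ[k] Uq n s :=
  (RingQuot.mkAlgHom k (UqRel n s)).toLinearMap ∘ₗ TensorAlgebra.ι k

theorem ι_bracket {p r : ZMod 2} {x y : q n s} (hx : MatHomog p x.1) (hy : MatHomog r y.1) :
    ι (qBracket x y) = ι x * ι y - sg (p * r) • (ι y * ι x) := by
  have := RingQuot.mkAlgHom_rel k (UqRel.bracket p r x y hx hy)
  simp only [map_sub, map_mul, map_zsmul] at this
  exact this.symm

/-- The universal property of `U(q(n))`. -/
def lift {B : Type*} [Ring B] [Algebra k B] (f : q n s →ₗ[k] B)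
    (hf : ∀ (p r : ZMod 2) (x y : q n s), MatHomog p x.1 → MatHomog r y.1 →
      f (qBracket x y) = f x * f y - sg (p * r) • (f y * f x)) : Uq n s →ₐ[k] B :=
  RingQuot.liftAlgHom k ⟨TensorAlgebra.lift k f, by
    rintro _ _ ⟨p, r, x, y, hx, hy⟩
    simp only [map_sub, map_mul, map_zsmul, TensorAlgebra.lift_ι_apply]
    exact (hf p r x y hx hy).symm⟩

@[simp] theorem lift_ι {B : Type*} [Ring B] [Algebra k B] (f : q n s →ₗ[k] B) (hf) (x : q n s) :
    lift f hf (ι x) = f x := by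
  change RingQuot.liftAlgHom k _ (RingQuot.mkAlgHom k (UqRel n s) (TensorAlgebra.ι k x)) = f x
  rw [RingQuot.liftAlgHom_mkAlgHom_apply, TensorAlgebra.lift_ι_apply]

theorem induction {P : Uq n s → Prop} (hr : ∀ r : k, P (algebraMap k _ r)) (hι : ∀ x, P (ι x))
    (hm : ∀ a b, P a → P b → P (a * b)) (ha : ∀ a b, P a → P b → P (a + b)) (a : Uq n s) : P a := by
  obtain ⟨t, rfl⟩ := RingQuot.mkAlgHom_surjective k (UqRel n s) a
  induction t using TensorAlgebra.induction with
  | algebraMap r =>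
    rw [AlgHom.commutes]; exact hr r
  | ι x => exact hι x
  | mul a b h₁ h₂ => rw [map_mul]; exact hm _ _ h₁ h₂
  | add a b h₁ h₂ => rw [map_add]; exact ha _ _ h₁ h₂

theorem par_aux (p r : ZMod 2) (x y : q n s) (hx : MatHomog p x.1) (hy : MatHomog r y.1) :
    (ι ∘ₗ (qPart 0 - qPart 1)) (qBracket x y) =
      (ι ∘ₗ (qPart 0 - qPart 1)) x * (ι ∘ₗ (qPart 0 - qPart 1)) y -
        sg (p * r) • ((ι ∘ₗ (qPart 0 - qPart 1)) y * (ι ∘ₗ (qPart 0 - qPart 1)) x) := by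
  have hom : ∀ (p : ZMod 2) (z : q n s), MatHomog p z.1 →
      (ι ∘ₗ (qPart 0 - qPart 1)) z = sg p • ι z := by
    intro p z hz
    rcases zmod2_cases p with rfl | rfl
    · simp [qPart_self hz, qPart_ne hz (show (1 : ZMod 2) ≠ 0 by decide)]
    · simp [qPart_self hz, qPart_ne hz (show (0 : ZMod 2) ≠ 1 by decide)]
  have hxy : MatHomog (p + r) (qBracket x y).1 := matHomog_superBracket hx hy
  rw [hom _ _ hx, hom _ _ hy, hom _ _ hxy, ι_bracket hx hy, sg_add]
  simp only [smul_mul_smul_comm, smul_sub]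
  rw [smul_comm (sg p * sg r), mul_comm (sg r) (sg p)]

/-- The parity automorphism of `U(q(n))`: the algebra automorphism with `x ↦ (-1)^{|x|} x` for
homogeneous `x ∈ q(n)`. -/
def par : Uq n s →ₐ[k] Uq n s := lift (ι ∘ₗ (qPart 0 - qPart 1)) par_aux

theorem par_ι {p : ZMod 2} {x : q n s} (h : MatHomog p x.1) : par (ι x) = sg p • ι x := by
  rw [par, lift_ι]
  rcases zmod2_cases p with rfl | rfl
  · simp [qPart_self h, qPart_ne h (show (1 : ZMod 2) ≠ 0 by decide)]
  · simp [qPart_self h, qPart_ne h (show (0 : ZMod 2) ≠ 1 by decide)]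

variable (n s) in
/-- The elements of parity `p` of `U(q(n))`. -/
def part (p : ZMod 2) : Submodule k (Uq n s) where
  carrier := {a | par a = sg p • a}
  zero_mem' := by simp
  add_mem' {a b} ha hb := by
    simp only [Set.mem_ofPred_eq] at *
    rw [map_add, ha, hb, smul_add]
  smul_mem' r a ha := by
    simp only [Set.mem_ofPred_eq] at *
    rw [map_smul, ha, smul_comm]

theorem mem_part {p : ZMod 2} {a : Uq n s} : a ∈ part n s p ↔ par a = sg p • a := Iff.rfl

theorem ι_mem {p : ZMod 2} {x : q n s} (h : MatHomog p x.1) : ι x ∈ part n s p := par_ι h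

theorem par_par (a : Uq n s) : par (par a) = a := by
  induction a using induction with
  | hr r => simp
  | hι x =>
    rw [← qPart_add x]
    simp only [map_add, par_ι (qPart_homog _ x), map_zsmul]
    simp
  | hm a b ha hb => simp [ha, hb]
  | ha a b ha hb => simp [ha, hb]

end Uq

end

end TypeQ

/-! ### The supercategory of `U(q(n))`-supermodules -/

namespace TypeQ

section

variable {k : Type u} [Field k] {n : ℕ} {s : SqrtNegOne k}

variable (n s) in
/-- A `U(q(n))`-supermodule. Since `2` is invertible, a superspace structure `M = M₀ ⊕ M₁` is the
same thing as the involution `par` of `M` that acts on `M_p` by `(-1)^p`, and the condition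
`U_p M_r ⊆ M_{p+r}` says that the action intertwines the parity involutions; see
`SMod.isCompl_part` and `SMod.act_mem`. -/
structure SMod where
  carrier : Type u
  [addCommGroup : AddCommGroup carrier]
  [module : Module k carrier]
  par : carrier →ₗ[k] carrier
  par_par : ∀ m, par (par m) = m
  act : Uq n s →ₐ[k] Module.End k carrier
  par_act : ∀ a m, par (act a m) = act (Uq.par a) (par m)

attribute [instance] SMod.addCommGroup SMod.module

namespace SMod

instance : CoeSort (SMod n s) (Type u) := ⟨SMod.carrier⟩

/-- The homogeneous component of parity `p`. -/
def part (M : SMod n s) (p : ZMod 2) : Submodule k M where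
  carrier := {m | M.par m = sg p • m}
  zero_mem' := by simp
  add_mem' {a b} ha hb := by
    simp only [Set.mem_ofPred_eq] at *
    rw [map_add, ha, hb, smul_add]
  smul_mem' r a ha := by
    simp only [Set.mem_ofPred_eq] at *
    rw [map_smul, ha, smul_comm]

theorem mem_part {M : SMod n s} {p : ZMod 2} {m : M} : m ∈ M.part p ↔ M.par m = sg p • m := Iff.rfl

/-- The power `par ^ p`, acting on homogeneous vectors by `(-1)^{p|m|}`. -/
def parPow (M : SMod n s) (p : ZMod 2) : M →ₗ[k] M := if p = 0 then LinearMap.id else M.par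

@[simp] theorem parPow_zero (M : SMod n s) : M.parPow 0 = LinearMap.id := rfl
@[simp] theorem parPow_one (M : SMod n s) : M.parPow 1 = M.par := rfl

theorem parPow_parPow (M : SMod n s) (p r : ZMod 2) (m : M) :
    M.parPow p (M.parPow r m) = M.parPow (p + r) m := by
  rcases zmod2_cases p with rfl | rfl <;> rcases zmod2_cases r with rfl | rfl <;>
    simp [M.par_par, show (1 : ZMod 2) + 1 = 0 from rfl]

theorem par_parPow (M : SMod n s) (p : ZMod 2) (m : M) :
    M.par (M.parPow p m) = M.parPow p (M.par m) := by
  rcases zmod2_cases p with rfl | rfl <;> simp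

theorem parPow_of_mem {M : SMod n s} {p : ZMod 2} {m : M} (h : m ∈ M.part p) (r : ZMod 2) :
    M.parPow r m = sg (p * r) • m := by
  rcases zmod2_cases r with rfl | rfl
  · simp
  · rw [mul_one]; exact h

/-- The action of `q(n)`. -/
def rho (M : SMod n s) : q n s →ₗ[k] Module.End k M := M.act.toLinearMap ∘ₗ Uq.ι

theorem act_ι (M : SMod n s) (x : q n s) : M.act (Uq.ι x) = M.rho x := rfl

theorem rho_bracket (M : SMod n s) {p r : ZMod 2} {x y : q n s} (hx : MatHomog p x.1)
    (hy : MatHomog r y.1) :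
    M.rho (qBracket x y) = M.rho x * M.rho y - sg (p * r) • (M.rho y * M.rho x) := by
  simp only [← act_ι, Uq.ι_bracket hx hy, map_sub, map_mul, map_zsmul]

theorem par_rho (M : SMod n s) {p : ZMod 2} {x : q n s} (hx : MatHomog p x.1) (m : M) :
    M.par (M.rho x m) = sg p • M.rho x (M.par m) := by
  rw [← act_ι, M.par_act, Uq.par_ι hx, map_zsmul, LinearMap.smul_apply]

theorem parPow_rho (M : SMod n s) {p : ZMod 2} {x : q n s} (hx : MatHomog p x.1) (r : ZMod 2)
    (m : M) : M.parPow r (M.rho x m) = sg (p * r) • M.rho x (M.parPow r m) := by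
  rcases zmod2_cases r with rfl | rfl
  · simp
  · simpa using M.par_rho hx m

theorem rho_parPow (M : SMod n s) {p : ZMod 2} {x : q n s} (hx : MatHomog p x.1) (r : ZMod 2)
    (m : M) : M.rho x (M.parPow r m) = sg (p * r) • M.parPow r (M.rho x m) := by
  rw [M.parPow_rho hx, smul_smul, sg_mul_self, one_smul]

theorem act_mem {M : SMod n s} {p r : ZMod 2} {a : Uq n s} {m : M} (ha : a ∈ Uq.part n s p)
    (hm : m ∈ M.part r) : M.act a m ∈ M.part (p + r) := by
  rw [mem_part] at hm ⊢
  rw [Uq.mem_part] at ha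
  rw [M.par_act, ha, hm, map_zsmul, map_zsmul, LinearMap.smul_apply, smul_smul, sg_add, mul_comm]

theorem isCompl_part [NeZero (2 : k)] (M : SMod n s) : IsCompl (M.part 0) (M.part 1) := by
  have h2 : (2 : k) ≠ 0 := NeZero.ne 2
  constructor
  · rw [Submodule.disjoint_def]
    intro m h0 h1
    rw [mem_part] at h0 h1
    rw [h0] at h1
    simp only [sg_zero, sg_one, one_smul, neg_smul] at h1
    have : (2 : k) • m = 0 := by rw [two_smul]; nth_rw 1 [h1]; simp
    exact (smul_eq_zero.1 this).resolve_left h2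
  · rw [codisjoint_iff, eq_top_iff]
    intro m _
    have : m = (2 : k)⁻¹ • (m + M.par m) + (2 : k)⁻¹ • (m - M.par m) := by
      rw [← smul_add, add_add_sub_cancel, ← two_smul k m, smul_smul, inv_mul_cancel₀ h2, one_smul]
    rw [this]
    refine Submodule.add_mem_sup (Submodule.smul_mem _ _ ?_) (Submodule.smul_mem _ _ ?_)
    · rw [mem_part]; simp [M.par_par, add_comm]
    · rw [mem_part]; simp [M.par_par]

/-- A supermodule from a representation of the Lie superalgebra `q(n)`. -/
abbrev ofRho (M : Type u) [AddCommGroup M] [Module k M] (par : M →ₗ[k] M)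
    (par_par : ∀ m, par (par m) = m) (ρ : q n s →ₗ[k] Module.End k M)
    (hρ : ∀ (p r : ZMod 2) (x y : q n s), MatHomog p x.1 → MatHomog r y.1 →
      ρ (qBracket x y) = ρ x * ρ y - sg (p * r) • (ρ y * ρ x))
    (hpar : ∀ (p : ZMod 2) (x : q n s), MatHomog p x.1 → ∀ m,
      par (ρ x m) = sg p • ρ x (par m)) : SMod n s where
  carrier := M
  par := par
  par_par := par_par
  act := Uq.lift ρ hρ
  par_act a := by
    induction a using Uq.induction with
    | hr r => intro m; simp
    | hι x =>
      intro m
      rw [← qPart_add x]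
      simp only [map_add, LinearMap.add_apply, Uq.par_ι (qPart_homog _ x), map_zsmul,
        LinearMap.smul_apply, Uq.lift_ι, hpar _ _ (qPart_homog _ x)]
    | hm a b ha hb => intro m; simp [ha, hb]
    | ha a b ha hb => intro m; simp [ha, hb]

theorem ofRho_rho (M : Type u) [AddCommGroup M] [Module k M] (par : M →ₗ[k] M) (h1)
    (ρ : q n s →ₗ[k] Module.End k M) (h2 h3) (x : q n s) :
    (ofRho M par h1 ρ h2 h3).rho x = ρ x := Uq.lift_ι ρ h2 x

/-- The homogeneous supermodule homomorphisms of parity `p`: the linear maps of parity `p` with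
`f (a m) = (-1)^{p|a|} a f(m)`. -/
def homPart (M N : SMod n s) (p : ZMod 2) : Submodule k (M →ₗ[k] N) where
  carrier := {f | (∀ r, ∀ m ∈ M.part r, f m ∈ N.part (p + r)) ∧
    ∀ r, ∀ a ∈ Uq.part n s r, ∀ m, f (M.act a m) = sg (p * r) • N.act a (f m)}
  zero_mem' := by simp
  add_mem' {f g} hf hg :=
    ⟨fun r m hm => Submodule.add_mem _ (hf.1 r m hm) (hg.1 r m hm), fun r a ha m => by
      simp [hf.2 r a ha m, hg.2 r a ha m]⟩
  smul_mem' c f hf :=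
    ⟨fun r m hm => Submodule.smul_mem _ _ (hf.1 r m hm), fun r a ha m => by
      simp [hf.2 r a ha m, smul_comm c]⟩

theorem par_hom [NeZero (2 : k)] {M N : SMod n s} {p : ZMod 2} {f : M →ₗ[k] N} (hf : f ∈ homPart M N p) (m : M) :
    N.par (f m) = sg p • f (M.par m) := by
  have hm : m ∈ M.part 0 ⊔ M.part 1 := by rw [M.isCompl_part.sup_eq_top]; trivial
  obtain ⟨a, ha, b, hb, rfl⟩ := Submodule.mem_sup.1 hm
  have h0 := hf.1 0 a ha
  have h1 := hf.1 1 b hb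
  rw [mem_part] at ha hb h0 h1
  simp only [map_add, h0, h1, ha, hb, smul_add, map_zsmul, smul_smul, sg_add]

theorem parPow_hom [NeZero (2 : k)] {M N : SMod n s} {p : ZMod 2} {f : M →ₗ[k] N} (hf : f ∈ homPart M N p)
    (r : ZMod 2) (m : M) : N.parPow r (f m) = sg (p * r) • f (M.parPow r m) := by
  rcases zmod2_cases r with rfl | rfl
  · simp
  · simpa using par_hom hf m

theorem hom_rho {M N : SMod n s} {p : ZMod 2} {f : M →ₗ[k] N} (hf : f ∈ homPart M N p)
    {r : ZMod 2} {x : q n s} (hx : MatHomog r x.1) (m : M) :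
    f (M.rho x m) = sg (p * r) • N.rho x (f m) := hf.2 r _ (Uq.ι_mem hx) m

/-- It suffices to check equivariance on `q(n)`. -/
theorem mem_homPart {M N : SMod n s} {p : ZMod 2} {f : M →ₗ[k] N}
    (hpar : ∀ m, N.par (f m) = sg p • f (M.par m))
    (hf : ∀ (r : ZMod 2) (x : q n s), MatHomog r x.1 → ∀ m,
      f (M.rho x m) = sg (p * r) • N.rho x (f m)) : f ∈ homPart M N p := by
  refine ⟨fun r m hm => ?_, fun r a ha m => ?_⟩
  · rw [mem_part] at hm ⊢
    rw [hpar, hm, map_zsmul, smul_smul, sg_add]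
  · have key : ∀ (a : Uq n s) (m : M),
        f (M.act a m) = N.act (if p = 0 then a else Uq.par a) (f m) := by
      intro a
      induction a using Uq.induction with
      | hr c => intro m; split_ifs <;> simp
      | hι x =>
        intro m
        rw [← qPart_add x]
        simp only [map_add, LinearMap.add_apply, Uq.par_ι (qPart_homog _ x), act_ι,
          hf _ _ (qPart_homog _ x)]
        rcases zmod2_cases p with rfl | rfl <;> simp [act_ι]
      | hm a b ha hb => intro m; split_ifs at * <;> simp [ha, hb]
      | ha a b ha hb => intro m; split_ifs at * <;> simp [ha, hb]
    rw [key]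
    rcases zmod2_cases p with rfl | rfl
    · simp
    · rw [Uq.mem_part] at ha; simp [ha]

theorem comp_mem_homPart {L M N : SMod n s} {p r t : ZMod 2} {f : L →ₗ[k] M} {g : M →ₗ[k] N}
    (h : p + r = t) (hg : g ∈ homPart M N r) (hf : f ∈ homPart L M p) :
    g ∘ₗ f ∈ homPart L N t := by
  subst h
  refine ⟨fun t m hm => ?_, fun t a ha m => ?_⟩
  · have := hg.1 _ _ (hf.1 t m hm)
    rwa [← add_assoc, add_comm r p] at this
  · rw [LinearMap.comp_apply, hf.2 t a ha, map_zsmul, hg.2 t a ha, smul_smul, add_mul, sg_add]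
    rfl

theorem id_mem_homPart (M : SMod n s) : LinearMap.id ∈ homPart M M 0 :=
  ⟨fun r m hm => by simpa using hm, fun r a _ m => by simp⟩

/-- Morphisms of supermodules: `Hom(M, N) = Hom(M, N)₀ ⊕ Hom(M, N)₁`. -/
instance : Category (SMod n s) where
  Hom M N := homPart M N 0 × homPart M N 1
  id M := (⟨LinearMap.id, id_mem_homPart M⟩, 0)
  comp f g :=
    (⟨g.1.1 ∘ₗ f.1.1 + g.2.1 ∘ₗ f.2.1, Submodule.add_mem _ (comp_mem_homPart (by decide) g.1.2 f.1.2)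
      (comp_mem_homPart (by decide) g.2.2 f.2.2)⟩,
     ⟨g.1.1 ∘ₗ f.2.1 + g.2.1 ∘ₗ f.1.1, Submodule.add_mem _ (comp_mem_homPart (by decide) g.1.2 f.2.2)
      (comp_mem_homPart (by decide) g.2.2 f.1.2)⟩)
  id_comp f := by ext <;> simp
  comp_id f := by ext <;> simp
  assoc f g h := by
    refine Prod.ext (Subtype.ext (LinearMap.ext fun m => ?_))
      (Subtype.ext (LinearMap.ext fun m => ?_)) <;> simp <;> abel

/-- The even component of a morphism. -/
def ev {M N : SMod n s} (f : M ⟶ N) : M →ₗ[k] N := f.1.1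

/-- The odd component of a morphism. -/
def od {M N : SMod n s} (f : M ⟶ N) : M →ₗ[k] N := f.2.1

/-- The linear map underlying a morphism. -/
def toLin {M N : SMod n s} (f : M ⟶ N) : M →ₗ[k] N := ev f + od f

theorem ev_mem {M N : SMod n s} (f : M ⟶ N) : ev f ∈ homPart M N 0 := f.1.2
theorem od_mem {M N : SMod n s} (f : M ⟶ N) : od f ∈ homPart M N 1 := f.2.2

theorem hom_ext {M N : SMod n s} {f g : M ⟶ N} (h0 : ev f = ev g) (h1 : od f = od g) : f = g :=
  Prod.ext (Subtype.ext h0) (Subtype.ext h1)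

instance : Preadditive (SMod n s) where
  homGroup M N := inferInstanceAs (AddCommGroup (homPart M N 0 × homPart M N 1))
  add_comp L M N f f' g := by
    refine hom_ext (LinearMap.ext fun m => ?_) (LinearMap.ext fun m => ?_)
    · change g.1.1 (f.1.1 m + f'.1.1 m) + g.2.1 (f.2.1 m + f'.2.1 m) =
        (g.1.1 (f.1.1 m) + g.2.1 (f.2.1 m)) + (g.1.1 (f'.1.1 m) + g.2.1 (f'.2.1 m))
      simp only [map_add]; abel
    · change g.1.1 (f.2.1 m + f'.2.1 m) + g.2.1 (f.1.1 m + f'.1.1 m) =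
        (g.1.1 (f.2.1 m) + g.2.1 (f.1.1 m)) + (g.1.1 (f'.2.1 m) + g.2.1 (f'.1.1 m))
      simp only [map_add]; abel
  comp_add L M N f g g' := by
    refine hom_ext (LinearMap.ext fun m => ?_) (LinearMap.ext fun m => ?_)
    · change (g.1.1 (f.1.1 m) + g'.1.1 (f.1.1 m)) + (g.2.1 (f.2.1 m) + g'.2.1 (f.2.1 m)) =
        (g.1.1 (f.1.1 m) + g.2.1 (f.2.1 m)) + (g'.1.1 (f.1.1 m) + g'.2.1 (f.2.1 m))
      abel
    · change (g.1.1 (f.2.1 m) + g'.1.1 (f.2.1 m)) + (g.2.1 (f.1.1 m) + g'.2.1 (f.1.1 m)) =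
        (g.1.1 (f.2.1 m) + g.2.1 (f.1.1 m)) + (g'.1.1 (f.2.1 m) + g'.2.1 (f.1.1 m))
      abel

instance : Linear k (SMod n s) where
  homModule M N := inferInstanceAs (Module k (homPart M N 0 × homPart M N 1))
  smul_comp L M N r f g := by
    refine hom_ext (LinearMap.ext fun m => ?_) (LinearMap.ext fun m => ?_)
    · change g.1.1 (r • f.1.1 m) + g.2.1 (r • f.2.1 m) = r • (g.1.1 (f.1.1 m) + g.2.1 (f.2.1 m))
      simp only [map_smul, smul_add]
    · change g.1.1 (r • f.2.1 m) + g.2.1 (r • f.1.1 m) = r • (g.1.1 (f.2.1 m) + g.2.1 (f.1.1 m))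
      simp only [map_smul, smul_add]
  comp_smul L M N f r g := by
    refine hom_ext (LinearMap.ext fun m => ?_) (LinearMap.ext fun m => ?_)
    · change r • g.1.1 (f.1.1 m) + r • g.2.1 (f.2.1 m) = r • (g.1.1 (f.1.1 m) + g.2.1 (f.2.1 m))
      simp only [smul_add]
    · change r • g.1.1 (f.2.1 m) + r • g.2.1 (f.1.1 m) = r • (g.1.1 (f.2.1 m) + g.2.1 (f.1.1 m))
      simp only [smul_add]

section lemmas

variable {L M N : SMod n s}

theorem ev_comp (f : L ⟶ M) (g : M ⟶ N) : ev (f ≫ g) = ev g ∘ₗ ev f + od g ∘ₗ od f := rfl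
theorem od_comp (f : L ⟶ M) (g : M ⟶ N) : od (f ≫ g) = ev g ∘ₗ od f + od g ∘ₗ ev f := rfl
@[simp] theorem ev_id (M : SMod n s) : ev (𝟙 M) = LinearMap.id := rfl
@[simp] theorem od_id (M : SMod n s) : od (𝟙 M) = 0 := rfl
@[simp] theorem ev_add (f g : M ⟶ N) : ev (f + g) = ev f + ev g := rfl
@[simp] theorem od_add (f g : M ⟶ N) : od (f + g) = od f + od g := rfl
@[simp] theorem ev_smul (r : k) (f : M ⟶ N) : ev (r • f) = r • ev f := rfl
@[simp] theorem od_smul (r : k) (f : M ⟶ N) : od (r • f) = r • od f := rfl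
@[simp] theorem ev_zero : ev (0 : M ⟶ N) = 0 := rfl
@[simp] theorem od_zero : od (0 : M ⟶ N) = 0 := rfl

theorem toLin_comp (f : L ⟶ M) (g : M ⟶ N) : toLin (f ≫ g) = toLin g ∘ₗ toLin f := by
  refine LinearMap.ext fun m => ?_
  simp only [toLin, ev_comp, od_comp, LinearMap.add_apply, LinearMap.comp_apply, map_add]
  abel

@[simp] theorem toLin_id (M : SMod n s) : toLin (𝟙 M) = LinearMap.id := by simp [toLin]
@[simp] theorem toLin_add (f g : M ⟶ N) : toLin (f + g) = toLin f + toLin g := by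
  simp only [toLin, ev_add, od_add]; abel
@[simp] theorem toLin_smul (r : k) (f : M ⟶ N) : toLin (r • f) = r • toLin f := by
  simp only [toLin, ev_smul, od_smul, smul_add]
@[simp] theorem toLin_zero : toLin (0 : M ⟶ N) = 0 := by simp [toLin]

/-- An even morphism. -/
def evenHom (f : M →ₗ[k] N) (hf : f ∈ homPart M N 0) : M ⟶ N := (⟨f, hf⟩, 0)

/-- An odd morphism. -/
def oddHom (f : M →ₗ[k] N) (hf : f ∈ homPart M N 1) : M ⟶ N := (0, ⟨f, hf⟩)

@[simp] theorem ev_evenHom (f : M →ₗ[k] N) (hf) : ev (evenHom f hf) = f := rfl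
@[simp] theorem od_evenHom (f : M →ₗ[k] N) (hf) : od (evenHom f hf) = 0 := rfl
@[simp] theorem ev_oddHom (f : M →ₗ[k] N) (hf) : ev (oddHom f hf) = 0 := rfl
@[simp] theorem od_oddHom (f : M →ₗ[k] N) (hf) : od (oddHom f hf) = f := rfl

end lemmas

theorem toLin_injective [NeZero (2 : k)] {M N : SMod n s} {f g : M ⟶ N} (h : toLin f = toLin g) : f = g := by
  have h2 : (2 : k) ≠ 0 := NeZero.ne 2
  have key : ∀ m, ev f m = ev g m := by
    intro m
    have e1 : ev f m + od f m = ev g m + od g m := LinearMap.congr_fun h m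
    have e2 : ev f (M.par m) + od f (M.par m) = ev g (M.par m) + od g (M.par m) :=
      LinearMap.congr_fun h (M.par m)
    have e3 := congrArg N.par e2
    simp only [map_add, par_hom (ev_mem _), par_hom (od_mem _), M.par_par, sg_zero, sg_one,
      one_smul, neg_smul] at e3
    have e4 : (2 : k) • ev f m = (2 : k) • ev g m := by
      have := congrArg₂ (· + ·) e1 e3
      simp only [two_smul] at this ⊢
      convert this using 1 <;> abel
    exact smul_right_injective _ h2 e4
  refine hom_ext (LinearMap.ext key) (LinearMap.ext fun m => ?_)
  have e1 : ev f m + od f m = ev g m + od g m := LinearMap.congr_fun h m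
  rwa [key, add_right_inj] at e1

instance : Supercategory k (SMod n s) where
  part p M N := if p = 0 then LinearMap.ker (LinearMap.snd k (homPart M N 0) (homPart M N 1))
    else LinearMap.ker (LinearMap.fst k (homPart M N 0) (homPart M N 1))
  isCompl M N := by
    simp only [if_true, one_ne_zero, if_false]
    rw [LinearMap.ker_snd, LinearMap.ker_fst]
    exact LinearMap.isCompl_range_inl_inr
  id_mem M := rfl
  comp_mem {p r L M N f g} hf hg := by
    rcases zmod2_cases p with rfl | rfl <;> rcases zmod2_cases r with rfl | rfl
    · have h1 : f.2 = 0 := hf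
      have h2 : g.2 = 0 := hg
      refine Subtype.ext (?_ : g.1.1 ∘ₗ f.2.1 + g.2.1 ∘ₗ f.1.1 = 0)
      simp [h1, h2]
    · have h1 : f.2 = 0 := hf
      have h2 : g.1 = 0 := hg
      refine Subtype.ext (?_ : g.1.1 ∘ₗ f.1.1 + g.2.1 ∘ₗ f.2.1 = 0)
      simp [h1, h2]
    · have h1 : f.1 = 0 := hf
      have h2 : g.2 = 0 := hg
      refine Subtype.ext (?_ : g.1.1 ∘ₗ f.1.1 + g.2.1 ∘ₗ f.2.1 = 0)
      simp [h1, h2]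
    · have h1 : f.1 = 0 := hf
      have h2 : g.1 = 0 := hg
      refine Subtype.ext (?_ : g.1.1 ∘ₗ f.2.1 + g.2.1 ∘ₗ f.1.1 = 0)
      simp [h1, h2]

end SMod

end

end TypeQ

/-! ### Tensor products, duals, the natural supermodule and its dual -/

namespace TypeQ

open TensorProduct

section

variable {k : Type u} [Field k] {n : ℕ} {s : SqrtNegOne k}

namespace SMod

/-- The action of `q(n)` on a tensor product: `x (w ⊗ m) = x w ⊗ m + (-1)^{|x||w|} w ⊗ x m`. -/
def tensorRho (W M : SMod n s) : q n s →ₗ[k] Module.End k (W ⊗[k] M) where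
  toFun x := TensorProduct.map (W.rho x) LinearMap.id +
    ∑ p : ZMod 2, TensorProduct.map (W.parPow p) (M.rho (qPart p x))
  map_add' x y := by
    simp only [map_add, TensorProduct.map_add_left, TensorProduct.map_add_right,
      Finset.sum_add_distrib]
    abel
  map_smul' r x := by
    simp only [map_smul, TensorProduct.map_smul_left, TensorProduct.map_smul_right,
      ← Finset.smul_sum, ← smul_add, RingHom.id_apply]

theorem tensorRho_tmul (W M : SMod n s) {p : ZMod 2} {x : q n s} (hx : MatHomog p x.1)
    (w : W) (m : M) : tensorRho W M x (w ⊗ₜ[k] m) =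
      W.rho x w ⊗ₜ[k] m + W.parPow p w ⊗ₜ[k] M.rho x m := by
  change (TensorProduct.map (W.rho x) LinearMap.id +
    ∑ p : ZMod 2, TensorProduct.map (W.parPow p) (M.rho (qPart p x)) :
      W ⊗[k] M →ₗ[k] W ⊗[k] M) (w ⊗ₜ[k] m) = _
  rw [Finset.sum_eq_single p]
  · simp [qPart_self hx]
  · intro r _ hr; simp [qPart_ne hx hr]
  · simp

/-- The tensor product of supermodules. -/
abbrev tensor (W M : SMod n s) : SMod n s :=
  ofRho (W ⊗[k] M) (TensorProduct.map W.par M.par)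
    (fun t => by
      induction t with
      | zero => simp
      | tmul w m => simp [W.par_par, M.par_par]
      | add a b ha hb => simp [ha, hb])
    (tensorRho W M)
    (fun p r x y hx hy => by
      refine TensorProduct.ext' fun w m => ?_
      have hxy : MatHomog (p + r) (qBracket x y).1 := matHomog_superBracket hx hy
      simp only [LinearMap.sub_apply, LinearMap.smul_apply, Module.End.mul_apply]
      rw [tensorRho_tmul _ _ hxy, tensorRho_tmul _ _ hx, tensorRho_tmul _ _ hy, map_add, map_add,
        tensorRho_tmul _ _ hx, tensorRho_tmul _ _ hx, tensorRho_tmul _ _ hy,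
        tensorRho_tmul _ _ hy, rho_bracket _ hx hy, rho_bracket _ hx hy]
      simp only [LinearMap.sub_apply, LinearMap.smul_apply, Module.End.mul_apply, sub_tmul,
        tmul_sub, smul_add, W.parPow_rho hx, W.parPow_rho hy, parPow_parPow, add_comm r p,
        smul_tmul', tmul_smul, smul_smul, mul_comm r p, sg_mul_self, one_smul]
      abel)
    (fun p x hx t => by
      induction t with
      | zero => simp
      | tmul w m =>
        rw [tensorRho_tmul _ _ hx, map_add, TensorProduct.map_tmul, TensorProduct.map_tmul,
          TensorProduct.map_tmul, tensorRho_tmul _ _ hx, W.par_rho hx, M.par_rho hx, smul_add,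
          smul_tmul', tmul_smul, W.par_parPow]
      | add a b ha hb => simp only [map_add, ha, hb, smul_add])

theorem tensor_rho (W M : SMod n s) {p : ZMod 2} {x : q n s} (hx : MatHomog p x.1)
    (w : W) (m : M) : (tensor W M).rho x (w ⊗ₜ[k] m) =
      W.rho x w ⊗ₜ[k] m + W.parPow p w ⊗ₜ[k] M.rho x m := by
  rw [ofRho_rho]; exact tensorRho_tmul W M hx w m

theorem tensor_par (W M : SMod n s) (w : W) (m : M) :
    (tensor W M).par (w ⊗ₜ[k] m) = W.par w ⊗ₜ[k] M.par m := rfl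

theorem tensor_parPow (W M : SMod n s) (p : ZMod 2) (w : W) (m : M) :
    (tensor W M).parPow p (w ⊗ₜ[k] m) = W.parPow p w ⊗ₜ[k] M.parPow p m := by
  rcases zmod2_cases p with rfl | rfl <;> rfl

/-- The action of `q(n)` on the dual: `(x f)(w) = -(-1)^{|x||f|} f(x w)`. -/
def dualRho (W : SMod n s) : q n s →ₗ[k] Module.End k (Module.Dual k W) where
  toFun x := -∑ p : ZMod 2, (W.parPow p ∘ₗ W.rho (qPart p x)).dualMap
  map_add' x y := by
    ext f w
    simp [sum_zmod2]; abel
  map_smul' r x := by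
    ext f w
    simp [sum_zmod2]

theorem dualRho_apply (W : SMod n s) {p : ZMod 2} {x : q n s} (hx : MatHomog p x.1)
    (f : Module.Dual k W) (w : W) : dualRho W x f w = -f (W.parPow p (W.rho x w)) := by
  change (-∑ p : ZMod 2, (W.parPow p ∘ₗ W.rho (qPart p x)).dualMap) f w = _
  rw [Finset.sum_eq_single p]
  · simp [qPart_self hx]
  · intro r _ hr
    ext; simp [qPart_ne hx hr]
  · simp

/-- The dual supermodule. -/
abbrev dual (W : SMod n s) : SMod n s :=
  ofRho (Module.Dual k W) W.par.dualMap
    (fun f => by ext w; simp [W.par_par])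
    (dualRho W)
    (fun p r x y hx hy => by
      ext f w
      have hxy : MatHomog (p + r) (qBracket x y).1 := matHomog_superBracket hx hy
      simp only [LinearMap.sub_apply, LinearMap.smul_apply, Module.End.mul_apply]
      rw [dualRho_apply _ hxy, dualRho_apply _ hx, dualRho_apply _ hy, dualRho_apply _ hy,
        dualRho_apply _ hx, rho_bracket _ hx hy, W.rho_parPow hx, W.rho_parPow hy]
      simp only [LinearMap.sub_apply, LinearMap.smul_apply, Module.End.mul_apply, map_sub,
        map_zsmul, parPow_parPow, neg_neg, add_comm r p, mul_comm r p, smul_smul, sg_mul_self,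
        one_smul]
      abel)
    (fun p x hx f => by
      ext w
      simp only [LinearMap.dualMap_apply, LinearMap.smul_apply]
      rw [dualRho_apply _ hx, dualRho_apply _ hx]
      simp only [LinearMap.dualMap_apply]
      rw [W.par_parPow, W.par_rho hx, map_zsmul, map_zsmul, smul_neg, smul_smul, sg_mul_self,
        one_smul])

end SMod

end

end TypeQ

/-! ### The natural supermodule, tensoring with a supermodule, and the maps on generators -/

namespace TypeQ

open TensorProduct

section

variable {k : Type u} [Field k] {n : ℕ} {s : SqrtNegOne k}

namespace SMod

variable (n s) in
/-- The natural supermodule `V` with basis indexed by `I`. -/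
abbrev natMod : SMod n s :=
  ofRho (Idx n → k)
    { toFun := fun v a => sg a.2 • v a
      map_add' := fun v w => by ext a; simp
      map_smul' := fun r v => by ext a; exact smul_comm (sg a.2) r (v a) }
    (fun v => by
      ext a
      change sg a.2 • (sg a.2 • v a) = v a
      rw [smul_smul, sg_mul_self, one_smul])
    ((Matrix.toLin' (R := k) (m := Idx n) (n := Idx n)).toLinearMap ∘ₗ (q n s).subtype)
    (fun p r x y hx hy => by
      change Matrix.toLin' (superBracket x.1 y.1) = _
      rw [superBracket_of_homog hx hy, map_sub, map_zsmul, Matrix.toLin'_mul, Matrix.toLin'_mul]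
      rfl)
    (fun p x hx v => by
      ext a
      change sg a.2 • (x.1.mulVec v) a = sg p • (x.1.mulVec fun a => sg a.2 • v a) a
      simp only [Matrix.mulVec, dotProduct, Finset.smul_sum]
      refine Finset.sum_congr rfl fun b _ => ?_
      by_cases h : a.2 + b.2 = p
      · rw [← h, sg_add, mul_smul_comm, smul_smul, mul_assoc, sg_mul_self, mul_one]
      · rw [hx a b h]; simp)

/-- The basis vector `v_a`. -/
def bas (a : Idx n) : natMod n s := Pi.single a (1 : k)

/-- The dual basis vector `v_a^*`. -/
def cobas (a : Idx n) : dual (natMod n s) := LinearMap.proj (φ := fun _ : Idx n => k) a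

theorem cobas_bas (a b : Idx n) :
    (cobas (s := s) a : (Idx n → k) →ₗ[k] k) (bas (s := s) b) = if a = b then 1 else 0 := by
  change (Pi.single b (1 : k) : Idx n → k) a = _
  rw [Pi.single_apply]

theorem sum_bas (v : natMod n s) : ∑ a, (v : Idx n → k) a • bas (s := s) a = v := by
  ext a
  change (∑ b, (v : Idx n → k) b • (Pi.single b (1 : k) : Idx n → k)) a = _
  simp [Finset.sum_apply, Pi.single_apply]

theorem sum_cobas (f : dual (natMod n s)) :
    ∑ a, (f : (Idx n → k) →ₗ[k] k) (bas (s := s) a) • cobas (s := s) a = f := by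
  refine LinearMap.ext fun v => ?_
  conv_rhs => rw [← sum_bas (s := s) v, map_sum]
  rw [LinearMap.sum_apply]
  refine Finset.sum_congr rfl fun a _ => ?_
  rw [map_smul, LinearMap.smul_apply, smul_eq_mul, smul_eq_mul, mul_comm]
  rfl

theorem ext_bas {X Y : Type u} [AddCommGroup X] [Module k X] [AddCommGroup Y] [Module k Y]
    {f g : natMod n s ⊗[k] X →ₗ[k] Y} (h : ∀ a x, f (bas a ⊗ₜ x) = g (bas a ⊗ₜ x)) : f = g := by
  refine TensorProduct.ext' fun v x => ?_
  rw [← sum_bas v]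
  simp only [sum_tmul, map_sum, ← smul_tmul', map_smul, h]

theorem ext_cobas {X Y : Type u} [AddCommGroup X] [Module k X] [AddCommGroup Y] [Module k Y]
    {f g : dual (natMod n s) ⊗[k] X →ₗ[k] Y} (h : ∀ a x, f (cobas a ⊗ₜ x) = g (cobas a ⊗ₜ x)) :
    f = g := by
  refine TensorProduct.ext' fun v x => ?_
  rw [← sum_cobas v]
  simp only [sum_tmul, map_sum, ← smul_tmul', map_smul, h]

theorem bas_mem (a : Idx n) : bas a ∈ (natMod n s).part a.2 := by
  rw [mem_part]
  ext b
  change sg b.2 • (Pi.single a (1 : k) : Idx n → k) b =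
    sg a.2 • (Pi.single a (1 : k) : Idx n → k) b
  by_cases h : b = a
  · rw [h]
  · simp [h]

theorem cobas_mem (a : Idx n) : cobas a ∈ (dual (natMod n s)).part a.2 := by
  rw [mem_part]
  refine LinearMap.ext fun v => ?_
  rfl

theorem rho_mem {M : SMod n s} {p r : ZMod 2} {x : q n s} (hx : MatHomog p x.1) {m : M}
    (hm : m ∈ M.part r) : M.rho x m ∈ M.part (p + r) := act_mem (Uq.ι_mem hx) hm

theorem rho_bas (x : q n s) (b : Idx n) :
    (natMod n s).rho x (bas b) = ∑ a, x.1 a b • bas (s := s) a := by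
  rw [ofRho_rho]
  refine (sum_bas _).symm.trans (Finset.sum_congr rfl fun a _ => ?_)
  congr 1
  change (x.1.mulVec (Pi.single b (1 : k))) a = _
  simp

theorem rho_cobas {p : ZMod 2} {x : q n s} (hx : MatHomog p x.1) (a : Idx n) :
    (dual (natMod n s)).rho x (cobas a) = ∑ b, (-(sg (p * a.2) • x.1 a b)) • cobas (s := s) b := by
  rw [ofRho_rho]
  refine (sum_cobas _).symm.trans (Finset.sum_congr rfl fun b _ => ?_)
  rw [dualRho_apply _ hx, rho_bas]
  congr 1
  have : (cobas (s := s) a : (Idx n → k) →ₗ[k] k)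
      ((natMod n s).parPow p (∑ c, x.1 c b • bas (s := s) c)) = sg (p * a.2) • x.1 a b := by
    simp only [map_sum, map_smul]
    rw [Finset.sum_eq_single a]
    · rw [parPow_of_mem (bas_mem a), map_zsmul, cobas_bas]; simp [mul_comm]
    · intro c _ hc
      rw [parPow_of_mem (bas_mem c), map_zsmul, cobas_bas, if_neg (Ne.symm hc)]; simp
    · simp
  rw [this]

theorem par_bas (a : Idx n) : (natMod n s).par (bas a) = sg a.2 • bas a := bas_mem a
theorem parPow_bas (p : ZMod 2) (a : Idx n) :
    (natMod n s).parPow p (bas a) = sg (a.2 * p) • bas a := parPow_of_mem (bas_mem a) p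
theorem par_cobas (a : Idx n) : (dual (natMod n s)).par (cobas a) = sg a.2 • cobas a := cobas_mem a
theorem parPow_cobas (p : ZMod 2) (a : Idx n) :
    (dual (natMod n s)).parPow p (cobas a) = sg (a.2 * p) • cobas a := parPow_of_mem (cobas_mem a) p

/-- It suffices to check a homomorphism out of a tensor product on pure tensors. -/
theorem mem_homPart_tensor {W M N : SMod n s} {p : ZMod 2} {f : W ⊗[k] M →ₗ[k] N}
    (hpar : ∀ w m, N.par (f (w ⊗ₜ m)) = sg p • f (W.par w ⊗ₜ M.par m))
    (hf : ∀ (r : ZMod 2) (x : q n s), MatHomog r x.1 → ∀ w m,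
      f (W.rho x w ⊗ₜ m) + f (W.parPow r w ⊗ₜ M.rho x m) = sg (p * r) • N.rho x (f (w ⊗ₜ m))) :
    f ∈ homPart (tensor W M) N p := by
  refine mem_homPart (M := tensor W M) (fun t => ?_) (fun r x hx t => ?_)
  · induction t using TensorProduct.induction_on with
    | zero => simp
    | tmul w m => exact hpar w m
    | add a b ha hb => simp only [map_add, ha, hb, smul_add]
  · induction t using TensorProduct.induction_on with
    | zero => simp
    | tmul w m => rw [tensor_rho _ _ hx, map_add]; exact hf r x hx w m
    | add a b ha hb => simp only [map_add, ha, hb, smul_add]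

/-- The endofunctor `W ⊗ -`, with `(W ⊗ f)(w ⊗ m) = (-1)^{|f||w|} w ⊗ f m`. -/
def tensorFunctor [NeZero (2 : k)] (W : SMod n s) : Superfunctor k (SMod n s) where
  obj M := tensor W M
  map {M N} f :=
    (⟨TensorProduct.map LinearMap.id (ev f), mem_homPart_tensor
        (fun w m => by
          simp [par_hom (ev_mem f)])
        (fun r x hx w m => by
          simp [tensor_rho _ _ hx, hom_rho (ev_mem f) hx])⟩,
     ⟨TensorProduct.map W.par (od f), mem_homPart_tensor
        (fun w m => by
          simp [par_hom (od_mem f), tmul_neg])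
        (fun r x hx w m => by
          simp [tensor_rho _ _ hx, hom_rho (od_mem f) hx, W.par_rho hx, W.par_parPow,
            smul_tmul'])⟩)
  map_id M := hom_ext (TensorProduct.map_id) (TensorProduct.map_zero_right _)
  map_comp {L M N} f g := hom_ext
    (by
      refine TensorProduct.ext' fun w m => ?_
      change w ⊗ₜ[k] (ev g (ev f m) + od g (od f m)) =
        w ⊗ₜ[k] ev g (ev f m) + W.par (W.par w) ⊗ₜ[k] od g (od f m)
      rw [W.par_par, tmul_add])
    (by
      refine TensorProduct.ext' fun w m => ?_
      change W.par w ⊗ₜ[k] (ev g (od f m) + od g (ev f m)) =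
        W.par w ⊗ₜ[k] ev g (od f m) + W.par w ⊗ₜ[k] od g (ev f m)
      rw [tmul_add])
  map_add' f g := hom_ext (TensorProduct.map_add_right _ _ _) (TensorProduct.map_add_right _ _ _)
  map_smul' r f := hom_ext (TensorProduct.map_smul_right _ _ _) (TensorProduct.map_smul_right _ _ _)
  map_mem {p X Y f} hf := by
    rcases zmod2_cases p with rfl | rfl
    · have h : f.2 = 0 := hf
      refine Subtype.ext (?_ : TensorProduct.map W.par f.2.1 = 0)
      rw [h]; exact TensorProduct.map_zero_right _
    · have h : f.1 = 0 := hf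
      refine Subtype.ext (?_ : TensorProduct.map LinearMap.id f.1.1 = 0)
      rw [h]; exact TensorProduct.map_zero_right _

end SMod

end

end TypeQ

namespace TypeQ

open TensorProduct

section

variable {k : Type u} [Field k] {n : ℕ} {s : SqrtNegOne k}

namespace SMod

section tf

variable [NeZero (2 : k)]

theorem ev_tensorFunctor (W : SMod n s) {M N : SMod n s} (f : M ⟶ N) :
    ev ((tensorFunctor W).map f) = TensorProduct.map LinearMap.id (ev f) := rfl
theorem od_tensorFunctor (W : SMod n s) {M N : SMod n s} (f : M ⟶ N) :
    od ((tensorFunctor W).map f) = TensorProduct.map W.par (od f) := rfl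

theorem tensorFunctor_evenHom (W : SMod n s) {M N : SMod n s} (f : M →ₗ[k] N) (hf) (w : W) (m : M) :
    toLin ((tensorFunctor W).map (evenHom f hf)) (w ⊗ₜ[k] m) = w ⊗ₜ[k] f m := by
  change w ⊗ₜ[k] f m + W.par w ⊗ₜ[k] (0 : N) = _
  rw [tmul_zero, add_zero]

theorem tensorFunctor_oddHom (W : SMod n s) {M N : SMod n s} (f : M →ₗ[k] N) (hf) (w : W) (m : M) :
    toLin ((tensorFunctor W).map (oddHom f hf)) (w ⊗ₜ[k] m) = W.par w ⊗ₜ[k] f m := by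
  change w ⊗ₜ[k] (0 : N) + W.par w ⊗ₜ[k] f m = _
  rw [tmul_zero, zero_add]

end tf

/-- `m ↦ ∑_a v_a ⊗ v_a^* ⊗ m`. -/
def cupL (X : SMod n s) : X →ₗ[k] tensor (natMod n s) (tensor (dual (natMod n s)) X) :=
  ∑ a : Idx n, TensorProduct.mk k (natMod n s) (tensor (dual (natMod n s)) X) (bas a) ∘ₗ
    TensorProduct.mk k (dual (natMod n s)) X (cobas a)

theorem cupL_apply (X : SMod n s) (m : X) :
    cupL X m = ∑ a : Idx n, bas (s := s) a ⊗ₜ[k] (cobas (s := s) a ⊗ₜ[k] m) := by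
  simp [cupL]

theorem cupL_mem (X : SMod n s) :
    cupL X ∈ homPart X (tensor (natMod n s) (tensor (dual (natMod n s)) X)) 0 := by
  refine mem_homPart (fun m => ?_) (fun r x hx m => ?_)
  · rw [cupL_apply, cupL_apply, map_sum, sg_zero, one_smul]
    refine Finset.sum_congr rfl fun a _ => ?_
    rw [tensor_par, tensor_par, par_bas, par_cobas, smul_tmul, ← smul_tmul', smul_smul,
      sg_mul_self, one_smul]
  · rw [cupL_apply, cupL_apply, map_sum, zero_mul, sg_zero, one_smul]
    have : ∀ a : Idx n, (tensor (natMod n s) (tensor (dual (natMod n s)) X)).rho x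
        (bas (s := s) a ⊗ₜ[k] (cobas (s := s) a ⊗ₜ[k] m)) =
        (∑ b, x.1 b a • (bas (s := s) b ⊗ₜ[k] (cobas (s := s) a ⊗ₜ[k] m)) -
          ∑ b, x.1 a b • (bas (s := s) a ⊗ₜ[k] (cobas (s := s) b ⊗ₜ[k] m))) +
        bas (s := s) a ⊗ₜ[k] (cobas (s := s) a ⊗ₜ[k] X.rho x m) := by
      intro a
      rw [tensor_rho _ _ hx, tensor_rho _ _ hx, rho_bas, rho_cobas hx, parPow_bas, parPow_cobas,
        tmul_add, sum_tmul, sum_tmul, tmul_sum, sub_eq_add_neg, add_assoc,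
        ← Finset.sum_neg_distrib]
      congr 1
      congr 1
      · refine Finset.sum_congr rfl fun b _ => ?_
        rw [← smul_tmul', ← smul_tmul', tmul_smul, smul_tmul', neg_smul, neg_tmul, mul_comm,
          smul_neg, smul_assoc, ← smul_tmul', smul_smul, sg_mul_self, one_smul, ← smul_tmul']
      · rw [← smul_tmul', ← smul_tmul', tmul_smul, smul_smul, sg_mul_self, one_smul]
    simp only [this, Finset.sum_add_distrib, Finset.sum_sub_distrib]
    rw [Finset.sum_comm, sub_self, zero_add]

/-- `f ⊗ v ⊗ m ↦ f(v) m`. -/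
def capL (X : SMod n s) : tensor (dual (natMod n s)) (tensor (natMod n s) X) →ₗ[k] X :=
  (TensorProduct.lid k X).toLinearMap ∘ₗ
    TensorProduct.map (contractLeft k (natMod n s)) LinearMap.id ∘ₗ
    (TensorProduct.assoc k (Module.Dual k (natMod n s)) (natMod n s) X).symm.toLinearMap

theorem capL_apply (X : SMod n s) (f : Module.Dual k (natMod n s)) (v : natMod n s) (m : X) :
    capL X (f ⊗ₜ[k] (v ⊗ₜ[k] m)) = f v • m := by
  simp [capL]

/-- The component of parity `p` of a vector of `V`. -/
def vPart (p : ZMod 2) : natMod n s →ₗ[k] natMod n s where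
  toFun v := fun a => if a.2 = p then (v : Idx n → k) a else 0
  map_add' v w := by
    funext a
    by_cases h : a.2 = p <;> simp [h]
  map_smul' r v := by
    funext a
    by_cases h : a.2 = p <;> simp [h]

theorem vPart_of_mem [NeZero (2 : k)] {p r : ZMod 2} {v : natMod n s} (hv : v ∈ (natMod n s).part p) :
    vPart r v = if r = p then v else 0 := by
  have h2 : (2 : k) ≠ 0 := NeZero.ne 2
  have h0 : ∀ a : Idx n, a.2 ≠ p → (v : Idx n → k) a = 0 := by
    intro a hap
    have ha : sg a.2 • (v : Idx n → k) a = sg p • (v : Idx n → k) a := congrFun hv a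
    have : (2 : k) * (v : Idx n → k) a = 0 := by
      rcases zmod2_cases p with rfl | rfl <;> rcases zmod2_cases a.2 with h | h <;>
        rw [h] at ha hap
      · exact absurd rfl hap
      · rw [sg_one, sg_zero, neg_smul, one_smul] at ha
        linear_combination -ha
      · rw [sg_one, sg_zero, neg_smul, one_smul] at ha
        linear_combination ha
      · exact absurd rfl hap
    exact (mul_eq_zero.1 this).resolve_left h2
  funext a
  change (if a.2 = r then (v : Idx n → k) a else 0) = _
  by_cases hr : r = p
  · subst hr
    rw [if_pos rfl]
    split_ifs with h
    · rfl
    · exact (h0 a h).symm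
  · rw [if_neg hr]
    split_ifs with h
    · exact h0 a (by rw [h]; exact hr)
    · rfl

/-- The graded flip `v ⊗ w ⊗ m ↦ (-1)^{|v||w|} w ⊗ v ⊗ m`. -/
def crossL (W X : SMod n s) :
    tensor (natMod n s) (tensor W X) →ₗ[k] tensor W (tensor (natMod n s) X) :=
  ∑ p : ZMod 2, (TensorProduct.leftComm k (natMod n s) W X).toLinearMap ∘ₗ
    TensorProduct.map (vPart p) (TensorProduct.map (W.parPow p) LinearMap.id)

theorem crossL_apply [NeZero (2 : k)] (W X : SMod n s) {p : ZMod 2} {v : natMod n s}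
    (hv : v ∈ (natMod n s).part p) (w : W) (m : X) :
    crossL W X (v ⊗ₜ[k] (w ⊗ₜ[k] m)) = W.parPow p w ⊗ₜ[k] (v ⊗ₜ[k] m) := by
  rw [crossL, LinearMap.sum_apply, Finset.sum_eq_single p]
  · simp [vPart_of_mem hv]
  · intro r _ hr
    simp [vPart_of_mem hv, if_neg hr]
  · simp

/-- A version of `mem_homPart_tensor` for the natural supermodule. -/
theorem mem_homPart_bas {M N : SMod n s} {p : ZMod 2} {f : natMod n s ⊗[k] M →ₗ[k] N}
    (hpar : ∀ a m, N.par (f (bas a ⊗ₜ m)) = sg p • f ((natMod n s).par (bas a) ⊗ₜ M.par m))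
    (hf : ∀ (r : ZMod 2) (x : q n s), MatHomog r x.1 → ∀ a m,
      f ((natMod n s).rho x (bas a) ⊗ₜ m) + f ((natMod n s).parPow r (bas a) ⊗ₜ M.rho x m) =
        sg (p * r) • N.rho x (f (bas a ⊗ₜ m))) :
    f ∈ homPart (tensor (natMod n s) M) N p := by
  refine mem_homPart_tensor (fun w m => ?_) (fun r x hx w m => ?_)
  · have : (N.par ∘ₗ f) = sg p • f ∘ₗ TensorProduct.map (natMod n s).par M.par :=
      ext_bas fun a x => hpar a x
    exact LinearMap.congr_fun this (w ⊗ₜ m)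
  · have : f ∘ₗ TensorProduct.map ((natMod n s).rho x) LinearMap.id +
        f ∘ₗ TensorProduct.map ((natMod n s).parPow r) (M.rho x) =
        sg (p * r) • (N.rho x ∘ₗ f) := ext_bas fun a m => hf r x hx a m
    exact LinearMap.congr_fun this (w ⊗ₜ m)

theorem crossL_mem [NeZero (2 : k)] (W X : SMod n s) :
    crossL W X ∈ homPart (tensor (natMod n s) (tensor W X)) (tensor W (tensor (natMod n s) X)) 0 := by
  refine mem_homPart_bas (fun a t => ?_) (fun r x hx a t => ?_)
  · induction t using TensorProduct.induction_on with
    | zero => simp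
    | tmul w m =>
      rw [tensor_par, crossL_apply _ _ (bas_mem a), tensor_par, tensor_par, par_bas, ← smul_tmul',
        ← smul_tmul', map_zsmul, crossL_apply _ _ (bas_mem a), W.par_parPow, tmul_smul, sg_zero,
        one_smul]
    | add b c hb hc => simp only [map_add, tmul_add, smul_add, hb, hc]
  · induction t using TensorProduct.induction_on with
    | zero => simp
    | tmul w m =>
      rw [tensor_rho _ _ hx, crossL_apply _ _ (rho_mem hx (bas_mem a)), parPow_bas, ← smul_tmul',
        map_zsmul, tmul_add, map_add, crossL_apply _ _ (bas_mem a), crossL_apply _ _ (bas_mem a),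
        crossL_apply _ _ (bas_mem a), tensor_rho _ _ hx, tensor_rho _ _ hx, W.parPow_rho hx,
        parPow_parPow, parPow_parPow, zero_mul, sg_zero, one_smul, parPow_bas, tmul_add,
        ← smul_tmul', ← smul_tmul', tmul_smul, smul_add, smul_smul, mul_comm a.2 r, sg_mul_self,
        one_smul, add_comm a.2 r]
      abel
    | add b c hb hc =>
      simp only [map_add, tmul_add, smul_add]
      rw [← hb, ← hc]; abel

theorem capL_mem (X : SMod n s) :
    capL X ∈ homPart (tensor (dual (natMod n s)) (tensor (natMod n s) X)) X 0 := by
  refine mem_homPart_tensor (fun f t => ?_) (fun r x hx f t => ?_)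
  · induction t using TensorProduct.induction_on with
    | zero => simp
    | tmul v m =>
      rw [tensor_par, capL_apply, capL_apply, sg_zero, one_smul, map_smul]
      change _ = (f ((natMod n s).par ((natMod n s).par v))) • _
      rw [par_par]
    | add b c hb hc => simp only [map_add, tmul_add, smul_add, hb, hc]
  · induction t using TensorProduct.induction_on with
    | zero => simp
    | tmul v m =>
      have h1 : ∀ v, ((dual (natMod n s)).parPow r f : Module.Dual k (natMod n s)) v =
          f ((natMod n s).parPow r v) := by
        intro v; rcases zmod2_cases r with rfl | rfl <;> rfl
      rw [tensor_rho _ _ hx, tmul_add, map_add, capL_apply, capL_apply, capL_apply, capL_apply,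
        ofRho_rho, dualRho_apply _ hx, h1, h1, parPow_parPow]
      have : ∀ r : ZMod 2, r + r = 0 := by decide
      simp [this]
    | add b c hb hc =>
      simp only [map_add, tmul_add, smul_add]
      rw [← hb, ← hc]; abel

variable (n s) in
/-- The odd map `c` of `V`. -/
def cLin : natMod n s →ₗ[k] natMod n s := Matrix.toLin' (cMat n s)

/-- `v ⊗ m ↦ c(v) ⊗ m`. -/
def cliffL (X : SMod n s) : tensor (natMod n s) X →ₗ[k] tensor (natMod n s) X :=
  TensorProduct.map (cLin n s) LinearMap.id

theorem cLin_bas (a : Idx n) :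
    cLin n s (bas a) = (sg a.2 • s.val) • bas (s := s) (a.1, a.2 + 1) := by
  funext b
  change ((cMat n s).mulVec (Pi.single a (1 : k))) b =
    (sg a.2 • s.val) • (Pi.single (a.1, a.2 + 1) (1 : k) : Idx n → k) b
  rw [Matrix.mulVec_single_one, Matrix.col_apply, cMat, Matrix.of_apply, Pi.single_apply]
  simp only [Prod.ext_iff]
  split_ifs <;> simp

theorem cliffL_bas (X : SMod n s) (a : Idx n) (m : X) :
    cliffL X (bas a ⊗ₜ[k] m) =
      (sg a.2 • s.val) • (bas (s := s) (a.1, a.2 + 1) ⊗ₜ[k] m) := by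
  rw [cliffL, TensorProduct.map_tmul, smul_tmul', LinearMap.id_apply, cLin_bas]

theorem cLin_rho {p : ZMod 2} {x : q n s} (hx : MatHomog p x.1) (v : natMod n s) :
    cLin n s ((natMod n s).rho x v) = sg p • (natMod n s).rho x (cLin n s v) := by
  have h : superBracket x.1 (cMat n s) = 0 := x.2
  rw [superBracket_of_homog hx cMat_homog, mul_one, sub_eq_zero] at h
  rw [ofRho_rho]
  change (cMat n s).mulVec (x.1.mulVec v) = sg p • (x.1.mulVec ((cMat n s).mulVec v))
  rw [Matrix.mulVec_mulVec, Matrix.mulVec_mulVec, h, Matrix.smul_mulVec, smul_smul, sg_mul_self,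
    one_smul]

theorem cLin_par (v : natMod n s) :
    cLin n s ((natMod n s).par v) = -(natMod n s).par (cLin n s v) := by
  rw [← sum_bas v, map_sum, map_sum, map_sum, map_sum, ← Finset.sum_neg_distrib]
  refine Finset.sum_congr rfl fun a _ => ?_
  rw [map_smul, map_smul, map_smul, map_smul, ← smul_neg, par_bas, map_zsmul, cLin_bas, map_smul,
    par_bas, sg_add, sg_one, mul_neg_one, neg_smul, smul_neg, smul_neg, smul_neg, neg_neg, smul_comm (sg a.2)]

theorem cliffL_mem (X : SMod n s) :
    cliffL X ∈ homPart (tensor (natMod n s) X) (tensor (natMod n s) X) 1 := by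
  refine mem_homPart_tensor (fun v m => ?_) (fun r x hx v m => ?_)
  · rw [cliffL, map_tmul, tensor_par, map_tmul, cLin_par, sg_one, neg_tmul, neg_smul, one_smul,
      neg_neg]
    rfl
  · have h1 : cLin n s ((natMod n s).parPow r v) = sg r • (natMod n s).parPow r (cLin n s v) := by
      rcases zmod2_cases r with rfl | rfl
      · rw [sg_zero, one_smul]; rfl
      · rw [sg_one, neg_smul, one_smul]; exact cLin_par v
    rw [cliffL, map_tmul, map_tmul, map_tmul, cLin_rho hx, h1, tensor_rho _ _ hx, one_mul,
      smul_add, smul_tmul', smul_tmul']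
    rfl

end SMod

end

end TypeQ

/-! ### The Casimir element -/

namespace TypeQ

open TensorProduct

section

variable {k : Type u} [Field k] {n : ℕ} {s : SqrtNegOne k}

theorem eMat_mem (ε : ZMod 2) (i j : Fin n) :
    (Matrix.single (i, ε) (j, 0) 1 + Matrix.single (i, ε + 1) (j, 1) 1 : Mat k n) ∈ q n s := by
  rw [mem_q]
  intro a b p r
  simp only [Matrix.add_apply, Matrix.single_apply, Prod.mk.injEq]
  rcases zmod2_cases ε with rfl | rfl <;> rcases zmod2_cases p with rfl | rfl <;>
    rcases zmod2_cases r with rfl | rfl <;> simp [show (1 : ZMod 2) + 1 = 0 from rfl]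

variable (s) in
/-- The basis element `e_{i,j}^ε` of `q(n)`: `e_{i,j}^0 = e_{i,j} + e_{ī,j̄}` and
`e_{i,j}^1 = e_{ī,j} + e_{i,j̄}`. -/
def e (ε : ZMod 2) (i j : Fin n) : q n s :=
  ⟨Matrix.single (i, ε) (j, 0) 1 + Matrix.single (i, ε + 1) (j, 1) 1, eMat_mem ε i j⟩

/-- The matrices `ẽ_{i,j}^0 = e_{i,j} - e_{ī,j̄}` and `ẽ_{i,j}^1 = e_{ī,j} - e_{i,j̄}`. -/
def eTilde (ε : ZMod 2) (i j : Fin n) : Mat k n :=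
  Matrix.single (i, ε) (j, 0) 1 - Matrix.single (i, ε + 1) (j, 1) 1

theorem e_homog (ε : ZMod 2) (i j : Fin n) : MatHomog ε (e s ε i j).1 := by
  have h1 : ∀ ε : ZMod 2, ε + 1 + 1 = ε := by decide
  intro a b h
  simp only [e, Matrix.add_apply, Matrix.single_apply]
  rw [if_neg, if_neg, add_zero]
  · rintro ⟨rfl, rfl⟩; exact h (h1 ε)
  · rintro ⟨rfl, rfl⟩; exact h (add_zero ε)

theorem e_apply (ε : ZMod 2) (i j : Fin n) (a c : Idx n) :
    (e s ε i j).1 a c = if c.1 = j ∧ a = (i, c.2 + ε) then 1 else 0 := by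
  obtain ⟨c, r⟩ := c
  simp only [e, Matrix.add_apply, Matrix.single_apply, Prod.mk.injEq]
  rcases zmod2_cases r with rfl | rfl
  · by_cases h1 : (i, ε) = a
    · simp [h1, eq_comm]
    · have : ¬ (a = (i, ε)) := fun h => h1 h.symm
      simp [h1, this]
  · rw [add_comm 1 ε]
    by_cases h1 : (i, ε + 1) = a
    · subst h1
      simp [eq_comm]
    · have : ¬ (a = (i, ε + 1)) := fun h => h1 h.symm
      simp [h1, this]

theorem q_apply {δ : ZMod 2} {x : q n s} (hx : MatHomog δ x.1) (i j : Fin n) (p r : ZMod 2) :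
    x.1 (i, p) (j, r) = if p = r + δ then x.1 (i, δ) (j, 0) else 0 := by
  split_ifs with h
  · subst h
    rcases zmod2_cases r with rfl | rfl
    · rw [zero_add]
    · have := mem_q.1 x.2 i j δ 0
      rwa [zero_add, add_comm] at this
  · refine hx _ _ fun h2 => h ?_
    rw [← h2]
    have h3 : ∀ p r : ZMod 2, p = r + (p + r) := by decide
    exact h3 p r

theorem bracket_e {δ : ZMod 2} {x : q n s} (hx : MatHomog δ x.1) (ε : ZMod 2) (b j : Fin n) :
    qBracket x (e s ε b j) = ∑ l, x.1 (l, δ) (b, 0) • e s (δ + ε) l j -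
      sg (δ * ε) • ∑ l, x.1 (j, δ) (l, 0) • e s (δ + ε) b l := by
  refine Subtype.ext ?_
  change superBracket x.1 (e s ε b j).1 = _
  rw [superBracket_of_homog hx (e_homog ε b j)]
  simp only [Submodule.coe_sub, Submodule.coe_smul, Submodule.coe_sum, Submodule.coe_smul_of_tower]
  congr 1
  · ext ⟨a, p⟩ ⟨c, r⟩
    rw [Matrix.mul_apply, Matrix.sum_apply]
    simp only [Matrix.smul_apply, e_apply, Prod.mk.injEq, smul_eq_mul, mul_ite, mul_one, mul_zero]
    by_cases hc : c = j
    · subst hc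
      simp only [true_and, Finset.sum_ite_eq', Finset.mem_univ, if_true]
      rw [q_apply hx]
      by_cases hp : p = r + ε + δ
      · rw [if_pos hp]
        simp [hp, add_assoc, add_comm ε δ]
      · rw [if_neg hp]
        have : p ≠ r + (δ + ε) := by rwa [add_comm δ, ← add_assoc]
        simp [this]
    · simp [hc]
  · congr 1
    ext ⟨a, p⟩ ⟨c, r⟩
    rw [Matrix.mul_apply, Matrix.sum_apply]
    simp only [Matrix.smul_apply, e_apply, Prod.mk.injEq, smul_eq_mul, mul_ite, mul_one, mul_zero,
      ite_mul, one_mul, zero_mul]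
    have h1 : ∀ p d ε : ZMod 2, p = d + ε ↔ d = p + ε := by decide
    by_cases ha : a = b
    · subst ha
      rw [Finset.sum_eq_single (j, p + ε), Finset.sum_eq_single c]
      · have h2 : ∀ p ε r δ : ZMod 2, (p + ε = r + δ) ↔ (p = r + (δ + ε)) := by decide
        have := h2 p ε r δ
        simp [q_apply hx j c (p + ε) r, this, h1 p (p + ε) ε]
      · intro l _ hl
        rw [if_neg]; rintro ⟨h, -⟩; exact hl h.symm
      · simp
      · rintro ⟨d, t⟩ _ hd
        rw [if_neg]
        rintro ⟨h, -, h2⟩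
        exact hd (Prod.ext h ((h1 _ _ _).1 h2))
      · simp
    · simp [ha]

namespace SMod

theorem rho_e_bas (ε : ZMod 2) (b j a : Fin n) (p : ZMod 2) :
    (natMod n s).rho (e s ε b j) (bas (a, p)) = if a = j then bas (b, p + ε) else 0 := by
  rw [rho_bas, Finset.sum_eq_single (b, p + ε)]
  · simp only [e_apply]
    split_ifs <;> simp_all
  · intro c _ hc
    rw [e_apply, if_neg (fun h => hc h.2), zero_smul]
  · simp

theorem rho_bas_homog {δ : ZMod 2} {x : q n s} (hx : MatHomog δ x.1) (b : Fin n) (p : ZMod 2) :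
    (natMod n s).rho x (bas (b, p)) = ∑ l, x.1 (l, δ) (b, 0) • bas (s := s) (l, p + δ) := by
  rw [rho_bas, Fintype.sum_prod_type]
  refine Finset.sum_congr rfl fun l _ => ?_
  rw [Finset.sum_eq_single (p + δ)]
  · rw [q_apply hx, if_pos rfl]
  · intro r _ hr
    rw [q_apply hx, if_neg hr, zero_smul]
  · simp

/-- The action of the Casimir element `∑_{i,j} ∑_ε ẽ_{i,j}^ε ⊗ e_{j,i}^ε` on `V ⊗ X`. -/
def omegaL (X : SMod n s) : tensor (natMod n s) X →ₗ[k] tensor (natMod n s) X :=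
  ∑ i : Fin n, ∑ j : Fin n, ∑ ε : ZMod 2,
    TensorProduct.map (Matrix.toLin' (eTilde ε i j) ∘ₗ (natMod n s).parPow ε) (X.rho (e s ε j i))

theorem eTilde_bas (ε : ZMod 2) (i j b : Fin n) (p : ZMod 2) :
    (Matrix.toLin' (eTilde ε i j) ∘ₗ (natMod n s).parPow ε) (bas (b, p)) =
      if j = b then sg (p * (ε + 1)) • bas (s := s) (i, p + ε) else 0 := by
  rw [LinearMap.comp_apply, parPow_bas, map_zsmul]
  have : Matrix.toLin' (eTilde ε i j) (bas (s := s) (b, p)) =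
      if j = b then sg p • bas (s := s) (i, p + ε) else 0 := by
    funext a
    change ((eTilde ε i j).mulVec (Pi.single (b, p) (1 : k))) a = _
    rw [Matrix.mulVec_single_one, Matrix.col_apply]
    simp only [eTilde, Matrix.sub_apply, Matrix.single_apply, Prod.mk.injEq]
    by_cases hj : j = b
    · simp only [hj, if_true, true_and]
      change _ = sg p • (Pi.single (i, p + ε) (1 : k) : Idx n → k) a
      rw [Pi.single_apply]
      simp only [eq_comm (a := a)]
      rcases zmod2_cases p with rfl | rfl
      · simp
      · simp only [add_comm ε 1]; by_cases h : (i, 1 + ε) = a <;> simp [h]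
    · simp only [hj, if_false, false_and, and_false, sub_self]; rfl
  rw [this]
  split_ifs
  · rw [smul_smul, ← sg_add, mul_add, mul_one]
  · rw [smul_zero]

theorem omegaL_bas (X : SMod n s) (b : Fin n) (p : ZMod 2) (m : X) :
    omegaL X (bas (b, p) ⊗ₜ[k] m) = ∑ j : Fin n, ∑ ε : ZMod 2,
      sg (p * (ε + 1)) • (bas (s := s) (j, p + ε) ⊗ₜ[k] X.rho (e s ε b j) m) := by
  simp only [omegaL, LinearMap.sum_apply, TensorProduct.map_tmul]
  refine Finset.sum_congr rfl fun i _ => ?_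
  rw [Finset.sum_eq_single b]
  · refine Finset.sum_congr rfl fun ε _ => ?_
    rw [eTilde_bas, if_pos rfl, smul_tmul']
  · intro j _ hj
    refine Finset.sum_eq_zero fun ε _ => ?_
    rw [eTilde_bas, if_neg hj, zero_tmul]
  · simp

theorem omegaL_mem (X : SMod n s) :
    omegaL X ∈ homPart (tensor (natMod n s) X) (tensor (natMod n s) X) 0 := by
  refine mem_homPart_bas ?_ ?_
  · rintro ⟨b, p⟩ m
    rw [par_bas, ← smul_tmul', map_zsmul, omegaL_bas, omegaL_bas, map_sum, sg_zero, one_smul,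
      Finset.smul_sum]
    refine Finset.sum_congr rfl fun j _ => ?_
    rw [map_sum, Finset.smul_sum]
    refine Finset.sum_congr rfl fun ε _ => ?_
    rw [map_zsmul, tensor_par, par_bas, X.par_rho (e_homog ε b j), ← smul_tmul', tmul_smul,
      smul_smul, smul_smul, smul_smul]
    have h : ∀ p ε : ZMod 2, sg (p * (ε + 1)) * sg (p + ε) * sg ε = sg p * sg (p * (ε + 1)) := by
      decide
    rw [← h]
  · rintro δ x hx ⟨b, p⟩ m
    let A : ZMod 2 → ZMod 2 → tensor (natMod n s) X := fun t ε => ∑ j, ∑ l,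
      x.1 (l, δ) (b, 0) • (bas (s := s) (j, t) ⊗ₜ[k] X.rho (e s ε l j) m)
    let B : ZMod 2 → ZMod 2 → tensor (natMod n s) X := fun t ε => ∑ j, ∑ l,
      x.1 (l, δ) (j, 0) • (bas (s := s) (l, t) ⊗ₜ[k] X.rho (e s ε b j) m)
    let C : ZMod 2 → ZMod 2 → tensor (natMod n s) X := fun t ε => ∑ j,
      (bas (s := s) (j, t) ⊗ₜ[k] X.rho (e s ε b j) (X.rho x m))
    have h1 : omegaL X ((natMod n s).rho x (bas (b, p)) ⊗ₜ m) =
        ∑ ε, sg ((p + δ) * (ε + 1)) • A (p + δ + ε) ε := by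
      have h0 : ∀ l, omegaL X ((x.1 (l, δ) (b, 0) • bas (s := s) (l, p + δ)) ⊗ₜ m) =
          ∑ ε, sg ((p + δ) * (ε + 1)) • ∑ j,
            x.1 (l, δ) (b, 0) • (bas (s := s) (j, p + δ + ε) ⊗ₜ[k] X.rho (e s ε l j) m) := by
        intro l
        rw [← smul_tmul', map_smul, omegaL_bas, Finset.sum_comm, Finset.smul_sum]
        refine Finset.sum_congr rfl fun ε _ => ?_
        rw [← Finset.smul_sum, smul_comm, Finset.smul_sum]
      rw [rho_bas_homog hx, sum_tmul, map_sum, Finset.sum_congr rfl fun l _ => h0 l,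
        Finset.sum_comm]
      refine Finset.sum_congr rfl fun ε _ => ?_
      rw [← Finset.smul_sum, Finset.sum_comm]
    have h2 : omegaL X ((natMod n s).parPow δ (bas (b, p)) ⊗ₜ X.rho x m) =
        sg (p * δ) • ∑ ε, sg (p * (ε + 1)) • C (p + ε) ε := by
      rw [parPow_bas, ← smul_tmul', map_zsmul, omegaL_bas, Finset.sum_comm]
      simp only [C, Finset.smul_sum]
    have h3 : ∀ ε j, X.rho x (X.rho (e s ε b j) m) = X.rho (qBracket x (e s ε b j)) m +
        sg (δ * ε) • X.rho (e s ε b j) (X.rho x m) := by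
      intro ε j
      rw [X.rho_bracket hx (e_homog ε b j)]
      simp only [LinearMap.sub_apply, LinearMap.smul_apply, Module.End.mul_apply]
      abel
    have h4 : (tensor (natMod n s) X).rho x (omegaL X (bas (b, p) ⊗ₜ m)) =
        ∑ ε, sg (p * (ε + 1)) • (B (p + ε + δ) ε + sg ((p + ε) * δ) •
          (A (p + ε) (δ + ε) - sg (δ * ε) • B (p + ε) (δ + ε) + sg (δ * ε) • C (p + ε) ε)) := by
      rw [omegaL_bas, Finset.sum_comm, map_sum]
      refine Finset.sum_congr rfl fun ε _ => ?_
      rw [map_sum]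
      have hB : B (p + ε) (δ + ε) = ∑ j, ∑ l,
          x.1 (j, δ) (l, 0) • (bas (s := s) (j, p + ε) ⊗ₜ[k] X.rho (e s (δ + ε) b l) m) :=
        Finset.sum_comm
      rw [hB]
      have h5 : ∀ j, (tensor (natMod n s) X).rho x (sg (p * (ε + 1)) •
          (bas (s := s) (j, p + ε) ⊗ₜ[k] X.rho (e s ε b j) m)) = sg (p * (ε + 1)) •
          ((∑ l, x.1 (l, δ) (j, 0) • (bas (s := s) (l, p + ε + δ) ⊗ₜ[k] X.rho (e s ε b j) m)) +
            sg ((p + ε) * δ) •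
          ((∑ l, x.1 (l, δ) (b, 0) • (bas (s := s) (j, p + ε) ⊗ₜ[k] X.rho (e s (δ + ε) l j) m)) -
            sg (δ * ε) • (∑ l, x.1 (j, δ) (l, 0) •
              (bas (s := s) (j, p + ε) ⊗ₜ[k] X.rho (e s (δ + ε) b l) m)) +
            sg (δ * ε) • (bas (s := s) (j, p + ε) ⊗ₜ[k] X.rho (e s ε b j) (X.rho x m)))) := by
        intro j
        rw [map_zsmul, tensor_rho _ _ hx, rho_bas_homog hx, parPow_bas, h3, bracket_e hx,
          sum_tmul, ← smul_tmul', tmul_add, map_sub, map_zsmul, map_sum, map_sum,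
          LinearMap.sub_apply, LinearMap.smul_apply, LinearMap.sum_apply, LinearMap.sum_apply,
          tmul_sub, tmul_smul, tmul_smul, tmul_sum, tmul_sum]
        simp only [map_smul, LinearMap.smul_apply, tmul_smul, ← smul_tmul']
      rw [Finset.sum_congr rfl fun j _ => h5 j, ← Finset.smul_sum, Finset.sum_add_distrib,
        ← Finset.smul_sum, Finset.sum_add_distrib, Finset.sum_sub_distrib, ← Finset.smul_sum,
        ← Finset.smul_sum]
    rw [h1, h2, h4]
    generalize A = A
    generalize B = B
    generalize C = C
    simp only [sum_zmod2]
    have e1 : (1 : ZMod 2) + 1 = 0 := rfl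
    rcases zmod2_cases p with rfl | rfl <;> rcases zmod2_cases δ with rfl | rfl <;>
      simp only [e1, zero_add, add_zero, mul_zero, mul_one, sg_zero, sg_one, one_smul,
        neg_smul] <;> abel

end SMod

end

end TypeQ

/-! ### The monoidal superfunctor `Ψ` -/

set_option linter.unusedSectionVars false

namespace AOBC

section shapes

variable {k : Type u} [Field k] {C : Type v} [Category.{w} C] [Preadditive C] [Linear k C]
  [Supercategory k C] (Φ : Letter → Superfunctor k C)
  (γ : ∀ {a b : Word}, Gen a b → SuperNat (obj Φ a) (obj Φ b))

theorem total_11 {x y : Letter} {c d : Word} (f : Term k [x] [y]) (g : Term k c d) (X : C) :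
    (interp Φ γ (f ⊠ g)).total X =
      (Φ x).map ((interp Φ γ g).total X) ≫ (interp Φ γ f).total ((obj Φ d).obj X) := by
  rw [interp_tensor_total]
  change (Φ x).map (𝟙 _) ≫ ((Φ x).map ((interp Φ γ g).total X) ≫
    (interp Φ γ f).total ((obj Φ d).obj X)) ≫ (Φ y).map (𝟙 _) = _
  rw [CategoryTheory.Functor.map_id, CategoryTheory.Functor.map_id, Category.id_comp]
  exact Category.comp_id _

theorem total_id1 {x : Letter} {c d : Word} (g : Term k c d) (X : C) :
    (interp Φ γ (.id [x] ⊠ g)).total X = (Φ x).map ((interp Φ γ g).total X) := by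
  rw [total_11]
  change _ ≫ (SuperNat.id _).total _ = _
  rw [SuperNat.total_id]; exact Category.comp_id _

theorem total_id2 {x y : Letter} {c d : Word} (g : Term k c d) (X : C) :
    (interp Φ γ (.id [x, y] ⊠ g)).total X = (Φ x).map ((Φ y).map ((interp Φ γ g).total X)) := by
  rw [interp_tensor_total]
  change (Φ x).map ((Φ y).map (𝟙 _)) ≫ ((Φ x).map ((Φ y).map ((interp Φ γ g).total X)) ≫
    (SuperNat.id _).total _) ≫ (Φ x).map ((Φ y).map (𝟙 _)) = _
  rw [SuperNat.total_id, CategoryTheory.Functor.map_id, CategoryTheory.Functor.map_id,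
    CategoryTheory.Functor.map_id, CategoryTheory.Functor.map_id, Category.id_comp]
  exact (Category.comp_id _).trans (Category.comp_id _)

theorem comp_triple {A B : C} {p q : A ⟶ A} {r : B ⟶ B} (hp : p = 𝟙 A) (hq : q = 𝟙 A)
    (hr : r = 𝟙 B) (f : A ⟶ B) : p ≫ (q ≫ f) ≫ r = f := by
  subst hp hq hr; simp

theorem map_id1 {x : Letter} (X : C) : (Φ x).map (𝟙 X) = 𝟙 _ := CategoryTheory.Functor.map_id _ _

theorem map_id2 {x y : Letter} (X : C) : (Φ x).map ((Φ y).map (𝟙 X)) = 𝟙 _ := by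
  rw [map_id1, map_id1]

theorem total_22 {x y z t : Letter} {c : Word} (f : Term k [x, y] [z, t]) (X : C) :
    (interp Φ γ (f ⊠ .id c)).total X = (interp Φ γ f).total ((obj Φ c).obj X) := by
  rw [interp_tensor_total]
  change (Φ x).map ((Φ y).map (𝟙 _)) ≫ ((Φ x).map ((Φ y).map ((SuperNat.id _).total X)) ≫
    (interp Φ γ f).total ((obj Φ c).obj X)) ≫ (Φ z).map ((Φ t).map (𝟙 _)) = _
  rw [SuperNat.total_id]
  exact comp_triple (map_id2 Φ _) (map_id2 Φ _) (map_id2 Φ _) _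

theorem total_02 {x y : Letter} {c : Word} (f : Term k [] [x, y]) (X : C) :
    (interp Φ γ (f ⊠ .id c)).total X = (interp Φ γ f).total ((obj Φ c).obj X) := by
  rw [interp_tensor_total]
  change 𝟙 _ ≫ ((SuperNat.id _).total X ≫
    (interp Φ γ f).total ((obj Φ c).obj X)) ≫ (Φ x).map ((Φ y).map (𝟙 _)) = _
  rw [SuperNat.total_id]
  exact comp_triple rfl rfl (map_id2 Φ _) _

theorem total_20 {x y : Letter} {c : Word} (f : Term k [x, y] []) (X : C) :
    (interp Φ γ (f ⊠ .id c)).total X = (interp Φ γ f).total ((obj Φ c).obj X) := by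
  rw [interp_tensor_total]
  change (Φ x).map ((Φ y).map (𝟙 _)) ≫ ((Φ x).map ((Φ y).map ((SuperNat.id _).total X)) ≫
    (interp Φ γ f).total ((obj Φ c).obj X)) ≫ 𝟙 _ = _
  rw [SuperNat.total_id]
  exact comp_triple (map_id2 Φ _) (map_id2 Φ _) rfl _

theorem total_1id {x y : Letter} {c : Word} (f : Term k [x] [y]) (X : C) :
    (interp Φ γ (f ⊠ .id c)).total X = (interp Φ γ f).total ((obj Φ c).obj X) := by
  rw [total_11]
  change (Φ x).map ((SuperNat.id _).total X) ≫ _ = _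
  rw [SuperNat.total_id, CategoryTheory.Functor.map_id]; exact Category.id_comp _

end shapes

end AOBC

namespace TypeQ

open TensorProduct AOBC SMod

section

variable {k : Type u} [Field k] [NeZero (2 : k)] {n : ℕ} {s : SqrtNegOne k}

variable (n s) in
/-- The supermodules `V` and `V^*` for the letters `↑` and `↓`. -/
def letterMod : Letter → SMod n s
  | .up => natMod n s
  | .down => dual (natMod n s)

variable (n s) in
/-- `Ψ` on the generating objects: `↑ ↦ V ⊗ -` and `↓ ↦ V^* ⊗ -`. -/
def psiLetter (l : Letter) : Superfunctor k (SMod n s) := tensorFunctor (letterMod n s l)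

theorem toLin_neg {M N : SMod n s} (f : M ⟶ N) : toLin (-f) = -toLin f := by
  have := toLin_smul (-1 : k) f
  rwa [neg_smul, one_smul, neg_smul, one_smul] at this

/-- An even supernatural transformation from even linear maps. -/
def evenNat {F G : Superfunctor k (SMod n s)} (L : ∀ X, F.obj X →ₗ[k] G.obj X)
    (hL : ∀ X, L X ∈ homPart (F.obj X) (G.obj X) 0)
    (hn : ∀ {X Y : SMod n s} (f : X ⟶ Y) (t : F.obj X),
      L Y (toLin (F.map f) t) = toLin (G.map f) (L X t)) : SuperNat F G :=
  SuperNat.ofEven (fun X => evenHom (L X) (hL X)) (fun _ => rfl) (fun {X Y} f => by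
    refine toLin_injective ?_
    rw [toLin_comp, toLin_comp]
    simp only [toLin, ev_evenHom, od_evenHom, add_zero]
    exact LinearMap.ext fun t => hn f t)

/-- An odd supernatural transformation from odd linear maps. -/
def oddNat {F G : Superfunctor k (SMod n s)} (L : ∀ X, F.obj X →ₗ[k] G.obj X)
    (hL : ∀ X, L X ∈ homPart (F.obj X) (G.obj X) 1)
    (hn : ∀ {X Y : SMod n s} (f : X ⟶ Y) (t : F.obj X),
      L Y (ev (F.map f) t) = ev (G.map f) (L X t) ∧
      L Y (od (F.map f) t) = -od (G.map f) (L X t)) : SuperNat F G where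
  app p X := if p = 0 then 0 else oddHom (L X) (hL X)
  app_mem p X := by
    rcases zmod2_cases p with rfl | rfl
    · exact Submodule.zero_mem _
    · exact (rfl : (oddHom (L X) (hL X)).1 = 0)
  naturality p r X Y f hf := by
    rcases zmod2_cases p with rfl | rfl
    · simp
    · have h0 : ∀ t, L Y (ev (F.map f) t) = ev (G.map f) (L X t) := fun t => (hn f t).1
      have h1 : ∀ t, L Y (od (F.map f) t) = -od (G.map f) (L X t) := fun t => (hn f t).2
      rcases zmod2_cases r with rfl | rfl
      · have hF : od (F.map f) = 0 := congrArg Subtype.val (F.map_mem hf : (F.map f).2 = 0)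
        have hG : od (G.map f) = 0 := congrArg Subtype.val (G.map_mem hf : (G.map f).2 = 0)
        refine toLin_injective (LinearMap.ext fun t => ?_)
        simp [toLin, ev_comp, od_comp, hF, hG, h0]
      · have hF : ev (F.map f) = 0 := congrArg Subtype.val (F.map_mem hf : (F.map f).1 = 0)
        have hG : ev (G.map f) = 0 := congrArg Subtype.val (G.map_mem hf : (G.map f).1 = 0)
        refine toLin_injective (LinearMap.ext fun t => ?_)
        simp only [one_ne_zero, if_false, mul_one, sg_one, neg_smul, one_smul]
        rw [toLin_neg, toLin_comp, toLin_comp]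
        simp [toLin, hF, hG, h1]


theorem total_evenNat {F G : Superfunctor k (SMod n s)} (L : ∀ X, F.obj X →ₗ[k] G.obj X) (hL)
    (hn) (X : SMod n s) : (evenNat (F := F) (G := G) L hL hn).total X = evenHom (L X) (hL X) :=
  SuperNat.total_ofEven _ _ _ X

theorem total_oddNat {F G : Superfunctor k (SMod n s)} (L : ∀ X, F.obj X →ₗ[k] G.obj X) (hL)
    (hn) (X : SMod n s) : (oddNat (F := F) (G := G) L hL hn).total X = oddHom (L X) (hL X) := by
  simp [SuperNat.total, oddNat]

section naturality

variable {X Y : SMod n s} (f : X ⟶ Y)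

/-- The linear map underlying `W ⊗ f`. -/
def tL1 (W : SMod n s) : W ⊗[k] X →ₗ[k] W ⊗[k] Y :=
  TensorProduct.map LinearMap.id (ev f) + TensorProduct.map W.par (od f)

/-- The linear map underlying `W ⊗ Z ⊗ f`. -/
def tL2 (W Z : SMod n s) : W ⊗[k] (Z ⊗[k] X) →ₗ[k] W ⊗[k] (Z ⊗[k] Y) :=
  TensorProduct.map LinearMap.id (TensorProduct.map LinearMap.id (ev f)) +
    TensorProduct.map W.par (TensorProduct.map Z.par (od f))

theorem tf1 (W : SMod n s) (w : W) (m : X) : tL1 f W (w ⊗ₜ[k] m) =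
    w ⊗ₜ[k] ev f m + W.par w ⊗ₜ[k] od f m := rfl

theorem tf2 (W Z : SMod n s) (w : W) (z : Z) (m : X) :
    tL2 f W Z (w ⊗ₜ[k] (z ⊗ₜ[k] m)) =
      w ⊗ₜ[k] (z ⊗ₜ[k] ev f m) + W.par w ⊗ₜ[k] (Z.par z ⊗ₜ[k] od f m) := rfl

theorem cup_natural (t : X) : cupL Y (toLin f t) =
    tL2 f (natMod n s) (dual (natMod n s))
      (cupL X t) := by
  rw [cupL_apply, cupL_apply, map_sum]
  refine Finset.sum_congr rfl fun a _ => ?_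
  rw [tf2, par_bas, par_cobas, ← smul_tmul', ← smul_tmul', tmul_smul, smul_smul,
    sg_mul_self, one_smul, ← tmul_add, ← tmul_add]
  rfl

theorem cap_natural (t : dual (natMod n s) ⊗[k] (natMod n s ⊗[k] X)) :
    capL Y (tL2 f (dual (natMod n s)) (natMod n s) t) =
      toLin f (capL X t) := by
  induction t using TensorProduct.induction_on with
  | zero => rw [map_zero, map_zero, map_zero, map_zero]
  | add a b ha hb => rw [map_add, map_add, map_add, map_add, ha, hb]
  | tmul g t =>
    induction t using TensorProduct.induction_on with
    | zero => rw [tmul_zero, map_zero, map_zero, map_zero, map_zero]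
    | add a b ha hb => rw [tmul_add, map_add, map_add, map_add, map_add, ha, hb]
    | tmul v m =>
      rw [tf2, map_add, capL_apply, capL_apply, capL_apply, map_smul]
      change g v • ev f m + g ((natMod n s).par ((natMod n s).par v)) • od f m =
        g v • (ev f m + od f m)
      rw [par_par, smul_add]

theorem cross_natural (W : SMod n s) (t : natMod n s ⊗[k] (W ⊗[k] X)) :
    crossL W Y (tL2 f (natMod n s) W t) =
      tL2 f W (natMod n s) (crossL W X t) := by
  refine LinearMap.congr_fun (ext_bas (f := crossL W Y ∘ₗ tL2 f (natMod n s) W) (g := tL2 f W (natMod n s) ∘ₗ crossL W X) fun a t => ?_) t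
  rw [LinearMap.comp_apply, LinearMap.comp_apply]
  induction t using TensorProduct.induction_on with
  | zero => rw [tmul_zero, map_zero, map_zero, map_zero, map_zero]
  | add a b ha hb => rw [tmul_add, map_add, map_add, map_add, map_add, ha, hb]
  | tmul w m =>
    rw [tf2, map_add, crossL_apply _ _ (bas_mem a), crossL_apply _ _ (bas_mem a), tf2, par_bas,
      ← smul_tmul', map_zsmul, crossL_apply _ _ (bas_mem a), W.par_parPow, ← smul_tmul', tmul_smul]

theorem omega_natural (t : natMod n s ⊗[k] X) :
    omegaL Y (tL1 f (natMod n s) t) =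
      tL1 f (natMod n s) (omegaL X t) := by
  refine LinearMap.congr_fun (ext_bas (f := omegaL Y ∘ₗ tL1 f (natMod n s))
    (g := tL1 f (natMod n s) ∘ₗ omegaL X) fun a m => ?_) t
  obtain ⟨b, p⟩ := a
  rw [LinearMap.comp_apply, LinearMap.comp_apply, tf1, map_add, par_bas, ← smul_tmul', map_zsmul,
    omegaL_bas, omegaL_bas, omegaL_bas, map_sum, Finset.smul_sum, ← Finset.sum_add_distrib]
  refine Finset.sum_congr rfl fun j _ => ?_
  rw [map_sum, Finset.smul_sum, ← Finset.sum_add_distrib]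
  refine Finset.sum_congr rfl fun ε _ => ?_
  rw [map_zsmul, tf1, hom_rho (ev_mem f) (e_homog ε b j), hom_rho (od_mem f) (e_homog ε b j),
    par_bas, zero_mul, sg_zero, one_smul, one_mul, ← smul_tmul', tmul_smul, smul_add, smul_smul,
    smul_smul, smul_smul]
  congr 2
  rw [sg_add]
  dsimp only
  linear_combination (-(sg (p * (ε + 1)) * sg p)) * sg_mul_self ε

theorem cliff_natural (t : natMod n s ⊗[k] X) :
    cliffL Y (TensorProduct.map LinearMap.id (ev f) t) =
      TensorProduct.map LinearMap.id (ev f) (cliffL X t) ∧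
    cliffL Y (TensorProduct.map (natMod n s).par (od f) t) =
      -TensorProduct.map (natMod n s).par (od f) (cliffL X t) := by
  induction t using TensorProduct.induction_on with
  | zero => simp
  | add a b ha hb => 
    simp only [map_add, ha.1, ha.2, hb.1, hb.2, neg_add, true_and]
  | tmul v m =>
    refine ⟨rfl, ?_⟩
    change cLin n s ((natMod n s).par v) ⊗ₜ[k] od f m =
      -((natMod n s).par (cLin n s v) ⊗ₜ[k] od f m)
    rw [cLin_par, neg_tmul]

end naturality

variable (n s) in
/-- `Ψ` on the generating morphisms. -/
def psiGen : {a b : Word} → Gen a b → SuperNat (obj (psiLetter n s) a) (obj (psiLetter n s) b)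
  | _, _, .cup => evenNat (F := obj (psiLetter n s) []) (G := obj (psiLetter n s) [.up, .down])
      cupL cupL_mem cup_natural
  | _, _, .cap => evenNat (F := obj (psiLetter n s) [.down, .up]) (G := obj (psiLetter n s) [])
      capL capL_mem cap_natural
  | _, _, .cross => evenNat (F := obj (psiLetter n s) [.up, .up])
      (G := obj (psiLetter n s) [.up, .up])
      (crossL (natMod n s)) (crossL_mem (natMod n s)) (fun f => cross_natural f (natMod n s))
  | _, _, .rcross => evenNat (F := obj (psiLetter n s) [.up, .down])
      (G := obj (psiLetter n s) [.down, .up])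
      (crossL (dual (natMod n s))) (crossL_mem (dual (natMod n s)))
      (fun f => cross_natural f (dual (natMod n s)))
  | _, _, .dot => evenNat (F := obj (psiLetter n s) [.up]) (G := obj (psiLetter n s) [.up])
      omegaL omegaL_mem omega_natural
  | _, _, .cliff => oddNat (F := obj (psiLetter n s) [.up]) (G := obj (psiLetter n s) [.up])
      cliffL cliffL_mem cliff_natural

end

end TypeQ

set_option linter.unusedSectionVars false

namespace TypeQ

open TensorProduct AOBC SMod

section

variable {k : Type u} [Field k] [NeZero (2 : k)] {n : ℕ} {s : SqrtNegOne k}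

theorem isHomog_evenNat {F G : Superfunctor k (SMod n s)} (L : ∀ X, F.obj X →ₗ[k] G.obj X) (hL)
    (hn) : (evenNat (F := F) (G := G) L hL hn).IsHomog 0 := SuperNat.isHomog_ofEven _ _ _

theorem psiGen_isHomog : ∀ {a b : Word} (g : Gen a b), (psiGen n s g).IsHomog g.parity
  | _, _, .cup => isHomog_evenNat _ _ cup_natural
  | _, _, .cap => isHomog_evenNat _ _ cap_natural
  | _, _, .cross => isHomog_evenNat _ _ (fun f => cross_natural f (natMod n s))
  | _, _, .rcross => isHomog_evenNat _ _ (fun f => cross_natural f (dual (natMod n s)))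
  | _, _, .dot => isHomog_evenNat _ _ omega_natural
  | _, _, .cliff => fun X => by
      change (if (1 : ZMod 2) + 1 = 0 then 0 else oddHom (cliffL X) (cliffL_mem X)) = 0
      exact if_pos rfl

variable (n s) in
/-- `Ψ` on expressions. -/
abbrev psiTerm {a b : Word} (t : Term k a b) :
    SuperNat (obj (psiLetter n s) a) (obj (psiLetter n s) b) :=
  interp (psiLetter n s) (psiGen n s) t

/-- The underlying linear maps of `Ψ` on expressions. -/
def lin {a b : Word} (t : Term k a b) (X : SMod n s) :
    (obj (psiLetter n s) a).obj X →ₗ[k] (obj (psiLetter n s) b).obj X :=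
  toLin ((psiTerm n s t).total X)

theorem psi_ext {a b : Word} {t t' : Term k a b} (h : ∀ X : SMod n s, lin t X = lin t' X) :
    psiTerm n s t = psiTerm n s t' :=
  SuperNat.ext_total fun X => toLin_injective (h X)

theorem lin_comp {a b c : Word} (t : Term k b c) (t' : Term k a b) (X : SMod n s) :
    lin (t ⊚ t') X = lin t X ∘ₗ lin t' X := by
  change toLin ((SuperNat.comp _ _).total X) = _
  rw [SuperNat.total_comp, toLin_comp]
  rfl

theorem lin_id (a : Word) (X : SMod n s) : lin (.id a) X = LinearMap.id := by
  change toLin ((SuperNat.id _).total X) = _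
  rw [SuperNat.total_id, toLin_id]

theorem lin_add {a b : Word} (t t' : Term k a b) (X : SMod n s) :
    lin (.add t t') X = lin t X + lin t' X := by
  change toLin ((SuperNat.add _ _).total X) = _
  rw [SuperNat.total_add, toLin_add]
  rfl

theorem lin_smul {a b : Word} (r : k) (t : Term k a b) (X : SMod n s) :
    lin (.smul r t) X = r • lin t X := by
  change toLin ((SuperNat.smul _ _).total X) = _
  rw [SuperNat.total_smul, toLin_smul]
  rfl

theorem lin_zero (a b : Word) (X : SMod n s) : lin (.zero a b) X = 0 := by
  change toLin ((SuperNat.zero _ _).total X) = _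
  rw [SuperNat.total_zero, toLin_zero]

theorem toLin_evenHom {M N : SMod n s} (f : M →ₗ[k] N) (hf) : toLin (evenHom f hf) = f := by
  simp [toLin]

theorem toLin_oddHom {M N : SMod n s} (f : M →ₗ[k] N) (hf) : toLin (oddHom f hf) = f := by
  simp [toLin]

theorem total_cup (X : SMod n s) :
    (psiTerm n s (.gen .cup)).total X = evenHom (cupL X) (cupL_mem X) :=
  total_evenNat _ _ cup_natural X

theorem lin_cup (X : SMod n s) : lin (.gen .cup) X = cupL X :=
  (congrArg toLin (total_cup X)).trans (toLin_evenHom _ _)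

theorem total_cap (X : SMod n s) :
    (psiTerm n s (.gen .cap)).total X = evenHom (capL X) (capL_mem X) :=
  total_evenNat _ _ cap_natural X

theorem lin_cap (X : SMod n s) : lin (.gen .cap) X = capL X :=
  (congrArg toLin (total_cap X)).trans (toLin_evenHom _ _)

theorem total_cross (X : SMod n s) :
    (psiTerm n s (.gen .cross)).total X = evenHom (crossL (natMod n s) X) (crossL_mem (natMod n s) X) :=
  total_evenNat _ _ (fun f => cross_natural f (natMod n s)) X

theorem lin_cross (X : SMod n s) : lin (.gen .cross) X = crossL (natMod n s) X :=
  (congrArg toLin (total_cross X)).trans (toLin_evenHom _ _)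

theorem total_rcross (X : SMod n s) :
    (psiTerm n s (.gen .rcross)).total X = evenHom (crossL (dual (natMod n s)) X) (crossL_mem (dual (natMod n s)) X) :=
  total_evenNat _ _ (fun f => cross_natural f (dual (natMod n s))) X

theorem lin_rcross (X : SMod n s) : lin (.gen .rcross) X = crossL (dual (natMod n s)) X :=
  (congrArg toLin (total_rcross X)).trans (toLin_evenHom _ _)

theorem total_dot (X : SMod n s) :
    (psiTerm n s (.gen .dot)).total X = evenHom (omegaL X) (omegaL_mem X) :=
  total_evenNat _ _ omega_natural X

theorem lin_dot (X : SMod n s) : lin (.gen .dot) X = omegaL X :=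
  (congrArg toLin (total_dot X)).trans (toLin_evenHom _ _)

theorem total_cliff (X : SMod n s) :
    (psiTerm n s (.gen .cliff)).total X = oddHom (cliffL X) (cliffL_mem X) :=
  total_oddNat _ _ cliff_natural X

theorem lin_cliff (X : SMod n s) : lin (.gen .cliff) X = cliffL X :=
  (congrArg toLin (total_cliff X)).trans (toLin_oddHom _ _)

theorem od_of_hasParity {a b : Word} {t : Term k a b} (h : HasParity 0 t) (X : SMod n s) :
    od ((psiTerm n s t).total X) = 0 := by
  have h1 := interp_isHomog (psiLetter n s) (psiGen n s) psiGen_isHomog h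
  rw [SuperNat.total_of_isHomog h1]
  exact congrArg Subtype.val (((psiTerm n s t).app_mem 0 X : ((psiTerm n s t).app 0 X).2 = 0))

theorem lin_id1 (x : Letter) {c d : Word} {t : Term k c d} (h : HasParity 0 t) (X : SMod n s) :
    lin (.id [x] ⊠ t) X = TensorProduct.map (M := letterMod n s x) LinearMap.id (lin t X) := by
  refine (congrArg toLin (total_id1 (psiLetter n s) (psiGen n s) t X)).trans ?_
  change TensorProduct.map LinearMap.id (ev ((psiTerm n s t).total X)) +
    TensorProduct.map (letterMod n s x).par (od ((psiTerm n s t).total X)) = _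
  simp only [lin, toLin, od_of_hasParity h X, add_zero]
  rw [TensorProduct.map_zero_right]
  exact add_zero _

theorem lin_id1_cliff (x : Letter) (X : SMod n s) : lin (.id [x] ⊠ .gen .cliff) X =
    TensorProduct.map (M := letterMod n s x) (letterMod n s x).par (cliffL X) := by
  have h : ev ((psiTerm n s (.gen .cliff)).total X) = 0 := by rw [total_cliff]; rfl
  have h1 : od ((psiTerm n s (.gen .cliff)).total X) = cliffL X := by rw [total_cliff]; rfl
  refine (congrArg toLin (total_id1 (psiLetter n s) (psiGen n s) _ X)).trans ?_
  change TensorProduct.map LinearMap.id (ev ((psiTerm n s (.gen .cliff)).total X)) +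
    TensorProduct.map (letterMod n s x).par (od ((psiTerm n s (.gen .cliff)).total X)) = _
  rw [h, h1]
  rw [TensorProduct.map_zero_right]
  exact zero_add _

theorem lin_22 {x y z t : Letter} {c : Word} (f : Term k [x, y] [z, t]) (X : SMod n s) :
    lin (f ⊠ .id c) X = lin f ((obj (psiLetter n s) c).obj X) :=
  congrArg toLin (total_22 _ _ f X)

theorem lin_02 {x y : Letter} {c : Word} (f : Term k [] [x, y]) (X : SMod n s) :
    lin (f ⊠ .id c) X = lin f ((obj (psiLetter n s) c).obj X) :=
  congrArg toLin (total_02 _ _ f X)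

theorem lin_20 {x y : Letter} {c : Word} (f : Term k [x, y] []) (X : SMod n s) :
    lin (f ⊠ .id c) X = lin f ((obj (psiLetter n s) c).obj X) :=
  congrArg toLin (total_20 _ _ f X)

theorem lin_1id {x y : Letter} {c : Word} (f : Term k [x] [y]) (X : SMod n s) :
    lin (f ⊠ .id c) X = lin f ((obj (psiLetter n s) c).obj X) :=
  congrArg toLin (total_1id _ _ f X)

theorem lin_11 {x y : Letter} {c d : Word} (f : Term k [x] [y]) (g : Term k c d) (X : SMod n s) :
    lin (f ⊠ g) X = lin f ((obj (psiLetter n s) d).obj X) ∘ₗ lin (.id [x] ⊠ g) X := by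
  refine (congrArg toLin (total_11 _ _ f g X)).trans ((toLin_comp _ _).trans ?_)
  exact congrArg _ (congrArg toLin (total_id1 _ _ g X)).symm

end

end TypeQ

set_option linter.unusedSectionVars false

namespace TypeQ

open TensorProduct AOBC SMod

section

variable {k : Type u} [Field k] [NeZero (2 : k)] {n : ℕ} {s : SqrtNegOne k}

section ext

variable {X Y : Type u} [AddCommGroup X] [Module k X] [AddCommGroup Y] [Module k Y]

theorem ext_bas_bas {f g : natMod n s ⊗[k] (natMod n s ⊗[k] X) →ₗ[k] Y}
    (h : ∀ a b x, f (bas a ⊗ₜ (bas b ⊗ₜ x)) = g (bas a ⊗ₜ (bas b ⊗ₜ x))) : f = g :=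
  ext_bas fun a t => LinearMap.congr_fun (ext_bas (f := f ∘ₗ TensorProduct.mk k _ _ (bas a))
    (g := g ∘ₗ TensorProduct.mk k _ _ (bas a)) fun b x => h a b x) t

theorem ext_bas_cobas {f g : natMod n s ⊗[k] (dual (natMod n s) ⊗[k] X) →ₗ[k] Y}
    (h : ∀ a b x, f (bas a ⊗ₜ (cobas b ⊗ₜ x)) = g (bas a ⊗ₜ (cobas b ⊗ₜ x))) : f = g :=
  ext_bas fun a t => LinearMap.congr_fun (ext_cobas (f := f ∘ₗ TensorProduct.mk k _ _ (bas a))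
    (g := g ∘ₗ TensorProduct.mk k _ _ (bas a)) fun b x => h a b x) t

theorem ext_cobas_bas {f g : dual (natMod n s) ⊗[k] (natMod n s ⊗[k] X) →ₗ[k] Y}
    (h : ∀ a b x, f (cobas a ⊗ₜ (bas b ⊗ₜ x)) = g (cobas a ⊗ₜ (bas b ⊗ₜ x))) : f = g :=
  ext_cobas fun a t => LinearMap.congr_fun (ext_bas (f := f ∘ₗ TensorProduct.mk k _ _ (cobas a))
    (g := g ∘ₗ TensorProduct.mk k _ _ (cobas a)) fun b x => h a b x) t

theorem ext_bas_bas_bas {f g : natMod n s ⊗[k] (natMod n s ⊗[k] (natMod n s ⊗[k] X)) →ₗ[k] Y}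
    (h : ∀ a b c x, f (bas a ⊗ₜ (bas b ⊗ₜ (bas c ⊗ₜ x))) = g (bas a ⊗ₜ (bas b ⊗ₜ (bas c ⊗ₜ x)))) :
    f = g :=
  ext_bas fun a t => LinearMap.congr_fun (ext_bas_bas (f := f ∘ₗ TensorProduct.mk k _ _ (bas a))
    (g := g ∘ₗ TensorProduct.mk k _ _ (bas a)) fun b c x => h a b c x) t

end ext

theorem cross_bas (X : SMod n s) (a b : Idx n) (m : X) :
    crossL (natMod n s) X (bas a ⊗ₜ[k] (bas b ⊗ₜ[k] m)) =
      sg (a.2 * b.2) • (bas (s := s) b ⊗ₜ[k] (bas (s := s) a ⊗ₜ[k] m)) := by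
  rw [crossL_apply _ _ (bas_mem a), parPow_bas, ← smul_tmul', mul_comm]

theorem cross_cobas (X : SMod n s) (a b : Idx n) (m : X) :
    crossL (dual (natMod n s)) X (bas a ⊗ₜ[k] (cobas b ⊗ₜ[k] m)) =
      sg (a.2 * b.2) • (cobas (s := s) b ⊗ₜ[k] (bas (s := s) a ⊗ₜ[k] m)) := by
  rw [crossL_apply _ _ (bas_mem a), parPow_cobas, ← smul_tmul', mul_comm]

theorem rel_cross_sq (X : SMod n s) :
    lin (.gen .cross ⊚ .gen .cross) X = lin (.id [.up, .up]) X := by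
  rw [lin_comp, lin_cross, lin_id]
  refine ext_bas_bas (f := crossL (natMod n s) X ∘ₗ crossL (natMod n s) X) (g := LinearMap.id)
    fun a b m => ?_
  rw [LinearMap.comp_apply, cross_bas, map_zsmul, cross_bas, smul_smul, mul_comm b.2, sg_mul_self,
    one_smul]
  rfl

theorem rel_braid (X : SMod n s) : lin (k := k) (a := [.up, .up, .up]) (b := [.up, .up, .up])
      ((.gen .cross ⊠ .id [.up] :) ⊚ (.id [.up] ⊠ .gen .cross :) ⊚ (.gen .cross ⊠ .id [.up] :)) X =
    lin (a := [.up, .up, .up]) (b := [.up, .up, .up])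
      ((.id [.up] ⊠ .gen .cross :) ⊚ (.gen .cross ⊠ .id [.up] :) ⊚ (.id [.up] ⊠ .gen .cross :)) X
    := by
  rw [lin_comp, lin_comp, lin_comp, lin_comp, lin_22, lin_id1 _ (.gen .cross), lin_cross, lin_cross]
  refine ext_bas_bas_bas (f := crossL (natMod n s) (tensor (natMod n s) X) ∘ₗ
      TensorProduct.map LinearMap.id (crossL (natMod n s) X) ∘ₗ
      crossL (natMod n s) (tensor (natMod n s) X))
    (g := TensorProduct.map LinearMap.id (crossL (natMod n s) X) ∘ₗ
      crossL (natMod n s) (tensor (natMod n s) X) ∘ₗ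
      TensorProduct.map LinearMap.id (crossL (natMod n s) X)) fun a b c m => ?_
  simp only [LinearMap.comp_apply]
  rw [cross_bas, map_zsmul, map_zsmul, map_tmul, map_tmul, cross_bas, cross_bas, tmul_smul,
    tmul_smul, map_zsmul, map_zsmul, map_zsmul, LinearMap.id_apply, LinearMap.id_apply, cross_bas,
    cross_bas, map_zsmul, map_tmul, LinearMap.id_apply, cross_bas, tmul_smul, smul_smul,
    smul_smul, smul_smul, smul_smul]
  congr 1
  ring

theorem rel_zigzag_up (X : SMod n s) : lin (k := k) (a := [.up]) (b := [.up])
      ((.id [.up] ⊠ .gen .cap :) ⊚ (.gen .cup ⊠ .id [.up] :)) X = lin (.id [.up]) X := by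
  rw [lin_comp, lin_02, lin_id1 _ (.gen .cap), lin_cup, lin_cap, lin_id]
  refine ext_bas (f := TensorProduct.map LinearMap.id (capL X) ∘ₗ cupL (tensor (natMod n s) X))
    (g := LinearMap.id) fun a m => ?_
  rw [LinearMap.comp_apply, cupL_apply, map_sum, Finset.sum_eq_single a]
  · rw [map_tmul, capL_apply, cobas_bas, if_pos rfl, one_smul]; rfl
  · intro b _ hb
    rw [map_tmul, capL_apply, cobas_bas, if_neg hb, zero_smul, tmul_zero]
  · simp

theorem rel_zigzag_down (X : SMod n s) : lin (k := k) (a := [.down]) (b := [.down])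
      ((.gen .cap ⊠ .id [.down] :) ⊚ (.id [.down] ⊠ .gen .cup :)) X = lin (.id [.down]) X := by
  rw [lin_comp, lin_20, lin_id1 _ (.gen .cup), lin_cup, lin_cap, lin_id]
  refine ext_cobas (f := capL (tensor (dual (natMod n s)) X) ∘ₗ
      TensorProduct.map LinearMap.id (cupL X))
    (g := LinearMap.id) fun a m => ?_
  rw [LinearMap.comp_apply, map_tmul, cupL_apply, tmul_sum, map_sum, Finset.sum_eq_single a]
  · rw [LinearMap.id_apply, capL_apply, cobas_bas, if_pos rfl, one_smul]; rfl
  · intro b _ hb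
    rw [LinearMap.id_apply, capL_apply, cobas_bas, if_neg (Ne.symm hb), zero_smul]
  · simp

/-- The linear map of the leftward crossing. -/
def lcrossL (X : SMod n s) : dual (natMod n s) ⊗[k] (natMod n s ⊗[k] X) →ₗ[k]
    natMod n s ⊗[k] (dual (natMod n s) ⊗[k] X) :=
  capL (tensor (natMod n s) (tensor (dual (natMod n s)) X)) ∘ₗ
    TensorProduct.map LinearMap.id (crossL (natMod n s) (tensor (dual (natMod n s)) X)) ∘ₗ
    TensorProduct.map LinearMap.id (TensorProduct.map LinearMap.id (cupL X))

theorem lin_lcross (X : SMod n s) : lin (k := k) lcross X = lcrossL X := by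
  have h1 : lin (k := k) (.id [.down, .up] ⊠ .gen .cup) X =
      lin (k := k) (.id [.down] ⊠ (.id [.up] ⊠ .gen .cup)) X := by
    refine (congrArg toLin (total_id2 _ _ _ X)).trans ?_
    refine Eq.trans ?_ (congrArg toLin (total_id1 _ _ _ X)).symm
    exact congrArg (fun f => toLin ((psiLetter n s .down).map f)) (total_id1 _ _ _ X).symm
  rw [lcross, lin_comp, lin_comp, h1, lin_id1 _ (.tensor (.id _) (.gen .cup)),
    lin_id1 _ (.gen .cup), lin_id1 _ (.tensor (.gen .cross) (.id _)), lin_22, lin_20, lin_cup,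
    lin_cross, lin_cap]
  rfl

theorem lcrossL_apply (X : SMod n s) (a b : Idx n) (m : X) :
    lcrossL X (cobas a ⊗ₜ (bas b ⊗ₜ m)) =
      sg (a.2 * b.2) • (bas (s := s) b ⊗ₜ[k] (cobas (s := s) a ⊗ₜ[k] m)) := by
  rw [lcrossL, LinearMap.comp_apply, LinearMap.comp_apply, map_tmul, map_tmul, map_tmul, cupL_apply, tmul_sum,
    map_sum, tmul_sum, map_sum, Finset.sum_eq_single a]
  · rw [LinearMap.id_apply, LinearMap.id_apply, LinearMap.id_apply, cross_bas, tmul_smul,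
      map_zsmul, capL_apply, cobas_bas, if_pos rfl, one_smul, mul_comm]
  · intro c _ hc
    rw [LinearMap.id_apply, LinearMap.id_apply, LinearMap.id_apply, cross_bas, tmul_smul,
      map_zsmul, capL_apply, cobas_bas, if_neg (Ne.symm hc), zero_smul, smul_zero]
  · simp

theorem rel_rcross_lcross (X : SMod n s) :
    lin (k := k) (.gen .rcross ⊚ lcross) X = lin (.id [.down, .up]) X := by
  rw [lin_comp, lin_rcross, lin_lcross, lin_id]
  refine ext_cobas_bas (f := crossL (dual (natMod n s)) X ∘ₗ lcrossL X) (g := LinearMap.id)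
    fun a b m => ?_
  rw [LinearMap.comp_apply, lcrossL_apply, map_zsmul, cross_cobas, smul_smul, mul_comm b.2,
    sg_mul_self, one_smul]
  rfl

theorem rel_lcross_rcross (X : SMod n s) :
    lin (k := k) (lcross ⊚ .gen .rcross) X = lin (.id [.up, .down]) X := by
  rw [lin_comp, lin_rcross, lin_lcross, lin_id]
  refine ext_bas_cobas (f := lcrossL X ∘ₗ crossL (dual (natMod n s)) X)
    (g := LinearMap.id) fun a b m => ?_
  rw [LinearMap.comp_apply, cross_cobas, map_zsmul, lcrossL_apply, smul_smul, mul_comm b.2,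
    sg_mul_self, one_smul]
  rfl

theorem add_one_add_one (p : ZMod 2) : p + 1 + 1 = p := by revert p; decide

theorem rel_cliff_sq (X : SMod n s) :
    lin (.gen .cliff ⊚ .gen .cliff) X = lin (k := k) (.id [.up]) X := by
  rw [lin_comp, lin_cliff, lin_id]
  refine ext_bas (f := cliffL X ∘ₗ cliffL X) (g := LinearMap.id) fun a m => ?_
  rw [LinearMap.comp_apply, cliffL_bas, map_smul, cliffL_bas, smul_smul, add_one_add_one,
    LinearMap.id_apply]
  dsimp only
  have : (sg a.2 • s.val) * (sg (a.2 + 1) • s.val) = 1 := by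
    rw [smul_mul_smul_comm, s.sq, sg_add, ← mul_assoc, sg_mul_self]
    simp
  rw [this, one_smul]

theorem rel_cliff_cross (X : SMod n s) : lin (k := k) (a := [.up, .up]) (b := [.up, .up])
      (.gen .cross ⊚ (.gen .cliff ⊠ .id [.up] :)) X =
    lin (a := [.up, .up]) (b := [.up, .up]) ((.id [.up] ⊠ .gen .cliff :) ⊚ .gen .cross) X := by
  rw [lin_comp, lin_comp, lin_cross, lin_1id, lin_cliff, lin_id1_cliff]
  refine ext_bas_bas (f := crossL (natMod n s) X ∘ₗ cliffL (tensor (natMod n s) X))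
    (g := TensorProduct.map (natMod n s).par (cliffL X) ∘ₗ crossL (natMod n s) X) fun a b m => ?_
  rw [LinearMap.comp_apply, LinearMap.comp_apply, cliffL_bas, map_smul, cross_bas, cross_bas,
    map_zsmul, map_tmul, cliffL_bas, par_bas, tmul_smul, ← smul_tmul', smul_comm (sg (a.2 * b.2)),
    smul_smul]
  congr 2
  rw [← sg_add]
  congr 1
  ring

/-- The linear map of the rightward cup. -/
def rcupL (X : SMod n s) : X →ₗ[k] dual (natMod n s) ⊗[k] (natMod n s ⊗[k] X) :=
  crossL (dual (natMod n s)) X ∘ₗ cupL X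

theorem lin_rcup (X : SMod n s) : lin (k := k) rcup X = rcupL X := by
  rw [rcup, lin_comp, lin_rcross, lin_cup]
  rfl

theorem rcupL_apply (X : SMod n s) (m : X) : rcupL X m =
    ∑ a : Idx n, sg a.2 • (cobas (s := s) a ⊗ₜ[k] (bas (s := s) a ⊗ₜ[k] m)) := by
  rw [rcupL, LinearMap.comp_apply, cupL_apply, map_sum]
  refine Finset.sum_congr rfl fun a _ => ?_
  have : ∀ p : ZMod 2, p * p = p := by decide
  rw [cross_cobas, this]

theorem cliff_bubble_aux (X : SMod n s) :
    (capL X ∘ₗ TensorProduct.map (dual (natMod n s)).par (cliffL X) ∘ₗ rcupL X : X →ₗ[k] X) = 0 := by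
  refine LinearMap.ext fun m => ?_
  rw [LinearMap.comp_apply, LinearMap.comp_apply, rcupL_apply, map_sum, map_sum]
  refine Finset.sum_eq_zero fun a _ => ?_
  have h : a ≠ (a.1, a.2 + 1) := by
    intro h
    have h1 : ∀ p : ZMod 2, p ≠ p + 1 := by decide
    exact h1 a.2 (congrArg Prod.snd h)
  rw [map_zsmul, map_zsmul, map_tmul, par_cobas, cliffL_bas, tmul_smul, map_smul, ← smul_tmul',
    map_zsmul, capL_apply, cobas_bas, if_neg h, zero_smul, smul_zero, smul_zero, smul_zero]

theorem rel_cliff_bubble (X : SMod n s) : lin (k := k) (a := []) (b := [])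
      (.gen .cap ⊚ (.id [.down] ⊠ .gen .cliff :) ⊚ rcup) X = lin (.zero [] []) X := by
  rw [lin_comp, lin_comp, lin_cap, lin_id1_cliff, lin_rcup, lin_zero]
  exact cliff_bubble_aux X

theorem rel_dot_cliff (X : SMod n s) : lin (k := k) (.gen .dot ⊚ .gen .cliff) X =
    lin (.smul (-1) (.gen .cliff ⊚ .gen .dot)) X := by
  rw [lin_smul, lin_comp, lin_comp, lin_dot, lin_cliff]
  refine ext_bas (f := omegaL X ∘ₗ cliffL X) (g := (-1 : k) • (cliffL X ∘ₗ omegaL X))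
    fun a m => ?_
  obtain ⟨b, p⟩ := a
  rw [LinearMap.comp_apply, LinearMap.smul_apply, LinearMap.comp_apply, cliffL_bas, map_smul,
    omegaL_bas, omegaL_bas, map_sum, Finset.smul_sum, Finset.smul_sum]
  refine Finset.sum_congr rfl fun j _ => ?_
  rw [map_sum, Finset.smul_sum, Finset.smul_sum]
  refine Finset.sum_congr rfl fun ε _ => ?_
  rw [map_zsmul, cliffL_bas]
  dsimp only
  rw [add_right_comm p ε 1]
  generalize (bas (s := s) (j, p + ε + 1) ⊗ₜ[k] X.rho (e s ε b j) m) = y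
  have hn : ∀ (c : k) (y : natMod n s ⊗[k] X), (-c) • y = -(c • y) := fun c y => neg_smul c y
  change _ = (-1 : k) • _
  rcases zmod2_cases p with rfl | rfl <;> rcases zmod2_cases ε with rfl | rfl <;>
    simp [show (1 : ZMod 2) + 1 = 0 from rfl] <;>
    simp [hn]

theorem dot_cross_aux (X : SMod n s) :
    (omegaL (tensor (natMod n s) X) ∘ₗ crossL (natMod n s) X + (-1 : k) •
      (crossL (natMod n s) X ∘ₗ TensorProduct.map LinearMap.id (omegaL X)) :
      natMod n s ⊗[k] (natMod n s ⊗[k] X) →ₗ[k] natMod n s ⊗[k] (natMod n s ⊗[k] X)) =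
    LinearMap.id + (-1 : k) • (cliffL (tensor (natMod n s) X) ∘ₗ
      TensorProduct.map (natMod n s).par (cliffL X)) := by
  refine ext_bas_bas fun a b m => ?_
  obtain ⟨i, p⟩ := a
  obtain ⟨j, r⟩ := b
  have h1 : omegaL (tensor (natMod n s) X) (crossL (natMod n s) X (bas (i, p) ⊗ₜ
      (bas (j, r) ⊗ₜ m))) = (∑ ε, sg (p * r + r * (ε + 1)) •
        (bas (s := s) (i, r + ε) ⊗ₜ[k] (bas (s := s) (j, p + ε) ⊗ₜ[k] m))) +
      crossL (natMod n s) X (bas (i, p) ⊗ₜ omegaL X (bas (j, r) ⊗ₜ m)) := by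
    have e0 : ∀ l ε, (tensor (natMod n s) X).rho (e s ε j l) (bas (i, p) ⊗ₜ m) =
        (if i = l then bas (s := s) (j, p + ε) ⊗ₜ[k] m else 0) +
          sg (p * ε) • (bas (s := s) (i, p) ⊗ₜ[k] X.rho (e s ε j l) m) := by
      intro l ε
      rw [tensor_rho _ _ (e_homog ε j l), rho_e_bas, parPow_bas, ite_tmul, ← smul_tmul']
    have e2 : ∀ l ε, sg (p * r) • sg (r * (ε + 1)) • (bas (s := s) (l, r + ε) ⊗ₜ[k]
        (tensor (natMod n s) X).rho (e s ε j l) (bas (i, p) ⊗ₜ m)) =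
        (if i = l then sg (p * r + r * (ε + 1)) •
          (bas (s := s) (l, r + ε) ⊗ₜ[k] (bas (s := s) (j, p + ε) ⊗ₜ[k] m)) else 0) +
        sg (r * (ε + 1)) • crossL (natMod n s) X (bas (i, p) ⊗ₜ[k]
          (bas (s := s) (l, r + ε) ⊗ₜ[k] X.rho (e s ε j l) m)) := by
      intro l ε
      have hs : ∀ p r ε : ZMod 2, sg (p * r) * sg (r * (ε + 1)) * sg (p * ε) =
        sg (r * (ε + 1)) * sg (p * (r + ε)) := by decide
      rw [e0, cross_bas, tmul_add, smul_add, smul_add, tmul_smul, smul_smul, smul_smul, smul_smul,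
        smul_smul, hs]
      congr 1
      split_ifs
      · rw [← sg_add]
      · rw [tmul_zero, smul_zero]
    have e3 : crossL (natMod n s) X (bas (i, p) ⊗ₜ omegaL X (bas (j, r) ⊗ₜ m)) =
        ∑ l, ∑ ε, sg (r * (ε + 1)) • crossL (natMod n s) X (bas (i, p) ⊗ₜ[k]
          (bas (s := s) (l, r + ε) ⊗ₜ[k] X.rho (e s ε j l) m)) := by
      rw [omegaL_bas, tmul_sum, map_sum]
      refine Finset.sum_congr rfl fun l _ => ?_
      rw [tmul_sum, map_sum]
      refine Finset.sum_congr rfl fun ε _ => ?_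
      rw [tmul_smul, map_zsmul]
    rw [e3, cross_bas, map_zsmul, omegaL_bas, Finset.smul_sum]
    simp only [Finset.smul_sum, e2, Finset.sum_add_distrib]
    congr 1
    rw [Finset.sum_comm]
    simp only [Finset.sum_ite_eq, Finset.mem_univ, if_true]
  have h2 : cliffL (tensor (natMod n s) X) ((natMod n s).par (bas (i, p)) ⊗ₜ
      cliffL X (bas (j, r) ⊗ₜ m)) = -(sg r •
        (bas (s := s) (i, p + 1) ⊗ₜ[k] (bas (s := s) (j, r + 1) ⊗ₜ[k] m))) := by
    rw [par_bas, cliffL_bas, tmul_smul, map_smul, ← smul_tmul', map_zsmul, cliffL_bas,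
      smul_comm (sg p), smul_smul]
    have hs : (sg r • s.val) * (sg p • s.val) = -((sg r * sg p : ℤ) : k) := by
      rw [smul_mul_smul_comm, s.sq, smul_neg, zsmul_eq_mul, mul_one]
    refine (congrArg (· • sg p • (bas (s := s) (i, p + 1) ⊗ₜ[k]
      (bas (s := s) (j, r + 1) ⊗ₜ[k] m))) hs).trans ?_
    generalize (bas (s := s) (i, p + 1) ⊗ₜ[k] (bas (s := s) (j, r + 1) ⊗ₜ[k] m)) = y
    have hn : ∀ (c d : ℤ) (y : natMod n s ⊗[k] (natMod n s ⊗[k] X)),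
        (-(c : k)) • d • y = -((c * d) • y) := fun c d y => by
      refine (neg_smul (c : k) (d • y)).trans (congrArg (-·) ?_)
      exact (Int.cast_smul_eq_zsmul k c (d • y)).trans (smul_smul c d y)
    refine (hn _ _ y).trans ?_
    rw [mul_assoc, sg_mul_self, mul_one]
  rw [LinearMap.add_apply, LinearMap.smul_apply, LinearMap.comp_apply, LinearMap.comp_apply, h1,
    map_tmul, LinearMap.id_apply, LinearMap.add_apply, LinearMap.smul_apply, LinearMap.comp_apply,
    map_tmul, h2, LinearMap.id_apply, neg_smul, one_smul, neg_smul, one_smul, neg_neg,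
    add_neg_cancel_right, sum_zmod2]
  have e1 : (1 : ZMod 2) + 1 = 0 := rfl
  rcases zmod2_cases p with rfl | rfl <;> rcases zmod2_cases r with rfl | rfl <;>
    simp [e1] <;> abel

theorem rel_dot_cross (X : SMod n s) : lin (k := k) (a := [.up, .up]) (b := [.up, .up])
      (.add ((.gen .dot ⊠ .id [.up] :) ⊚ .gen .cross)
        (.smul (-1) (.gen .cross ⊚ (.id [.up] ⊠ .gen .dot :)))) X =
    lin (a := [.up, .up]) (b := [.up, .up])
      (.add (.id [.up, .up]) (.smul (-1) (.gen .cliff ⊠ .gen .cliff :))) X := by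
  rw [lin_add, lin_add, lin_smul, lin_smul, lin_comp, lin_comp, lin_cross, lin_1id, lin_dot,
    lin_id1 _ (.gen .dot), lin_dot, lin_id, lin_11, lin_cliff, lin_id1_cliff]
  exact dot_cross_aux X

/-- The generators satisfy the defining relations. -/
theorem psi_sound {a b : Word} {t t' : Term k a b} (h : Defining t t') :
    psiTerm n s t = psiTerm n s t' := by
  refine psi_ext fun X => ?_
  cases h with
  | cross_sq => exact rel_cross_sq X
  | braid => exact rel_braid X
  | zigzag_up => exact rel_zigzag_up X
  | zigzag_down => exact rel_zigzag_down X
  | rcross_lcross => exact rel_rcross_lcross X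
  | lcross_rcross => exact rel_lcross_rcross X
  | cliff_sq => exact rel_cliff_sq X
  | cliff_cross => exact rel_cliff_cross X
  | cliff_bubble => exact rel_cliff_bubble X
  | dot_cliff => exact rel_dot_cliff X
  | dot_cross => exact rel_dot_cross X

variable (n s) in
/-- The monoidal superfunctor `Ψ` on morphism spaces. -/
def psiMap {a b : Word} (f : AOBC.Hom k a b) :
    SuperNat (obj (psiLetter n s) a) (obj (psiLetter n s) b) :=
  Quot.lift (psiTerm n s) (fun _ _ h => interp_sound _ _ psiGen_isHomog psi_sound h) f

end

end TypeQ

/-! ### The elements `z_m` -/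

namespace TypeQ

open AOBC SMod

section

variable {k : Type u} [Field k] {n : ℕ} {s : SqrtNegOne k}

variable (n s) in
/-- The regular `U(q(n))`-supermodule. -/
def reg : SMod n s where
  carrier := Uq n s
  par := Uq.par.toLinearMap
  par_par := Uq.par_par
  act := Algebra.lmul k (Uq n s)
  par_act a m := map_mul Uq.par a m

variable (n s) in
/-- The component of parity `p` of the supercenter of `U(q(n))`. -/
def supercenterPart (p : ZMod 2) : Submodule k (Uq n s) where
  carrier := {z | z ∈ Uq.part n s p ∧ ∀ r, ∀ a ∈ Uq.part n s r, z * a = sg (p * r) • (a * z)}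
  zero_mem' := ⟨Submodule.zero_mem _, by simp⟩
  add_mem' := fun ha hb => ⟨Submodule.add_mem _ ha.1 hb.1, fun r a h => by
    rw [add_mul, ha.2 r a h, hb.2 r a h, mul_add, smul_add]⟩
  smul_mem' := fun c x hx => ⟨Submodule.smul_mem _ c hx.1, fun r a h => by
    rw [smul_mul_assoc, hx.2 r a h, mul_smul_comm, smul_comm]⟩

variable (n s) in
/-- The image of `1` under the component of `Ψ(Δ_m)` at the regular supermodule. -/
def zElt [NeZero (2 : k)] (m : ℕ) : Uq n s :=
  toLin ((psiMap n s (Delta k m)).total (reg n s)) (1 : Uq n s)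

/-- The sign `sgn(ε_m, …, ε_1)`, given recursively by
`sgn(ε_m, …, ε_1) = (-1)^{(ε_m + 1)(ε_{m-1} + ⋯ + ε_1)} sgn(ε_{m-1}, …, ε_1)`. -/
def sgnSeq : List (ZMod 2) → ℤ
  | [] => 1
  | ε :: l => sg ((ε + 1) * l.sum) * sgnSeq l

variable (s) in
/-- The product `e_{i_{m-1}, i_m}^{ε_m} ⋯ e_{i_1, i_2}^{ε_2} e_{i_m, i_1}^{ε_1}` in `U(q(n))`; the
entry `i t` is `i_{t+1}`, and the index before `i_1` is `i_m`. -/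
def cyclicProd {m : ℕ} (i : Fin m → Fin n) (ε : Fin m → ZMod 2) : Uq n s :=
  ((List.finRange m).reverse.map fun t => Uq.ι (e s (ε t) (i ((finRotate m).symm t)) (i t))).prod

end

end TypeQ

/-! Closing the upward strand of a dotted bubble takes a supertrace. The rightward cup sends x to
the sum of (-1)^{|a|} v_a^* ⊗ v_a ⊗ x over a in I, the m dots apply the m-th power of the Casimir
operator Ω (`omegaL`) on V ⊗ X, and the cap reads off the coefficient of v_a. So Ψ(Δ_m) acts on X by
the supertrace over V of Ω^m, with values in the operators on X, and only the diagonal coefficients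
of Ω^m matter.

One application of Ω moves v_{b,p} to v_{j,p+ε} and hits x with e_{b,j}^ε, with the sign
(-1)^{p(ε+1)} (`omegaL_bas`). Iterating gives a sum over paths b, i_1, …, i_m and parities ε_1, …,
ε_m. At step t the vector has parity p + ε_1 + ⋯ + ε_{t-1}, so the exponent of the sign splits as
p(ε_t+1) + (ε_1 + ⋯ + ε_{t-1})(ε_t+1). The second summands multiply up to sgn(ε_m, …, ε_1), by its
very recursion; the first ones give (-1)^{p(ε_1 + ⋯ + ε_m + m)}. This is `omegaL_pow_bas`.

A path contributes to the diagonal only if it is closed and its parities add up to zero. Then the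
sign that involves p, multiplied by the supertrace sign (-1)^p, is (-1)^{p(m+1)}, and no other
factor depends on p. Summing over both values of p gives 1 + (-1)^{m+1}, which is 2 for odd m and 0
for even m. The computation is the same for every supermodule (`bubbleL_eq_act`), so the bubble acts
through one element `bubbleSum` of U(q), and evaluation at 1 in the regular supermodule identifies
that element with z_m.

Evenness holds because the odd generator γ does not occur in the bubble. For the supercenter, left
multiplication by z_m is then an even endomorphism of the regular supermodule, and its value at a ·
1 can be computed both as z_m a and as a z_m. -/

namespace TypeQ

open TensorProduct AOBC SMod

/-! ### Paths, their signs, and the powers of the Casimir operator -/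

section

variable {k : Type u} [Field k] {n : ℕ} {s : SqrtNegOne k}

variable (s) in
/-- The product `e_{i_{m-1}, i_m}^{ε_m} ⋯ e_{i_1, i_2}^{ε_2} e_{b, i_1}^{ε_1}` in `U(q(n))` along the
path `b, i_1, …, i_m`. -/
def pathProd {m : ℕ} (b : Fin n) (i : Fin m → Fin n) (ε : Fin m → ZMod 2) : Uq n s :=
  ((List.finRange m).reverse.map fun t =>
    Uq.ι (e s (ε t) ((Fin.cons b i : Fin (m + 1) → Fin n) t.castSucc) (i t))).prod

/-- The list of factors is reversed before it is multiplied, so the last step of a path is the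
leftmost factor. Prolonging the path at its far end therefore multiplies on the left, which is how
one more application of the Casimir operator acts. -/
theorem pathProd_snoc {m : ℕ} (b : Fin n) (i : Fin m → Fin n) (ε : Fin m → ZMod 2) (j : Fin n)
    (δ : ZMod 2) :
    pathProd s b (Fin.snoc i j : Fin (m + 1) → Fin n) (Fin.snoc ε δ : Fin (m + 1) → ZMod 2) =
      Uq.ι (e s δ ((Fin.cons b i : Fin (m + 1) → Fin n) (Fin.last m)) j) * pathProd s b i ε := by
  simp only [pathProd, List.finRange_succ_last, List.reverse_append, List.reverse_singleton,
    List.singleton_append, List.map_cons, List.prod_cons, ← List.map_reverse, List.map_map]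
  -- Prepending the start and appending the new end commute. In this form the vertices at positions
  -- `castSucc` are visibly those of the old path, and the new step leaves from its last vertex.
  have h : (Fin.cons b (Fin.snoc i j : Fin (m + 1) → Fin n) : Fin (m + 2) → Fin n) =
      Fin.snoc (Fin.cons b i : Fin (m + 1) → Fin n) j :=
    Fin.cons_snoc_eq_snoc_cons (β := Fin n) b i j
  simp [h, Function.comp_def]

/-- A path that starts at i_m is closed, and its steps are those of the cyclic product. Both
products use the same target i_t and differ only in how they describe the vertex before it: by
prepending the start, or by rotating the indices backwards. The length is a successor so that a last
vertex exists. -/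
theorem pathProd_last {m : ℕ} (i : Fin (m + 1) → Fin n) (ε : Fin (m + 1) → ZMod 2) :
    pathProd s (i (Fin.last m)) i ε = cyclicProd s i ε := by
  unfold pathProd cyclicProd
  congr 2
  funext t
  congr 3
  -- Only the predecessor indices remain to be compared. At position 0 the rotation wraps around to
  -- the last entry, which is the chosen start; at u + 1 both descriptions give entry u.
  refine Fin.cases ?_ (fun u => ?_) t
  · have h : (finRotate (m + 1)).symm 0 = Fin.last m := by
      rw [Equiv.symm_apply_eq, finRotate_last]
    rw [h]; rfl
  · have h : (finRotate (m + 1)).symm u.succ = u.castSucc := by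
      rw [Equiv.symm_apply_eq, finRotate_apply, Fin.coeSucc_eq_succ]
    rw [h, ← Fin.succ_castSucc, Fin.cons_succ]

/-- `sgnSeq` expects the most recent parity at the head, so the family is reversed. The new parity
then becomes the head and the recursion of `sgnSeq` applies once; the sum of the tail does not
notice the reversal. -/
theorem sgnSeq_snoc {m : ℕ} (ε : Fin m → ZMod 2) (δ : ZMod 2) :
    sgnSeq (List.ofFn (Fin.snoc ε δ : Fin (m + 1) → ZMod 2)).reverse =
      sg ((δ + 1) * ∑ t, ε t) * sgnSeq (List.ofFn ε).reverse := by
  rw [List.ofFn_succ', List.concat_eq_append, List.reverse_append]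
  simp [sgnSeq, List.sum_reverse, List.sum_ofFn]

/-- The last coordinate is split off, rather than the first, because an induction on the number of
dots adds its new step at the end of the path. It serves for the vertices and for the parities
alike. -/
theorem sum_snoc {A α : Type*} [AddCommMonoid A] [Fintype α] {m : ℕ} (f : (Fin (m + 1) → α) → A) :
    ∑ i, f i = ∑ i : Fin m → α, ∑ j, f (Fin.snoc i j) := by
  rw [Finset.sum_comm, ← Fintype.sum_prod_type']
  exact ((Fin.snocEquiv fun _ => α).sum_comp f).symm

/-- Iterating the Casimir operator gives a sum over paths. -/
theorem omegaL_pow_bas (X : SMod n s) (m : ℕ) (b : Fin n) (p : ZMod 2) (x : X) :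
    (omegaL X ^ m) (bas (b, p) ⊗ₜ[k] x) = ∑ i : Fin m → Fin n, ∑ ε : Fin m → ZMod 2,
      (sg (p * (∑ t, ε t + m)) * sgnSeq (List.ofFn ε).reverse) •
        (bas (s := s) ((Fin.cons b i : Fin (m + 1) → Fin n) (Fin.last m), p + ∑ t, ε t) ⊗ₜ[k]
          X.act (pathProd s b i ε) x) := by
  induction m with
  -- The only path of length zero ends where it starts, its product is empty, and both signs are 1.
  | zero => simp [pathProd, sgnSeq]
  | succ m ih =>
    -- The additional factor is put on the left of the power, so it acts after the paths of length m
    -- have been summed and starts from their end vertex and accumulated parity.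
    rw [pow_succ', Module.End.mul_apply, ih, sum_snoc, map_sum]
    refine Finset.sum_congr rfl fun i _ => ?_
    simp only [sum_snoc (α := ZMod 2)]
    rw [map_sum, Finset.sum_comm]
    refine Finset.sum_congr rfl fun ε _ => ?_
    rw [map_zsmul, omegaL_bas, Finset.smul_sum]
    refine Finset.sum_congr rfl fun j _ => ?_
    rw [Finset.smul_sum]
    refine Finset.sum_congr rfl fun δ _ => ?_
    have h : (Fin.cons b (Fin.snoc i j : Fin (m + 1) → Fin n) : Fin (m + 2) → Fin n) =
        Fin.snoc (Fin.cons b i : Fin (m + 1) → Fin n) j :=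
      Fin.cons_snoc_eq_snoc_cons (β := Fin n) b i j
    -- Here p is the initial parity, S the sum of the earlier parities, δ the new one and M the
    -- earlier length. The sign of the new step is (-1)^{(p+S)(δ+1)}. Its part p(δ+1) turns p(S+M)
    -- into p(S+δ+M+1), and its part S(δ+1) is the new factor of the sign sequence.
    have hs : ∀ p S δ M : ZMod 2, sg (p * (S + δ + (M + 1))) * sg ((δ + 1) * S) =
        sg (p * (S + M)) * sg ((p + S) * (δ + 1)) := by decide
    rw [pathProd_snoc, sgnSeq_snoc, h, Fin.snoc_last, Fin.sum_snoc, smul_smul, map_mul, act_ι,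
      Module.End.mul_apply, ← add_assoc p, Nat.cast_succ, ← mul_assoc, hs, mul_right_comm]

end

/-! ### The bubble as a supertrace -/

section

variable {k : Type u} [Field k] [NeZero (2 : k)] {n : ℕ} {s : SqrtNegOne k}

/-- Parity zero is what `lin_id1` requires in order that placing a downward strand to the left of
the dots introduces no sign. -/
theorem hasParity_dots (m : ℕ) : HasParity 0 (dots m : Term k [.up] [.up]) := by
  induction m with
  | zero => exact .id _
  -- The index of a composite is a sum of parities; fixing both summands as 0 lets 0 + 0 reduce to 0
  -- by computation.
  | succ m ih => exact .comp (p := 0) (q := 0) (.gen .dot) ih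

/-- The cup, the rightward crossing, the dots and the cap are all even, since the white dot is the
only odd generator. Through `interp_isHomog` this gives the evenness of Ψ(Δ_m). -/
theorem hasParity_bubbleTerm (m : ℕ) : HasParity 0 (bubbleTerm m : Term k [] []) :=
  .comp (p := 0) (q := 0) (.gen .cap) (.comp (p := 0) (q := 0)
    (.tensor (p := 0) (q := 0) (.id _) (hasParity_dots m))
    (.comp (p := 0) (q := 0) (.gen .rcross) (.gen .cup)))

theorem lin_dots (m : ℕ) (X : SMod n s) : lin (k := k) (dots m) X = omegaL X ^ m := by
  induction m with
  | zero => exact lin_id _ X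
  | succ m ih =>
    rw [dots, lin_comp, lin_dot, ih, pow_succ']
    rfl

/-- The linear map of the bubble with `m` dots. -/
def bubbleL (m : ℕ) (X : SMod n s) : X →ₗ[k] X :=
  capL X ∘ₗ TensorProduct.map LinearMap.id (omegaL X ^ m) ∘ₗ rcupL X

theorem lin_bubbleTerm (m : ℕ) (X : SMod n s) : lin (k := k) (bubbleTerm m) X = bubbleL m X := by
  rw [bubbleTerm, lin_comp, lin_comp, lin_cap, lin_id1 _ (hasParity_dots m), lin_dots, lin_rcup]
  rfl

/-- This is the supertrace formula. The cup creates the terms v_a ⊗ v_a^*, and the rightward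
crossing exchanges two vectors of equal parity |a|, at the cost of (-1)^{|a||a|} = (-1)^{|a|}. The
cap pairs v_a^* with the first tensor factor of Ω^m (v_a ⊗ x). -/
theorem bubbleL_apply (m : ℕ) (X : SMod n s) (x : X) : bubbleL m X x =
    ∑ a : Idx n, sg a.2 • capL X (cobas (s := s) a ⊗ₜ[k] (omegaL X ^ m) (bas a ⊗ₜ[k] x)) := by
  rw [bubbleL, LinearMap.comp_apply, LinearMap.comp_apply, rcupL_apply, map_sum, map_sum]
  refine Finset.sum_congr rfl fun a _ => ?_
  rw [map_zsmul, map_zsmul, TensorProduct.map_tmul]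
  rfl

variable (s) in
/-- The sum over closed paths by which the bubble with `m` dots acts. -/
def bubbleSum (n m : ℕ) : Uq n s :=
  (∑ p : ZMod 2, sg (p * (m + 1))) • ∑ i : Fin m → Fin n, ∑ ε : Fin m → ZMod 2 with ∑ t, ε t = 0,
    ∑ b : Fin n with b = (Fin.cons b i : Fin (m + 1) → Fin n) (Fin.last m),
      sgnSeq (List.ofFn ε).reverse • pathProd s b i ε

/-- Inserting the path expansion into the supertrace leaves the paths that return to their starting
basis vector: the vertex must return, and the total parity must vanish. What remains besides the
sign (-1)^{p(m+1)} is an element of U(q) that depends neither on p nor on the supermodule, so the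
same element works for all of them. -/
theorem bubbleL_eq_act (m : ℕ) (X : SMod n s) : bubbleL m X = X.act (bubbleSum s n m) := by
  refine LinearMap.ext fun x => ?_
  -- The contribution of a single basis vector is written with p confined to the scalar in front.
  -- The two conditions for a nonzero pairing, on the total parity and on the end vertex, become two
  -- separate case distinctions, matching the two filtered sums in `bubbleSum`.
  have key : ∀ b p, sg p • capL X (cobas (s := s) (b, p) ⊗ₜ[k]
      (omegaL X ^ m) (bas (b, p) ⊗ₜ[k] x)) = sg (p * (m + 1)) •
      ∑ i : Fin m → Fin n, ∑ ε : Fin m → ZMod 2, if ∑ t, ε t = 0 then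
        (if b = (Fin.cons b i : Fin (m + 1) → Fin n) (Fin.last m) then
          sgnSeq (List.ofFn ε).reverse • X.act (pathProd s b i ε) x else 0) else 0 := by
    intro b p
    rw [omegaL_pow_bas, tmul_sum, map_sum, Finset.smul_sum, Finset.smul_sum]
    refine Finset.sum_congr rfl fun i _ => ?_
    rw [tmul_sum, map_sum, Finset.smul_sum, Finset.smul_sum]
    refine Finset.sum_congr rfl fun ε _ => ?_
    rw [tmul_smul, map_zsmul, capL_apply, cobas_bas]
    by_cases h0 : ∑ t, ε t = 0
    · by_cases hb : b = (Fin.cons b i : Fin (m + 1) → Fin n) (Fin.last m)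
      -- The factor (-1)^p comes from the supertrace and (-1)^{pM} from `omegaL_pow_bas` at total
      -- parity zero, with M the number of dots modulo 2.
      · have hs : ∀ p M : ZMod 2, sg p * sg (p * M) = sg (p * (M + 1)) := by decide
        rw [if_pos h0, if_pos hb, if_pos (by rw [h0, add_zero, ← hb]), one_smul, h0, zero_add,
          smul_smul, smul_smul, ← mul_assoc, hs]
      -- A path that ends at a vertex other than b produces a basis vector orthogonal to the dual
      -- vector.
      · rw [if_pos h0, if_neg hb, if_neg (fun h => hb (congrArg Prod.fst h)), zero_smul,
          smul_zero, smul_zero, smul_zero]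
    -- With nonzero total parity the resulting basis vector has parity different from p, so the
    -- pairing vanishes whatever its vertex is.
    · rw [if_neg h0, if_neg (fun h => h0 (left_eq_add.1 (congrArg Prod.snd h))), zero_smul,
        smul_zero, smul_zero, smul_zero]
  -- The sum over I becomes a sum over the vertex b and the parity p. After the exchange of the two,
  -- the inner sum over b is the same for both p, and the signs can be added up by themselves.
  rw [bubbleL_apply, Fintype.sum_prod_type]
  simp only [key]
  rw [Finset.sum_comm]
  simp only [← Finset.smul_sum]
  rw [← Finset.sum_smul, bubbleSum, map_zsmul, LinearMap.smul_apply, map_sum, LinearMap.sum_apply,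
    Finset.sum_comm]
  -- The scalars now agree. The remaining sums are matched term by term, after the sum over b has
  -- been moved inside those over the vertices and the parities of the path.
  congr 1
  refine Finset.sum_congr rfl fun i _ => ?_
  rw [Finset.sum_comm, map_sum, LinearMap.sum_apply, Finset.sum_filter]
  refine Finset.sum_congr rfl fun ε _ => ?_
  split_ifs
  · rw [map_sum, LinearMap.sum_apply, Finset.sum_filter]
    refine Finset.sum_congr rfl fun b _ => ?_
    rw [map_zsmul, LinearMap.smul_apply]
  · exact Finset.sum_const_zero

/-- Starting vectors of parity 0 and of parity 1 contribute with opposite signs, so the integer in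
front is 1 - 1 and the sum over closed paths need not be examined. For m = 0 this is the vanishing
of the superdimension of V. -/
theorem bubbleSum_of_even {m : ℕ} (hm : Even m) : bubbleSum s n m = 0 := by
  have h : (m : ZMod 2) = 0 := (ZMod.natCast_eq_zero_iff_even).2 hm
  simp [bubbleSum, sum_zmod2, h]

/-- Here the two parities of the starting vector contribute equally, which is the origin of the
factor 2. Since m is positive, a closed path is determined by its entries i_1, …, i_m: its start is
i_m, so the sum over b has a single term, and the path product becomes the cyclic one. -/
theorem bubbleSum_of_odd {m : ℕ} (hm : Odd m) : bubbleSum s n m =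
    2 • ∑ i : Fin m → Fin n, ∑ ε : Fin m → ZMod 2 with ∑ t, ε t = 0,
      sgnSeq (List.ofFn ε).reverse • cyclicProd s i ε := by
  have h : (m : ZMod 2) = 1 := (ZMod.natCast_eq_one_iff_odd).2 hm
  -- An odd number is positive; the successor form provides the last entry i_m as `i (Fin.last l)`.
  obtain ⟨l, rfl⟩ : ∃ l, m = l + 1 := Nat.exists_eq_succ_of_ne_zero hm.pos.ne'
  -- As the number of dots is 1 modulo 2, the exponent p(m+1) vanishes for both p and the signs add
  -- up to the integer 2.
  have hs : ∑ p : ZMod 2, sg (p * (((l + 1 : ℕ) : ZMod 2) + 1)) = 2 := by rw [h]; decide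
  rw [bubbleSum, hs, ofNat_zsmul]
  congr 1
  refine Finset.sum_congr rfl fun i _ => Finset.sum_congr rfl fun ε _ => ?_
  -- The last position of a nonempty path lies beyond its start, so the end vertex does not depend
  -- on b. The closing condition b = end therefore selects exactly one value of b.
  have hl : ∀ b, (Fin.cons b i : Fin (l + 2) → Fin n) (Fin.last (l + 1)) = i (Fin.last l) :=
    fun b => rfl
  simp only [hl, ← pathProd_last, Finset.filter_eq', Finset.mem_univ, if_true,
    Finset.sum_singleton]

/-! ### The elements z_m, their supercentrality, and the theorem -/

theorem toLin_Delta (m : ℕ) (M : SMod n s) :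
    (toLin ((psiMap n s (Delta k m)).total M) : M →ₗ[k] M) = M.act (bubbleSum s n m) :=
  -- The value of `psiMap` at the class of an expression is, by computation of the quotient lift,
  -- `psiTerm` of that expression, so the formula for `bubbleTerm` applies as it stands.
  (lin_bubbleTerm m M).trans (bubbleL_eq_act m M)

/-- On the regular supermodule the action is left multiplication, and an element is recovered from
its left multiplication by evaluating at 1. -/
theorem zElt_eq_bubbleSum (m : ℕ) : zElt n s m = bubbleSum s n m :=
  (LinearMap.congr_fun (toLin_Delta m (reg n s)) (1 : Uq n s)).trans
    (mul_one (bubbleSum s n m : Uq n s))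

/-- The component of Ψ(Δ_m) at the regular supermodule is an even endomorphism f. It preserves
parity, so f(1) is even because 1 is. It also commutes with left multiplication, while by the
explicit formula it is itself left multiplication by z_m; together these give z_m a = f(a · 1) = a
f(1) = a z_m. -/
theorem zElt_mem_supercenterPart (m : ℕ) : zElt n s m ∈ supercenterPart n s 0 := by
  -- Morphisms carry an even and an odd component. Here the odd one is zero, so the underlying
  -- linear map is the even component and inherits its equivariance.
  have hod : od ((psiMap n s (Delta k m)).total (reg n s)) = 0 :=
    od_of_hasParity (hasParity_bubbleTerm m) _
  have hf : toLin ((psiMap n s (Delta k m)).total (reg n s)) ∈ homPart (reg n s) (reg n s) 0 := by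
    rw [toLin, hod, add_zero]
    exact ev_mem _
  have h1 : Uq.par (1 : Uq n s) = sg 0 • 1 := by rw [map_one, sg_zero, one_smul]
  -- Preservation of parity places f(1) in degree 0 + 0, which computes to 0.
  refine ⟨hf.1 0 (1 : Uq n s) h1, fun r a ha => ?_⟩
  have h2 : ∀ u : Uq n s, toLin ((psiMap n s (Delta k m)).total (reg n s)) u =
      (zElt n s m * u : Uq n s) := fun u => by
    rw [zElt_eq_bubbleSum]
    exact LinearMap.congr_fun (toLin_Delta m (reg n s)) u
  -- The value at a · 1 is written in two ways: by the multiplication formula and by equivariance.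
  -- The sign (-1)^{0·r} from equivariance is literally the one in the definition of the even part
  -- of the supercenter.
  have h3 := ((h2 _).symm.trans (hf.2 r a ha (1 : Uq n s)))
  change zElt n s m * (a * 1) = sg (0 * r) • (a * zElt n s m) at h3
  rwa [mul_one] at h3

end

end TypeQ

/-- The number of dots is m, since k denotes the field, and the hypothesis on the characteristic
takes the form `NeZero (2 : k)`. Entry t of `i` and of `ε` stands for i_{t+1} and ε_{t+1}; the
reversal makes `sgnSeq` read the parities from ε_m down to ε_1. -/
theorem mainTheorem11 {k : Type u} [Field k] [NeZero (2 : k)] (s : TypeQ.SqrtNegOne k) (n m : ℕ) :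
    (TypeQ.psiMap n s (AOBC.Delta k m)).IsHomog 0 ∧
    (∀ M : TypeQ.SMod n s, TypeQ.SMod.toLin ((TypeQ.psiMap n s (AOBC.Delta k m)).total M) =
      M.act (TypeQ.zElt n s m)) ∧
    TypeQ.zElt n s m ∈ TypeQ.supercenterPart n s 0 ∧
    (Odd m → TypeQ.zElt n s m =
      2 • ∑ i : Fin m → Fin n, ∑ ε : Fin m → ZMod 2 with ∑ t, ε t = 0,
        TypeQ.sgnSeq (List.ofFn ε).reverse • TypeQ.cyclicProd s i ε) ∧
    (Even m → TypeQ.zElt n s m = 0) := by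
  -- Evenness is read off from the expression that represents the bubble. The formulas and the
  -- action on an arbitrary M are statements about `bubbleSum` once z_m has been identified with it.
  refine ⟨AOBC.interp_isHomog _ _ TypeQ.psiGen_isHomog (TypeQ.hasParity_bubbleTerm m),
    fun M => ?_, TypeQ.zElt_mem_supercenterPart m, fun hm => ?_, fun hm => ?_⟩
  · rw [TypeQ.zElt_eq_bubbleSum]
    exact TypeQ.toLin_Delta m M
  · rw [TypeQ.zElt_eq_bubbleSum, TypeQ.bubbleSum_of_odd hm]
  · rw [TypeQ.zElt_eq_bubbleSum, TypeQ.bubbleSum_of_even hm]
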